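/- Let $q=e^{2\pi i/3}$, let $a,b,c\ge 0$ be integers and $n=a+b+c$. *Loop model.* Consider the complex vector space with basis the non-crossing link patterns (non-crossing perfect matchings) $\pi$ of $2n$ points numbered $1,\dots,2n$ in cyclic order on a circle. For $t,z_1,\dots,z_{2n}\in\mathbb C$ with $qt-q^{-1}z_i\ne0$, the transfer matrix $T_n(t|z_1,\dots,z_{2n})$ acts by adding around a link pattern a circular strip of $2n$ plaquettes and discarding closed loops. Plaquette $i$ has an inner edge (glued to point $i$), an outer edge (the new point $i$), a side shared with plaquette $i-1$ and a side shared with plaquette $i+1$ (indices mod $2n$). Independently for each $i$, with weight $\frac{qz_i-q^{-1}t}{qt-q^{-1}z_i}$ the plaquette joins its inner edge to the side shared with $i+1$ and its outer edge to the side shared with $i-1$; with weight $\frac{z_i-t}{qt-q^{-1}z_i}$ it joins its inner edge to the side shared with $i-1$ and its outer edge to the side shared with $i+1$. There is exactly one family $\Psi_n=(\Psi_{n,\pi})_\pi$ of polynomials in $\mathbb C[z_1,\dots,z_{2n}]$ such that (i) $T_n(t|z)\Psi_n(z)=\Psi_n(z)$ for all $t,z$ as above, (ii) the $\Psi_{n,\pi}$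 have no common non-constant factor (and are not all zero), and (iii) the component of the link pattern of $n$ nested arches $i\leftrightarrow 2n+1-i$ takes the value $3^{n(n-1)/2}$ at $z_1=\dots=z_{2n}=1$. *Three sets of nested arches.* Put $$(z_1,\dots,z_{2n})=(q^2\gamma_1,\dots,q^2\gamma_{a+b},\;q\beta_1,\dots,q\beta_{a+c},\;\alpha_1,\dots,\alpha_{b+c}),$$ and let $\Psi_{a,b,c}\in\mathbb C[\alpha,\beta,\gamma]$ be the component of $\Psi_n$, in these variables, on the link pattern with $a$ nested arches between the last $a$ of the $\gamma$ points and the first $a$ of the $\beta$ points, $c$ nested arches between the last $c$ of the $\beta$ points and the first $c$ of the $\alpha$ points, and $b$ nested arches between the last $b$ of the $\alpha$ points and the first $b$ of the $\gamma$ points. Let $\varepsilon_{a,b,c}=(-1)^{n(n-1)/2+ab}\,q^{\,b(a+b-1)+2c(a+c-1)}$. Then there is exactly one polynomial $\Phi_{a,b,c}\in\mathbb C[\alpha,\beta,\gamma]$ with $$\Psi_{a,b,c}=\varepsilon_{a,b,c}\prod_{1\le i<j\le b+c}(q\alpha_i-q^{-1}\alpha_j)\prod_{1\le i<j\le a+c}(q\beta_i-q^{-1}\beta_j)\prod_{1\le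 i<j\le a+b}(q\gamma_i-q^{-1}\gamma_j)\;\Phi_{a,b,c}.$$ *Lozenge tilings.* In the plane with oblique coordinates $(x,y)$ and the triangular lattice of lines $x\in\mathbb Z$, $y\in\mathbb Z$, $x+y\in\mathbb Z$, take the $a\times b\times c$ hexagon $0\le x\le b+c$, $0\le y\le a+c$, $c\le x+y\le a+b+c$. Attach $\alpha_i$ to the strip $i-1<x<i$, $\beta_j$ to the strip $j-1<y<j$ and $\gamma_k$ to the strip $c+k-1<x+y<c+k$ (that is, to the middle lines of these strips). A lozenge is the union of two unit triangles with a common edge; it is the intersection of two strips in different directions, whose middle lines cross at its centre, and it has weight $\alpha_i-\beta_j$, $\gamma_k-\beta_j$ or $\alpha_i-\gamma_k$ if these strips carry $\alpha_i,\beta_j$, resp. $\gamma_k,\beta_j$, resp. $\alpha_i,\gamma_k$. Let $Z_{a,b,c}$ be the sum, over all tilings of the hexagon by lozenges, of the product of the weights of the lozenges. Then $$\Phi_{a,b,c}=Z_{a,b,c}.$$ -/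

import Mathlib

noncomputable section

namespace LoopModel

/-! ### Link patterns -/

/-- A non-crossing link pattern on `2n` points of a circle, numbered `0, …, 2n-1` in cyclic
order: a pairing of the points such that no two pairs cross. -/
@[ext]
structure LinkPattern (n : ℕ) where
  /-- the point to which a given point is linked -/
  partner : Fin (2 * n) → Fin (2 * n)
  partner_partner : ∀ i, partner (partner i) = i
  partner_ne : ∀ i, partner i ≠ i
  noncrossing : ∀ i j, ¬ (i < j ∧ j < partner i ∧ partner i < partner j)

instance (n : ℕ) : Finite (LinkPattern n) :=
  Finite.of_injective LinkPattern.partner fun _ _ h => LinkPattern.ext h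

instance (n : ℕ) : Fintype (LinkPattern n) := Fintype.ofFinite _

/-! ### The transfer matrix of the inhomogeneous O(1) loop model -/

/-- The cube root of unity `q = exp(2πi/3)`. -/
def q : ℂ := Complex.exp (2 * Real.pi * Complex.I / 3)

/-- Midpoints of the edges of the circular strip of `N` plaquettes. Plaquette `i` has the four
edges `inner i`, `outer i`, `side i` and `side (i + 1)`, the index of `side` being cyclic. -/
inductive StripEdge (N : ℕ) where
  | inner (i : Fin N)
  | outer (i : Fin N)
  | side (i : Fin N)

/-- The elementary connections in the strip glued around the link pattern `π`. The configuration
`S` tells for each `i` which of the two plaquettes is inserted at `i`: the first one (`true`)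
joins the inner edge to the following side and the outer edge to the preceding side; the second
one (`false`) joins the inner edge to the preceding side and the outer edge to the following
side. -/
inductive StripLink {n : ℕ} (S : Fin (2 * n) → Bool) (π : LinkPattern n) :
    StripEdge (2 * n) → StripEdge (2 * n) → Prop
  | arch (i : Fin (2 * n)) : StripLink S π (.inner i) (.inner (π.partner i))
  | firstInner (i : Fin (2 * n)) (h : S i = true) :
      StripLink S π (.inner i) (.side (finRotate (2 * n) i))
  | firstOuter (i : Fin (2 * n)) (h : S i = true) :
      StripLink S π (.outer i) (.side i)
  | secondInner (i : Fin (2 * n)) (h : S i = false) :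
      StripLink S π (.inner i) (.side i)
  | secondOuter (i : Fin (2 * n)) (h : S i = false) :
      StripLink S π (.outer i) (.side (finRotate (2 * n) i))

/-- `π'` is the link pattern obtained on the outer circle by adding the strip `S` around `π`
and following the lines (closed loops are discarded). -/
def IsResult {n : ℕ} (S : Fin (2 * n) → Bool) (π π' : LinkPattern n) : Prop :=
  ∀ i : Fin (2 * n),
    Relation.EqvGen (StripLink S π) (.outer i) (.outer (π'.partner i))

/-- The weight of a plaquette with horizontal parameter `t` and vertical parameter `w`. -/
def plaquetteWeight (t w : ℂ) : Bool → ℂ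
  | true => (q * w - q⁻¹ * t) / (q * t - q⁻¹ * w)
  | false => (w - t) / (q * t - q⁻¹ * w)

open scoped Classical in
/-- The transfer matrix `T_n(t | z_1, …, z_{2n})`; the column index is the initial link pattern,
the row index the resulting one. -/
def transferMatrix (n : ℕ) (t : ℂ) (z : Fin (2 * n) → ℂ) :
    Matrix (LinkPattern n) (LinkPattern n) ℂ :=
  fun π' π => ∑ S : Fin (2 * n) → Bool,
    (∏ i, plaquetteWeight t (z i) (S i)) * (if IsResult S π π' then 1 else 0)

/-- The link pattern made of `n` nested arches, `i ↔ 2n - 1 - i`. -/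
def nested (n : ℕ) : LinkPattern n where
  partner := Fin.rev
  partner_partner := Fin.rev_rev
  partner_ne i h := by
    have := congrArg Fin.val h
    simp only [Fin.val_rev] at this
    omega
  noncrossing i j h := by
    simp only [Fin.lt_def, Fin.val_rev] at h
    omega

/-- `Ψ` is the ground state of the inhomogeneous O(1) loop model of size `2n`: an eigenvector of
all the transfer matrices with eigenvalue `1`, whose components are collectively coprime
polynomials in `z_1, …, z_{2n}`; the remaining numerical constant is fixed by the value of the
component of `n` nested arches at `z_1 = ⋯ = z_{2n} = 1`. -/
structure IsGroundState (n : ℕ) (Ψ : LinkPattern n → MvPolynomial (Fin (2 * n)) ℂ) : Prop where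
  eigenvector : ∀ (t : ℂ) (z : Fin (2 * n) → ℂ), (∀ i, q * t - q⁻¹ * z i ≠ 0) →
    (transferMatrix n t z).mulVec (fun π => MvPolynomial.eval z (Ψ π)) =
      fun π => MvPolynomial.eval z (Ψ π)
  coprime : ∀ d : MvPolynomial (Fin (2 * n)) ℂ, (∀ π, d ∣ Ψ π) → IsUnit d
  normalized : MvPolynomial.eval (fun _ => 1) (Ψ (nested n)) = 3 ^ (n * (n - 1) / 2)

/-! ### Three sets of nested arches -/

/-- The partner of the point `i` in the link pattern with three sets of nested arches. -/
def threePartner (a b c i : ℕ) : ℕ :=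
  if i < b then 2 * (a + b + c) - 1 - i
  else if i < b + 2 * a then 2 * b + 2 * a - 1 - i
  else if i < b + 2 * a + 2 * c then 2 * b + 4 * a + 2 * c - 1 - i
  else 2 * (a + b + c) - 1 - i

theorem threePartner_lt (a b c : ℕ) (i : Fin (2 * (a + b + c))) :
    threePartner a b c i < 2 * (a + b + c) := by
  have := i.2
  unfold threePartner
  split_ifs <;> omega

/-- The link pattern with three sets of nested arches. Going around the circle one meets `a + b`
points (carrying the parameters `γ`), then `a + c` points (`β`), then `b + c` points (`α`);
there are `a` nested arches between the `γ` and the `β` points, `c` between the `β` and the `α`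
points, and `b` between the `α` and the `γ` points. -/
def threeArches (a b c : ℕ) : LinkPattern (a + b + c) where
  partner i := ⟨threePartner a b c i, threePartner_lt a b c i⟩
  partner_partner i := by
    have := i.2
    apply Fin.ext
    simp only [threePartner]
    split_ifs <;> omega
  partner_ne i h := by
    have h' := congrArg Fin.val h
    have := i.2
    simp only [threePartner] at h'
    split_ifs at h' <;> omega
  noncrossing i j h := by
    have := i.2
    have := j.2
    simp only [Fin.lt_def, threePartner] at h
    split_ifs at h <;> omega

/-- Polynomials in the parameters `α_1, …, α_{b+c}`, `β_1, …, β_{a+c}`, `γ_1, …, γ_{a+b}`. -/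
abbrev ParamPoly (a b c : ℕ) : Type :=
  MvPolynomial (Fin (b + c) ⊕ Fin (a + c) ⊕ Fin (a + b)) ℂ

/-- The parameter `α_{i+1}`. -/
def α {a b c : ℕ} (i : Fin (b + c)) : ParamPoly a b c := MvPolynomial.X (.inl i)

/-- The parameter `β_{j+1}`. -/
def β {a b c : ℕ} (j : Fin (a + c)) : ParamPoly a b c := MvPolynomial.X (.inr (.inl j))

/-- The parameter `γ_{k+1}`. -/
def γ {a b c : ℕ} (k : Fin (a + b)) : ParamPoly a b c := MvPolynomial.X (.inr (.inr k))

/-- The spectral parameters: `(z_1, …, z_{2n})` is the concatenation of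
`(q² γ_1, …, q² γ_{a+b})`, `(q β_1, …, q β_{a+c})` and `(α_1, …, α_{b+c})`. -/
def spectral (a b c : ℕ) (p : Fin (2 * (a + b + c))) : ParamPoly a b c :=
  if h₁ : p.val < a + b then MvPolynomial.C (q ^ 2) * γ ⟨p.val, h₁⟩
  else if h₂ : p.val - (a + b) < a + c then MvPolynomial.C q * β ⟨p.val - (a + b), h₂⟩
  else α ⟨p.val - (a + b) - (a + c), by have := p.2; omega⟩

/-- `∏_{i<j} (q x_i - q⁻¹ x_j)`. -/
def qVandermonde {σ : Type*} {m : ℕ} (x : Fin m → MvPolynomial σ ℂ) : MvPolynomial σ ℂ :=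
  ∏ p : Fin m × Fin m with p.1 < p.2,
    (MvPolynomial.C q * x p.1 - MvPolynomial.C q⁻¹ * x p.2)

/-- The root of unity `(-1)^{n(n-1)/2 + ab} q^{b(a+b-1) + 2c(a+c-1)}`, `n = a + b + c`. -/
def phase (a b c : ℕ) : ℂ :=
  (-1) ^ ((a + b + c) * (a + b + c - 1) / 2 + a * b) *
    q ^ (b * (a + b - 1) + 2 * (c * (a + c - 1)))

/-- `Φ` is the reduced polynomial of the component of `Ψ` on the link pattern `(a, b, c)`:
the quotient of that component by its explicit factors. -/
def IsReducedComponent (a b c : ℕ)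
    (Ψ : LinkPattern (a + b + c) → MvPolynomial (Fin (2 * (a + b + c))) ℂ)
    (Φ : ParamPoly a b c) : Prop :=
  MvPolynomial.aeval (spectral a b c) (Ψ (threeArches a b c)) =
    MvPolynomial.C (phase a b c) *
      (qVandermonde (α : Fin (b + c) → ParamPoly a b c) *
        qVandermonde (β : Fin (a + c) → ParamPoly a b c) *
        qVandermonde (γ : Fin (a + b) → ParamPoly a b c)) * Φ

/-! ### Lozenge tilings of the hexagon -/

/-- Unit triangles of the `a × b × c` hexagon. In oblique coordinates `(x, y)` of the plane, the
triangular lattice has the lines `x ∈ ℤ`, `y ∈ ℤ`, `x + y ∈ ℤ`, and the hexagon is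
`0 ≤ x ≤ b + c`, `0 ≤ y ≤ a + c`, `c ≤ x + y ≤ a + b + c`. The triple `(i, j, k)` stands for the
triangle lying in the three strips `i < x < i + 1`, `j < y < j + 1` and
`k + c < x + y < k + c + 1`; these strips have a common point if and only if
`k + c = i + j` or `k + c = i + j + 1` (the two orientations of triangles). The middle lines of
the strips carry the parameters `α_{i+1}`, `β_{j+1}` and `γ_{k+1}`. -/
abbrev Triangle (a b c : ℕ) : Type :=
  {t : Fin (b + c) × Fin (a + c) × Fin (a + b) //
    (t.2.2 : ℕ) + c = t.1 + t.2.1 ∨ (t.2.2 : ℕ) + c = t.1 + t.2.1 + 1}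

/-- A lozenge is given by the two lines that cross at its centre: `ab i j` is the intersection
of the strips of `α_{i+1}` and `β_{j+1}`, and so on. -/
inductive Lozenge (a b c : ℕ) where
  | ab (i : Fin (b + c)) (j : Fin (a + c))
  | cb (k : Fin (a + b)) (j : Fin (a + c))
  | ac (i : Fin (b + c)) (k : Fin (a + b))

/-- The unit triangles of the hexagon contained in a lozenge. -/
def Lozenge.cells {a b c : ℕ} : Lozenge a b c → Finset (Triangle a b c)
  | .ab i j => {t | t.1.1 = i ∧ t.1.2.1 = j}
  | .cb k j => {t | t.1.2.2 = k ∧ t.1.2.1 = j}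
  | .ac i k => {t | t.1.1 = i ∧ t.1.2.2 = k}

/-- The local Boltzmann weight of a lozenge. -/
def Lozenge.weight {a b c : ℕ} : Lozenge a b c → ParamPoly a b c
  | .ab i j => α i - β j
  | .cb k j => γ k - β j
  | .ac i k => α i - γ k

/-- A lozenge tiling of the hexagon: a set of lozenges, both triangles of which belong to the
hexagon, such that every unit triangle of the hexagon is in exactly one of them. -/
def IsTiling {a b c : ℕ} (T : Finset (Lozenge a b c)) : Prop :=
  (∀ L ∈ T, L.cells.card = 2) ∧ ∀ t : Triangle a b c, ∃! L, L ∈ T ∧ t ∈ L.cells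

instance (a b c : ℕ) : Finite (Lozenge a b c) :=
  Finite.of_surjective
    (fun s : (Fin (b + c) × Fin (a + c)) ⊕ (Fin (a + b) × Fin (a + c)) ⊕
        (Fin (b + c) × Fin (a + b)) =>
      match s with
      | .inl p => Lozenge.ab p.1 p.2
      | .inr (.inl p) => Lozenge.cb p.1 p.2
      | .inr (.inr p) => Lozenge.ac p.1 p.2)
    (by
      rintro (⟨i, j⟩ | ⟨k, j⟩ | ⟨i, k⟩)
      · exact ⟨.inl (i, j), rfl⟩
      · exact ⟨.inr (.inl (k, j)), rfl⟩
      · exact ⟨.inr (.inr (i, k)), rfl⟩)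

instance (a b c : ℕ) : Fintype (Lozenge a b c) := Fintype.ofFinite _

open scoped Classical in
/-- The partition function `Z_{a,b,c}`: the sum over all lozenge tilings of the `a × b × c`
hexagon of the product of the weights of the lozenges. -/
def partitionFunction (a b c : ℕ) : ParamPoly a b c :=
  ∑ T : Finset (Lozenge a b c) with IsTiling T, ∏ L ∈ T, L.weight

end LoopModel

end

/-! The ground state is constructed first and recognised as an eigenvector afterwards. Consider the
polynomials in $z_1,\dots,z_{2n}$ of degree less than $n$ in each variable that vanish whenever
$z_j=q^2z_i$, $z_k=q^2z_j$ for some $i<j<k$ (`IsWheel`). On $z_{k+1}=q^2z_k$ such a polynomial is an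
explicit product times one of size $n-1$ (`IsWheel.exists_restrict`). Hence it is determined by its
values at the points attached to link patterns, with coordinate $1$ at openings and $q^2$ at
closings (`IsWheel.eq_zero_of_points`). The divided differences $\theta_k$ exchanging neighbours
preserve this space, and the value of $\theta_kP$ at the point of $\tau$ is the value of $P$ at
$\tau$ minus its value at $e_k\tau$ (`IsTheta.eval_point`). This produces a basis dual to the points
(`exists_dual`), which up to a scalar is `groundState`.

Comparing values at the points yields the exchange relations `gs_exchange` and the recursion
`gs_restrict`. On the side of the transfer matrix the corresponding facts are the Yang-Baxter
relation `transferNum_exchange` and the fusion relation `transferNum_ins`. Together they make the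
defect of the eigenvector equation vanish on every hyperplane $z_j=q^2z_1$, which is too many for
its degree in $z_1$ (`transferNum_gs`).

Uniqueness comes from probability: for suitable parameters the transfer matrix is a Markov kernel
contracting the vectors of sum zero, so two solutions are proportional on a Zariski dense set.
Coprimality and the normalisation then make them equal (`IsGroundState.unique`).

Tilings are configurations of a vertex model on a rectangle, whose column matrices satisfy an
exchange relation. The partition function is therefore symmetric in the $\alpha_i$ (`pf_swap`). At
$\alpha_1=\beta_{a+c+1}$, for size $c+1$, the first column and the last row freeze, which reduces
$c+1$ to $c$ (`pf_corner`). The component of the ground state behaves in the same way: between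
neighbouring points that are not linked to each other the exchange relation is scalar, so the
component is symmetric in $\alpha$ up to the $q$-Vandermonde factor, and `gs_restrict` removes the
innermost arch between $\beta$ and $\alpha$. Both sides are polynomials of degree at most $n-1$ in
the last $\beta$ and agree when it equals some $\alpha_i$ or $q^2$ times another $\beta_j$, which is
more than $n-1$ values (`identity_update`). Induction on $c$ starts from $c=0$, where both sides are
explicit products (`identity_zero`). The prefactor is a nonzero polynomial, so $\Phi$ is obtained by
cancellation. -/

noncomputable section

namespace LoopModel

/-! ### Link patterns as involutions of the natural numbers; generators, insertion and closing -/

section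

namespace LinkPattern

variable {n : ℕ}

/-- The partner function of a link pattern, extended to all natural numbers by the identity. -/
def pn (π : LinkPattern n) (j : ℕ) : ℕ := if h : j < 2 * n then π.partner ⟨j, h⟩ else j

theorem pn_of_lt (π : LinkPattern n) {j : ℕ} (h : j < 2 * n) : π.pn j = π.partner ⟨j, h⟩ :=
  dif_pos h

theorem pn_of_le (π : LinkPattern n) {j : ℕ} (h : 2 * n ≤ j) : π.pn j = j := dif_neg (by omega)

theorem pn_val (π : LinkPattern n) (j : Fin (2 * n)) : π.pn j = π.partner j := dif_pos j.2

theorem pn_lt (π : LinkPattern n) {j : ℕ} (h : j < 2 * n) : π.pn j < 2 * n := by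
  rw [pn_of_lt π h]; exact Fin.is_lt _

theorem pn_pn (π : LinkPattern n) (j : ℕ) : π.pn (π.pn j) = j := by
  by_cases h : j < 2 * n
  · rw [pn_of_lt π h, pn_val, π.partner_partner]
  · rw [pn_of_le π (not_lt.1 h), pn_of_le π (not_lt.1 h)]

theorem pn_ne (π : LinkPattern n) {j : ℕ} (h : j < 2 * n) : π.pn j ≠ j := by
  rw [pn_of_lt π h]
  exact fun h' => π.partner_ne ⟨j, h⟩ (Fin.ext h')

theorem pn_lt_iff (π : LinkPattern n) {j : ℕ} : π.pn j < 2 * n ↔ j < 2 * n := by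
  refine ⟨fun h => ?_, π.pn_lt⟩
  by_contra hj
  rw [pn_of_le π (not_lt.1 hj)] at h
  exact hj h

theorem pn_nc (π : LinkPattern n) (i j : ℕ) : ¬ (i < j ∧ j < π.pn i ∧ π.pn i < π.pn j) := by
  rintro ⟨h1, h2, h3⟩
  have hi : i < 2 * n := by
    by_contra hi
    rw [pn_of_le π (not_lt.1 hi)] at h2
    omega
  have hj : j < 2 * n := h2.trans (π.pn_lt hi)
  rw [pn_of_lt π hi] at h2 h3
  rw [pn_of_lt π hj] at h3
  exact π.noncrossing ⟨i, hi⟩ ⟨j, hj⟩ ⟨h1, h2, h3⟩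

/-- Non-crossing for the pair `i, j` forbids the partner of `j` to lie beyond that of `i`; for the
pair `π.pn j, i` it forbids it to lie before `i`. -/
theorem pn_nest (π : LinkPattern n) {i j : ℕ} (h1 : i < j) (h2 : j < π.pn i) :
    i < π.pn j ∧ π.pn j < π.pn i := by
  have h3 := π.pn_nc i j
  have h4 := π.pn_nc (π.pn j) i
  have h5 := π.pn_pn
  grind

theorem ext_pn {π σ : LinkPattern n} (h : ∀ j, j < 2 * n → π.pn j = σ.pn j) : π = σ := by
  apply LinkPattern.ext
  funext j
  apply Fin.ext
  rw [← pn_val, ← pn_val]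
  exact h j j.2

/-- A link pattern from a partner function on the natural numbers. -/
def ofNat (n : ℕ) (f : ℕ → ℕ) (hlt : ∀ j < 2 * n, f j < 2 * n) (hinv : ∀ j < 2 * n, f (f j) = j)
    (hne : ∀ j < 2 * n, f j ≠ j)
    (hnc : ∀ i j, i < j → j < f i → f i < f j → f j < 2 * n → False) : LinkPattern n where
  partner j := ⟨f j, hlt j j.2⟩
  partner_partner j := Fin.ext (hinv j j.2)
  partner_ne j h := hne j j.2 (congrArg Fin.val h)
  noncrossing i j h := hnc i j h.1 h.2.1 h.2.2 (hlt j j.2)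

theorem pn_ofNat {n : ℕ} {f : ℕ → ℕ} {h1 h2 h3 h4} {j : ℕ} (h : j < 2 * n) :
    (ofNat n f h1 h2 h3 h4).pn j = f j := by
  rw [pn_of_lt _ h]; rfl

/-- The action of a Temperley--Lieb generator on partner functions. -/
def eFun (p : ℕ → ℕ) (i j : ℕ) : ℕ :=
  if j = i then i + 1 else if j = i + 1 then i else if p j = i then p (i + 1)
  else if p j = i + 1 then p i else p j

/-- The Temperley--Lieb generator: it links `i` with `i + 1`, and the former partners of these
points with each other. -/
def e (i : ℕ) (π : LinkPattern n) : LinkPattern n :=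
  if h : i + 1 < 2 * n then
    ofNat n (eFun π.pn i)
      (fun j hj => by
        have h1 := π.pn_lt hj
        have h2 := π.pn_lt h
        have h3 := π.pn_lt (show i < 2 * n by omega)
        unfold eFun; split_ifs <;> omega)
      (fun j hj => by
        have h1 := π.pn_pn
        have h2 := @pn_ne n π
        unfold eFun; grind)
      (fun j hj => by
        have h1 := π.pn_pn
        have h2 := @pn_ne n π
        unfold eFun; grind)
      (fun j k h1 h2 h3 h4 => by
        have h5 := π.pn_pn
        -- A crossing in the new pattern can involve only `j`, `k`, `i`, `i + 1` and their old
        -- partners. The nesting relations between these points settle every case.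
        have h6 := fun x y => @pn_nest n π x y
        have h7 := h6 k i
        have h8 := h6 k (i + 1)
        have h9 := h6 (π.pn k) i
        have h10 := h6 (π.pn k) (i + 1)
        have h11 := h6 j i
        have h12 := h6 j (i + 1)
        have h13 := h6 (π.pn j) i
        have h14 := h6 (π.pn j) (i + 1)
        have h15 := h6 j k
        have h16 := h6 k (π.pn i)
        have h17 := h6 k (π.pn (i + 1))
        have h18 := h6 j (π.pn i)
        have h19 := h6 j (π.pn (i + 1))
        have h20 : ∀ x y, π.pn x = y → π.pn y = x := fun x y h => by rw [← h, π.pn_pn]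
        have h21 := h20 j i
        have h22 := h20 j (i + 1)
        have h23 := h20 k i
        have h24 := h20 k (i + 1)
        have h25 := h6 (π.pn i) k
        have h26 := h6 (π.pn (i + 1)) k
        have h27 := π.pn_pn i
        have h28 := π.pn_pn (i + 1)
        clear h6 h5 h20
        unfold eFun at *
        by_cases c1 : j = i
        · simp only [c1, if_true] at h2; omega
        by_cases c2 : j = i + 1
        · simp only [c2, if_true] at h2; grind
        by_cases c3 : k = i
        · simp only [c3, if_true] at h3; grind
        by_cases c4 : k = i + 1
        · simp only [c4, if_true] at h3; grind
        simp only [c1, c2, c3, c4, if_false] at h2 h3 h4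
        by_cases c5 : π.pn j = i <;> by_cases c6 : π.pn j = i + 1 <;>
        by_cases c7 : π.pn k = i <;> by_cases c8 : π.pn k = i + 1 <;>
        simp only [c5, c6, c7, c8, if_true, if_false, true_imp_iff] at h2 h3 h4 h21 h22 h23 h24 <;>
        grind)
  else π

theorem pn_e {i : ℕ} (h : i + 1 < 2 * n) (π : LinkPattern n) (j : ℕ) :
    (e i π).pn j = eFun π.pn i j := by
  by_cases hj : j < 2 * n
  · rw [e, dif_pos h, pn_ofNat hj]
  · rw [pn_of_le _ (not_lt.1 hj)]
    have := π.pn_of_le (not_lt.1 hj)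
    unfold eFun
    grind

/-- The insertion of an arch on partner functions. -/
def insFun (p : ℕ → ℕ) (k j : ℕ) : ℕ :=
  if j = k then k + 1 else if j = k + 1 then k
  else if p (if j < k then j else j - 2) < k then p (if j < k then j else j - 2)
  else p (if j < k then j else j - 2) + 2

/-- Insert in a link pattern a small arch linking the new points `k` and `k + 1`. -/
def ins (k : Fin (2 * n + 1)) (π : LinkPattern n) : LinkPattern (n + 1) :=
    ofNat (n + 1) (insFun π.pn k)
      (fun j hj => by
        have h1 := @pn_lt n π
        have := k.2
        unfold insFun; grind)
      (fun j hj => by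
        have h1 := π.pn_pn
        unfold insFun; grind)
      (fun j hj => by
        have h1 := π.pn_pn
        have h2 := @pn_ne n π
        have := k.2
        unfold insFun; grind)
      (fun i j h1 h2 h3 h4 => by
        have h5 := π.pn_nc (if i < k then i else i - 2) (if j < k then j else j - 2)
        unfold insFun at *
        generalize π.pn (if i < k then i else i - 2) = x at *
        generalize π.pn (if j < k then j else j - 2) = y at *
        grind)

theorem pn_ins (k : Fin (2 * n + 1)) (π : LinkPattern n) (j : ℕ) :
    (ins k π).pn j = insFun π.pn k j := by
  by_cases hj : j < 2 * (n + 1)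
  · rw [ins, pn_ofNat hj]
  · rw [pn_of_le _ (not_lt.1 hj)]
    have := π.pn_of_le (show 2 * n ≤ j - 2 by omega)
    have := k.2
    unfold insFun
    grind

/-- Closing on partner functions. -/
def closeFun (p : ℕ → ℕ) (l j : ℕ) : ℕ :=
  if p (j + 1) = 0 then p l - 1 else if p (j + 1) = l then p 0 - 1 else p (j + 1) - 1

/-- Remove the first and the last point of a link pattern, linking their partners. -/
def close (π : LinkPattern (n + 1)) : LinkPattern n :=
    ofNat n (closeFun π.pn (2 * n + 1))
      (fun j hj => by
        have h1 := @pn_lt _ π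
        have h2 := π.pn_pn
        have h3 := @pn_ne _ π
        unfold closeFun; grind)
      (fun j hj => by
        have h1 := @pn_lt _ π
        have h2 := π.pn_pn
        have h3 := @pn_ne _ π
        unfold closeFun; grind)
      (fun j hj => by
        have h1 := @pn_lt _ π
        have h2 := π.pn_pn
        have h3 := @pn_ne _ π
        unfold closeFun; grind)
      (fun i j h1 h2 h3 h4 => by
        -- The only new arch joins the old partners of the two removed points. If those were linked
        -- to each other there is no new arch, and the default branch of `closeFun` applies to every
        -- point.
        have h5 := fun x y => @pn_nest _ π x y
        have h6 := h5 (i + 1) (j + 1)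
        have h7 := h5 0 (i + 1)
        have h8 := h5 0 (j + 1)
        have h9 := h5 0 (π.pn (i + 1))
        have h10 := h5 0 (π.pn (j + 1))
        have h11 := h5 (π.pn (2 * n + 1)) (i + 1)
        have h12 := h5 (π.pn (2 * n + 1)) (j + 1)
        have h13 := h5 (π.pn (2 * n + 1)) (π.pn (i + 1))
        have h14 := h5 (π.pn (2 * n + 1)) (π.pn (j + 1))
        have h15 := h5 0 (π.pn (2 * n + 1))
        have h16 := @pn_lt _ π 0
        have h17 := @pn_lt _ π (2 * n + 1)
        have h18 := @pn_lt _ π (i + 1)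
        have h19 := @pn_lt _ π (j + 1)
        have h20 := π.pn_pn 0
        have h21 := π.pn_pn (2 * n + 1)
        have h22 := π.pn_pn (i + 1)
        have h23 := π.pn_pn (j + 1)
        have h24 := @pn_ne _ π 0
        have h25 := @pn_ne _ π (2 * n + 1)
        clear h5
        unfold closeFun at *
        split_ifs at * with a1 a2 a3 a4 <;> simp only [*] at * <;> omega)

theorem pn_close (π : LinkPattern (n + 1)) {j : ℕ} (hj : j < 2 * n) :
    (close π).pn j = closeFun π.pn (2 * n + 1) j := pn_ofNat hj

end LinkPattern
end

/-! ### Temperley-Lieb relations, and their compatibility with insertion and closing -/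

section

namespace LinkPattern

variable {n : ℕ}

theorem pn_e' {i : ℕ} (h : i + 1 < 2 * n) (π : LinkPattern n) : (e i π).pn = eFun π.pn i :=
  funext (pn_e h π)

theorem pn_ins' (k : Fin (2 * n + 1)) (π : LinkPattern n) : (ins k π).pn = insFun π.pn k :=
  funext (pn_ins k π)

/-- Idempotence expresses that a closed loop has weight $1$. -/
theorem e_e {i : ℕ} (h : i + 1 < 2 * n) (π : LinkPattern n) : e i (e i π) = e i π := by
  refine ext_pn fun j hj => ?_
  rw [pn_e h, pn_e' h]
  have h1 := π.pn_pn
  unfold eFun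
  grind (splits := 30)

theorem e_succ_e {i : ℕ} (h : i + 2 < 2 * n) (π : LinkPattern n) :
    e i (e (i + 1) (e i π)) = e i π := by
  refine ext_pn fun j hj => ?_
  have h' : i + 1 < 2 * n := by omega
  rw [pn_e h', pn_e' (show i + 1 + 1 < 2 * n by omega), pn_e' h']
  have h1 := π.pn_pn
  have h2 := @pn_ne _ π
  unfold eFun
  grind (splits := 30)

theorem e_pred_e {i : ℕ} (h : i + 2 < 2 * n) (π : LinkPattern n) :
    e (i + 1) (e i (e (i + 1) π)) = e (i + 1) π := by
  refine ext_pn fun j hj => ?_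
  have h' : i + 1 < 2 * n := by omega
  have h'' : i + 1 + 1 < 2 * n := by omega
  rw [pn_e h'', pn_e' h', pn_e' h'']
  have h1 := π.pn_pn
  have h2 := @pn_ne _ π
  unfold eFun
  grind (splits := 30)

theorem e_comm {i j : ℕ} (hi : i + 1 < j) (hj : j + 1 < 2 * n) (π : LinkPattern n) :
    e i (e j π) = e j (e i π) := by
  refine ext_pn fun l hl => ?_
  have h' : i + 1 < 2 * n := by omega
  rw [pn_e h', pn_e' hj, pn_e hj, pn_e' h']
  have h1 := π.pn_pn
  have h2 := @pn_ne _ π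
  unfold eFun
  grind (splits := 30)

theorem e_ins_self (k : Fin (2 * n + 1)) (π : LinkPattern n) : e k (ins k π) = ins k π := by
  refine ext_pn fun j hj => ?_
  have := k.2
  rw [pn_e (by omega), pn_ins']
  have h1 := π.pn_pn
  unfold eFun insFun
  grind (splits := 30)

/-- A zigzag is straightened: the line at `k` passes to the other side of the little arch. -/
theorem e_ins_succ (k : ℕ) (hk : k + 1 < 2 * n + 1) (π : LinkPattern n) :
    e k (ins ⟨k + 1, hk⟩ π) = ins ⟨k, by omega⟩ π := by
  refine ext_pn fun j hj => ?_
  rw [pn_e (by omega), pn_ins', pn_ins']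
  have h1 := π.pn_pn
  have h2 := @pn_ne _ π
  unfold eFun insFun
  grind (splits := 30)

theorem e_ins_of_lt {i : ℕ} (k : Fin (2 * n + 1)) (h : i + 1 < k) (π : LinkPattern n) :
    e i (ins k π) = ins k (e i π) := by
  refine ext_pn fun j hj => ?_
  have := k.2
  rw [pn_e (by omega), pn_ins', pn_ins', pn_e' (by omega)]
  have h1 := π.pn_pn
  have h2 := @pn_ne _ π
  unfold eFun insFun
  grind (splits := 30)

theorem e_ins_of_ge {i : ℕ} (k : Fin (2 * n + 1)) (h : k ≤ i) (hi : i + 1 < 2 * n)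
    (π : LinkPattern n) : e (i + 2) (ins k π) = ins k (e i π) := by
  refine ext_pn fun j hj => ?_
  have := k.2
  rw [pn_e (by omega), pn_ins', pn_ins', pn_e' (by omega)]
  have h1 := π.pn_pn
  have h2 := @pn_ne _ π
  unfold eFun insFun
  grind (splits := 30)

/-- The index drops by one because closing removes the point `0`; the generator does not touch
either removed point. -/
theorem close_e {i : ℕ} (hi : i + 1 < 2 * n) (π : LinkPattern (n + 1)) :
    close (e (i + 1) π) = e i (close π) := by
  refine ext_pn fun j hj => ?_
  rw [pn_close _ hj, pn_e' (by omega), pn_e hi]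
  have h3 := @pn_close _ π
  have h1 := π.pn_pn
  have h2 := @pn_ne _ π
  have h4 := h3 hj
  have h5 := h3 hi
  have h6 := h3 (show i < 2 * n by omega)
  clear h3
  have h7 := @pn_lt _ π
  unfold eFun closeFun at *
  grind (splits := 30)

theorem close_ins {k : ℕ} (hk : k < 2 * n + 1) (π : LinkPattern (n + 1)) :
    close (ins ⟨k + 1, by omega⟩ π) = ins ⟨k, hk⟩ (close π) := by
  refine ext_pn fun j hj => ?_
  rw [pn_close _ hj, pn_ins', pn_ins]
  have h3 := @pn_close _ π
  have h1 := π.pn_pn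
  have h2 := @pn_ne _ π
  have h4 := @h3 j
  have h5 := @h3 (j - 2)
  clear h3
  have h7 := @pn_lt _ π
  unfold insFun closeFun at *
  grind (splits := 30)

theorem ins_zero_ins {k : ℕ} (hk : k < 2 * n + 1) (π : LinkPattern n) :
    ins 0 (ins ⟨k, hk⟩ π) = ins ⟨k + 2, by omega⟩ (ins 0 π) := by
  refine ext_pn fun j hj => ?_
  rw [pn_ins', pn_ins', pn_ins', pn_ins']
  have h1 := π.pn_pn
  have h2 := @pn_ne _ π
  simp only [insFun, Fin.val_zero]
  grind (splits := 30)

end LinkPattern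
end

/-! ### Insertion of two values; a strip of plaquettes as a word in the generators -/

section

/-- Insert two consecutive values in a finite sequence of even length. -/
def ins2 {A : Type*} {n : ℕ} (k : Fin (2 * n + 1)) (x y : A) (f : Fin (2 * n) → A)
    (j : Fin (2 * (n + 1))) : A :=
  if h : j.val < k.val then f ⟨j, by omega⟩
  else if h' : j.val = k then x
  else if h'' : j.val = k + 1 then y
  else f ⟨j - 2, by have := j.2; have := k.2; omega⟩

section ins2

variable {A : Type*} {n : ℕ} (k : Fin (2 * n + 1)) (x y : A) (f : Fin (2 * n) → A)

/-- The first inserted position. -/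
def pos (k : Fin (2 * n + 1)) : Fin (2 * (n + 1)) := ⟨k, by have := k.2; omega⟩

/-- The second inserted position. -/
def posSucc (k : Fin (2 * n + 1)) : Fin (2 * (n + 1)) := ⟨k + 1, by have := k.2; omega⟩

/-- The position of an old value after the insertion. -/
def skip (k : Fin (2 * n + 1)) (l : Fin (2 * n)) : Fin (2 * (n + 1)) :=
  if l.val < k then ⟨l, by omega⟩ else ⟨l + 2, by omega⟩

theorem pos_ne_posSucc : pos k ≠ posSucc k := by simp [pos, posSucc]

theorem skip_ne_pos (l : Fin (2 * n)) : skip k l ≠ pos k := by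
  unfold skip pos; split_ifs <;> simp [Fin.ext_iff] <;> omega

theorem skip_ne_posSucc (l : Fin (2 * n)) : skip k l ≠ posSucc k := by
  unfold skip posSucc; split_ifs <;> simp [Fin.ext_iff] <;> omega

theorem skip_injective : Function.Injective (skip k) := by
  intro l m h
  unfold skip at h
  ext
  split_ifs at h <;> simp [Fin.ext_iff] at h <;> omega

theorem pos_or_skip (j : Fin (2 * (n + 1))) : j = pos k ∨ j = posSucc k ∨ ∃ l, j = skip k l := by
  have := j.2
  have := k.2
  rcases lt_trichotomy j.val k with h | h | h
  · exact .inr (.inr ⟨⟨j, by omega⟩, by simp [skip, h]⟩)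
  · exact .inl (by ext; exact h)
  · by_cases h' : j.val = k + 1
    · exact .inr (.inl (by ext; exact h'))
    · refine .inr (.inr ⟨⟨j - 2, by omega⟩, ?_⟩)
      ext
      rw [skip, if_neg (by simp; omega)]
      simp; omega

@[simp] theorem ins2_pos : ins2 k x y f (pos k) = x := by simp [ins2, pos]

@[simp] theorem ins2_posSucc : ins2 k x y f (posSucc k) = y := by simp [ins2, posSucc]

@[simp] theorem ins2_skip (l : Fin (2 * n)) : ins2 k x y f (skip k l) = f l := by
  unfold skip ins2
  grind

theorem eq_ins2 (g : Fin (2 * (n + 1)) → A) :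
    g = ins2 k (g (pos k)) (g (posSucc k)) (fun l => g (skip k l)) := by
  funext j
  rcases pos_or_skip k j with rfl | rfl | ⟨l, rfl⟩ <;> simp

/-- Positions after the insertion. -/
def skipEquiv : Fin (2 * n) ⊕ Bool ≃ Fin (2 * (n + 1)) :=
  Equiv.ofBijective (Sum.elim (skip k) (fun b => bif b then pos k else posSucc k)) (by
    constructor
    · rintro (l | _ | _) (m | _ | _) h <;>
        simp_all [skip_ne_pos, skip_ne_posSucc, pos_ne_posSucc, (skip_ne_pos k _).symm,
          (skip_ne_posSucc k _).symm, (pos_ne_posSucc k).symm, (skip_injective k).eq_iff]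
    · intro j
      rcases pos_or_skip k j with rfl | rfl | ⟨l, rfl⟩
      · exact ⟨.inr true, rfl⟩
      · exact ⟨.inr false, rfl⟩
      · exact ⟨.inl l, rfl⟩)

theorem prod_skip {M : Type*} [CommMonoid M] (F : Fin (2 * (n + 1)) → M) :
    ∏ j, F j = F (pos k) * F (posSucc k) * ∏ l, F (skip k l) := by
  rw [← (skipEquiv k).prod_comp, Fintype.prod_sum_type, Fintype.prod_bool, mul_comm]
  rfl

theorem sum_skip {M : Type*} [AddCommMonoid M] (F : Fin (2 * (n + 1)) → M) :
    ∑ j, F j = F (pos k) + F (posSucc k) + ∑ l, F (skip k l) := by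
  rw [← (skipEquiv k).sum_comp, Fintype.sum_sum_type, Fintype.sum_bool, add_comm]
  rfl

theorem sum_ins2 {M : Type*} [AddCommMonoid M] [Fintype A] (F : (Fin (2 * (n + 1)) → A) → M) :
    ∑ S, F S = ∑ S : Fin (2 * n) → A, ∑ x, ∑ y, F (ins2 k x y S) := by
  rw [← Fintype.sum_prod_type']
  simp_rw [← Fintype.sum_prod_type']
  refine Fintype.sum_equiv
    ⟨fun g => ((fun l => g (skip k l), g (pos k)), g (posSucc k)),
      fun p => ins2 k p.1.2 p.2 p.1.1, fun g => (eq_ins2 k g).symm, fun p => by simp⟩ _ _ ?_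
  intro g
  exact congrArg F (eq_ins2 k g)

end ins2

namespace LinkPattern

variable {n : ℕ}

/-- Extension of a configuration of plaquettes to all natural numbers. -/
def sext {n : ℕ} (S : Fin (2 * n) → Bool) (j : ℕ) : Bool := if h : j < 2 * n then S ⟨j, h⟩ else true

theorem sext_ins2 (k : Fin (2 * n + 1)) (x y : Bool) (S : Fin (2 * n) → Bool) (j : ℕ) :
    sext (ins2 k x y S) j = if j < k then sext S j else if j = k then x else if j = k + 1 then y
      else sext S (j - 2) := by
  have := k.2
  unfold sext ins2
  grind

/-- Apply to a link pattern the plaquettes `a, …, a + m - 1`, from left to right; before plaquette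
`j`, the point `j + 1` is the one carried by the strip. -/
def run {N : ℕ} (S : ℕ → Bool) (a : ℕ) : ℕ → LinkPattern N → LinkPattern N
  | 0, μ => μ
  | m + 1, μ => if S (a + m) then run S a m μ else e (a + m + 1) (run S a m μ)

theorem run_add {N : ℕ} (S : ℕ → Bool) (a m l : ℕ) (μ : LinkPattern N) :
    run S a (m + l) μ = run S (a + m) l (run S a m μ) := by
  induction l with
  | zero => rfl
  | succ l ih => rw [← add_assoc, run, run, ih, ← add_assoc]

theorem run_congr {N : ℕ} {S S' : ℕ → Bool} {a m : ℕ} (h : ∀ j, a ≤ j → j < a + m → S j = S' j)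
    (μ : LinkPattern N) : run S a m μ = run S' a m μ := by
  induction m with
  | zero => rfl
  | succ m ih =>
    rw [run, run, ih fun j h1 h2 => h j h1 (by omega), h (a + m) (by omega) (by omega)]

theorem run_two {N : ℕ} (S : ℕ → Bool) (a : ℕ) (μ : LinkPattern N) :
    run S a 2 μ = if S (a + 1) then (if S a then μ else e (a + 1) μ)
      else e (a + 2) (if S a then μ else e (a + 1) μ) := rfl

theorem run_e_lt {N : ℕ} (S : ℕ → Bool) {i a : ℕ} (h : i < a) (m : ℕ) (hm : a + m + 1 < 2 * N)
    (μ : LinkPattern N) : e i (run S a m μ) = run S a m (e i μ) := by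
  induction m with
  | zero => rfl
  | succ m ih =>
    rw [run, run]
    split_ifs
    · exact ih (by omega)
    · rw [e_comm (by omega) (by omega), ih (by omega)]

theorem run_e_gt {N : ℕ} (S : ℕ → Bool) {i a : ℕ} (m : ℕ) (h : a + m + 1 < i) (hi : i + 1 < 2 * N)
    (μ : LinkPattern N) : e i (run S a m μ) = run S a m (e i μ) := by
  induction m with
  | zero => rfl
  | succ m ih =>
    rw [run, run]
    split_ifs
    · exact ih (by omega)
    · rw [← e_comm (by omega) (by omega), ih (by omega)]

theorem run_ins_lt {N : ℕ} (S : ℕ → Bool) {a : ℕ} (m : ℕ) (k : Fin (2 * N + 1)) (h : a + m + 2 ≤ k)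
    (μ : LinkPattern N) : run S a m (ins k μ) = ins k (run S a m μ) := by
  induction m with
  | zero => rfl
  | succ m ih =>
    rw [run, run, ih (by omega)]
    split_ifs
    · rfl
    · rw [e_ins_of_lt _ (by omega)]

theorem run_ins_gt {N : ℕ} {S S' : ℕ → Bool} {a : ℕ} (m : ℕ) (k : Fin (2 * N + 1))
    (hS : ∀ j, a ≤ j → S (j + 2) = S' j) (h : k ≤ a + 1) (hm : a + m + 1 < 2 * N)
    (μ : LinkPattern N) : run S (a + 2) m (ins k μ) = ins k (run S' a m μ) := by
  induction m with
  | zero => rfl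
  | succ m ih =>
    rw [run, run, ih (by omega), show a + 2 + m = a + m + 2 by ring, hS _ (by omega)]
    split_ifs
    · rfl
    · rw [show a + m + 2 + 1 = a + m + 1 + 2 by ring, e_ins_of_ge _ (by omega) (by omega)]

/-- The link pattern obtained by adding a strip of plaquettes around a link pattern. -/
def res (S : Fin (2 * n) → Bool) (π : LinkPattern n) : LinkPattern n :=
  close (run (sext S) 0 (2 * n) (ins 0 π))

/-- Two consecutive plaquettes. -/
def pair {N : ℕ} (i : ℕ) (x y : Bool) (μ : LinkPattern N) : LinkPattern N :=
  if y then (if x then μ else e (i + 1) μ) else e (i + 2) (if x then μ else e (i + 1) μ)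

/-- The strip is cut open at side `0`, and its two ends are the points `0` and `1` created by `ins
0`. A first plaquette acts as the identity and a second one at `j` as the generator `e (j + 1)`.
When all have acted, `close` glues the two ends. Splitting the word here isolates the plaquettes `k`
and `k + 1`. -/
theorem res_ins2 (k : Fin (2 * n + 1)) (x y : Bool) (S : Fin (2 * n) → Bool)
    (π : LinkPattern (n + 1)) :
    res (ins2 k x y S) π = close (run (fun j => sext S (j - 2)) (k + 2) (2 * n - k)
      (pair k x y (run (sext S) 0 k (ins 0 π)))) := by
  have hk := k.2
  rw [res]
  generalize ins 0 π = μ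
  rw [show 2 * (n + 1) = (k : ℕ) + (2 + (2 * n - k)) by omega, run_add, run_add, run_two, zero_add,
    run_congr (S' := sext S) (a := 0) fun j h1 h2 => by rw [sext_ins2, if_pos (by omega)],
    run_congr (S' := fun j => sext S (j - 2)) (a := k + 2) fun j h1 h2 => by
      rw [sext_ins2, if_neg (by omega), if_neg (by omega), if_neg (by omega)]]
  simp [sext_ins2, pair]

/-- Before closing, the generator becomes `e (k + 1)`. The four plaquette pairs are $1$, $e_{k+1}$,
$e_{k+2}$ and $e_{k+2}e_{k+1}$. Multiplied on the left by $e_{k+1}$, all but $e_{k+2}$ collapse to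
$e_{k+1}$, the pair `(false, true)`. -/
theorem e_res {k : Fin (2 * n + 1)} {x y : Bool} (h : (x, y) ≠ (true, false))
    (S : Fin (2 * n) → Bool) (π : LinkPattern (n + 1)) :
    e k (res (ins2 k x y S) π) = res (ins2 k false true S) π := by
  have hk := k.2
  rw [res_ins2, res_ins2, ← close_e (by omega), run_e_lt _ (by omega) _ (by omega)]
  congr 2
  generalize run (sext S) 0 k (ins 0 π) = μ
  match x, y with
  | true, true => rfl
  | false, true => exact e_e (by omega) _
  | false, false => exact e_succ_e (by omega) _
  | true, false => exact absurd rfl h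

/-- The mirror of `e_res`: seen from inside the strip the generator is `e (k + 2)`, and right
multiplication by it collapses every pair but $e_{k+1}$ to $e_{k+2}$, the pair `(true, false)`. -/
theorem res_e {k : Fin (2 * n + 1)} {x y : Bool} (h : (x, y) ≠ (false, true))
    (S : Fin (2 * n) → Bool) (π : LinkPattern (n + 1)) :
    res (ins2 k x y S) (e k π) = res (ins2 k true false S) π := by
  have hk := k.2
  rw [res_ins2, res_ins2, ← e_ins_of_ge 0 (by simp) (by omega), ← run_e_gt _ _ (by omega) (by omega)]
  congr 2
  generalize run (sext S) 0 k (ins 0 π) = μ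
  match x, y with
  | true, true => rfl
  | true, false => exact e_e (by omega) _
  | false, false => exact e_pred_e (by omega) _
  | false, true => exact absurd rfl h

/-- In the cases excluded from `e_res` and `res_e` both words contain the product $e_{k+1}e_{k+2}$.
-/
theorem e_res_eq_res_e (k : Fin (2 * n + 1)) (S : Fin (2 * n) → Bool) (π : LinkPattern (n + 1)) :
    e k (res (ins2 k true false S) π) = res (ins2 k false true S) (e k π) := by
  have hk := k.2
  rw [res_ins2, res_ins2, ← e_ins_of_ge 0 (by simp) (by omega), ← run_e_gt _ _ (by omega) (by omega),
    ← close_e (by omega), run_e_lt _ (by omega) _ (by omega)]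
  rfl

theorem res_ins2_ins {k : Fin (2 * n + 1)} {x y : Bool} (h : (x, y) ≠ (false, true))
    (S : Fin (2 * n) → Bool) (π : LinkPattern n) :
    res (ins2 k x y S) (ins k π) = res (ins2 k true false S) (ins k π) := by
  rw [← res_e h, e_ins_self]

/-- With these two plaquettes the line running along the strip goes around the little arch
(`e_ins_succ`), which therefore comes out unchanged, while the rest of the strip acts on `π`. -/
theorem res_ins2_false_true (k : Fin (2 * n + 1)) (S : Fin (2 * n) → Bool) (π : LinkPattern n) :
    res (ins2 k false true S) (ins k π) = ins k (res S π) := by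
  have hk := k.2
  rw [res_ins2, ins_zero_ins k.2, run_ins_lt _ _ _ (by simp)]
  simp only [pair, if_true, Bool.false_eq_true, if_false]
  rw [e_ins_succ _ (by omega), run_ins_gt (S' := sext S) _ _ (by simp) (by simp) (by omega),
    close_ins hk, res]
  congr 2
  have := run_add (sext S) 0 k (2 * n - k) (ins 0 π)
  rw [zero_add, show (k : ℕ) + (2 * n - k) = 2 * n by omega] at this
  exact this.symm

end LinkPattern
end

/-! ### The word in the generators computes the connections of the strip -/

section

namespace LinkPattern

variable {n : ℕ}

/-- The index of the side of the strip preceding plaquette `j`. -/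
def sideIdx (n : ℕ) (hn : 0 < 2 * n) (j : ℕ) : Fin (2 * n) := if h : j < 2 * n then ⟨j, h⟩ else ⟨0, hn⟩

theorem finRotate_eq_sideIdx (hn : 0 < 2 * n) (i : Fin (2 * n)) :
    finRotate (2 * n) i = sideIdx n hn (i + 1) := by
  obtain ⟨m, hm⟩ : ∃ m, 2 * n = m + 1 := ⟨2 * n - 1, by omega⟩
  have key : ∀ (N : ℕ) (hN : N = m + 1) (i : Fin N), (finRotate N i).val =
      if i.val + 1 < N then i.val + 1 else 0 := by
    rintro N rfl i
    rw [coe_finRotate]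
    have := i.2
    split_ifs with h1 h2 h2 <;> simp_all [Fin.ext_iff] <;> omega
  ext
  rw [key _ hm]
  unfold sideIdx
  split_ifs <;> rfl

/-- The edge of the strip in which the point `x` of the link pattern before plaquette `j` ends. -/
def edgeAt (n : ℕ) (hn : 0 < 2 * n) (j x : ℕ) : StripEdge (2 * n) :=
  if x = 0 then .side (sideIdx n hn 0)
  else if x ≤ j then .outer (sideIdx n hn (x - 1))
  else if x = j + 1 then .side (sideIdx n hn j)
  else .inner (sideIdx n hn (x - 2))

theorem edgeAt_succ (hn : 0 < 2 * n) {j x : ℕ} (h1 : x ≠ j + 1) (h2 : x ≠ j + 2) :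
    edgeAt n hn (j + 1) x = edgeAt n hn j x := by
  unfold edgeAt
  grind

theorem pn_ins_zero_le {n : ℕ} {x : ℕ} (π : LinkPattern n) (hx : 2 ≤ x) :
    (ins 0 π).pn x = π.pn (x - 2) + 2 := by
  rw [pn_ins]
  simp only [insFun, Fin.val_zero]
  grind

/-- Before plaquette `j` the current points lie on the edges given by `edgeAt`. Each plaquette moves
only the points `j + 1` and `j + 2`, so connections are followed one plaquette at a time. -/
theorem eqvGen_run (hn : 0 < 2 * n) (S : Fin (2 * n) → Bool) (π : LinkPattern n) {j : ℕ}
    (hj : j ≤ 2 * n) {x : ℕ} (hx : x < 2 * n + 2) :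
    Relation.EqvGen (StripLink S π) (edgeAt n hn j x)
      (edgeAt n hn j ((run (sext S) 0 j (ins 0 π)).pn x)) := by
  induction j generalizing x with
  | zero =>
    rw [run]
    by_cases h : 2 ≤ x
    · rw [pn_ins_zero_le π h]
      have h1 : sideIdx n hn (x - 2) = ⟨x - 2, by omega⟩ := dif_pos (by omega)
      have h2 : sideIdx n hn (π.pn (x - 2)) = π.partner ⟨x - 2, by omega⟩ := by
        rw [sideIdx, dif_pos (π.pn_lt (by omega))]
        ext
        exact π.pn_of_lt _
      rw [edgeAt, edgeAt, if_neg (by omega), if_neg (by omega), if_neg (by omega), if_neg (by omega),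
        if_neg (by omega), if_neg (by omega), Nat.add_sub_cancel, h1, h2]
      exact .rel _ _ (.arch _)
    · have h0 : (ins 0 π).pn 0 = 1 := by rw [pn_ins]; simp [insFun]
      have h1 : (ins 0 π).pn 1 = 0 := by rw [pn_ins]; simp [insFun]
      have : edgeAt n hn 0 0 = edgeAt n hn 0 1 := by simp [edgeAt]
      obtain rfl | rfl : x = 0 ∨ x = 1 := by omega
      · rw [h0, this]; exact .refl _
      · rw [h1, this]; exact .refl _
  | succ j ih =>
    have ih := fun {x} hx => @ih (by omega) x hx
    have hS : sext S j = S ⟨j, by omega⟩ := dif_pos (by omega)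
    rw [run, zero_add, hS]
    set μ := run (sext S) 0 j (ins 0 π) with hμ
    have e1 : edgeAt n hn j (j + 1) = .side ⟨j, by omega⟩ := by
      simp [edgeAt, sideIdx, show j < 2 * n by omega]
    have e2 : edgeAt n hn j (j + 2) = .inner ⟨j, by omega⟩ := by
      simp [edgeAt, sideIdx, show j < 2 * n by omega]
    have e3 : edgeAt n hn (j + 1) (j + 1) = .outer ⟨j, by omega⟩ := by
      simp [edgeAt, sideIdx, show j < 2 * n by omega]
    have e4 : edgeAt n hn (j + 1) (j + 2) = .side (finRotate (2 * n) ⟨j, by omega⟩) := by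
      rw [finRotate_eq_sideIdx hn]
      simp [edgeAt]
    cases hb : S ⟨j, by omega⟩
    · simp only [Bool.false_eq_true, if_false]
      have h1 : Relation.EqvGen (StripLink S π) (edgeAt n hn (j + 1) (j + 1))
          (edgeAt n hn (j + 1) (j + 2)) := by
        rw [e3, e4]; exact .rel _ _ (.secondOuter _ hb)
      have h2 : Relation.EqvGen (StripLink S π) (edgeAt n hn j (j + 1)) (edgeAt n hn j (j + 2)) := by
        rw [e1, e2]; exact .symm _ _ (.rel _ _ (.secondInner _ hb))
      have h3 := μ.pn_pn
      have h4 := @pn_lt _ μ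
      have h5 := @pn_ne _ μ
      rw [pn_e (by omega)]
      unfold eFun
      by_cases c1 : x = j + 1
      · rw [if_pos c1, c1]; exact h1
      by_cases c2 : x = j + 1 + 1
      · rw [if_neg c1, if_pos c2, c2]; exact h1.symm
      rw [if_neg c1, if_neg c2, edgeAt_succ hn c1 c2]
      by_cases c3 : μ.pn x = j + 1
      · have h7 := h3 x
        have h6 := h3 (j + 1 + 1)
        rw [if_pos c3, edgeAt_succ hn (by grind) (by grind)]
        have := ih hx
        rw [c3] at this
        exact (this.trans _ _ _ h2).trans _ _ _ (ih (by omega))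
      by_cases c4 : μ.pn x = j + 1 + 1
      · have h7 := h3 x
        have h6 := h3 (j + 1)
        rw [if_neg c3, if_pos c4, edgeAt_succ hn (by grind) (by grind)]
        have := ih hx
        rw [c4] at this
        exact (this.trans _ _ _ h2.symm).trans _ _ _ (ih (by omega))
      rw [if_neg c3, if_neg c4, edgeAt_succ hn c3 c4]
      exact ih hx
    · simp only [if_true]
      have key : ∀ y, Relation.EqvGen (StripLink S π) (edgeAt n hn (j + 1) y) (edgeAt n hn j y) := by
        intro y
        by_cases c1 : y = j + 1
        · rw [c1, e3, e1]; exact .rel _ _ (.firstOuter _ hb)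
        by_cases c2 : y = j + 2
        · rw [c2, e4, e2]; exact .symm _ _ (.rel _ _ (.firstInner _ hb))
        rw [edgeAt_succ hn c1 c2]
        exact .refl _
      exact ((key x).trans _ _ _ (ih hx)).trans _ _ _ (key _).symm

/-- The converse of `eqvGen_run`, stated with invariants: a colouring of the current points that is
constant on arches extends to all edges already passed, compatibly with every elementary connection.
Edges of different colours are then certainly not connected. -/
theorem exists_coloring {C : Type*} (S : Fin (2 * n) → Bool) (π : LinkPattern n) {j : ℕ}
    (hj : j ≤ 2 * n) (g : ℕ → C)
    (hg : ∀ x < 2 * n + 2, g ((run (sext S) 0 j (ins 0 π)).pn x) = g x) :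
    ∃ fi fs fo : ℕ → C, fs 0 = g 0 ∧ (∀ i < j, fo i = g (i + 1)) ∧ fs j = g (j + 1) ∧
      (∀ i, j ≤ i → i < 2 * n → fi i = g (i + 2)) ∧ (∀ i < 2 * n, fi (π.pn i) = fi i) ∧
      ∀ i < j, (sext S i = true → fi i = fs (i + 1) ∧ fo i = fs i) ∧
        (sext S i = false → fi i = fs i ∧ fo i = fs (i + 1)) := by
  induction j generalizing g with
  | zero =>
    refine ⟨fun i => g (i + 2), fun _ => g 0, fun _ => g 0, rfl, by simp, ?_, fun i _ _ => rfl, ?_,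
      by simp⟩
    · have := hg 1 (by omega)
      rw [run, pn_ins] at this
      simpa [insFun] using this
    · intro i hi
      have := hg (i + 2) (by omega)
      rw [run, pn_ins_zero_le _ (by omega)] at this
      simpa using this
  | succ j ih =>
    rw [run, zero_add] at hg
    set μ := run (sext S) 0 j (ins 0 π) with hμ
    have h3 := μ.pn_pn
    have h4 := @pn_lt _ μ
    cases hb : sext S j
    · simp only [hb, Bool.false_eq_true, if_false] at hg
      rw [pn_e' (by omega)] at hg
      obtain ⟨fi, fs, fo, f0, f1, f2, f3, f4, f5⟩ := ih (by omega)
        -- Going back through a generator, the points `j + 1` and `j + 2` lie on the arch just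
        -- closed up; their common colour is read off at their partners before the generator acted.
        (fun x => if x = j + 1 then g (μ.pn (j + 1)) else if x = j + 2 then g (μ.pn (j + 2)) else g x)
        (by
          intro x hx
          have h5 := hg x hx
          have h6 := hg (μ.pn (j + 1)) (h4 (by omega))
          have h7 := hg (j + 1) (by omega)
          unfold eFun at h5 h6 h7
          grind)
      have k2 : g (j + 2) = g (j + 1) := by
        have := hg (j + 1) (by omega)
        simpa [eFun] using this
      have k1 : g (μ.pn (j + 2)) = g (μ.pn (j + 1)) := by
        have h6 := hg (μ.pn (j + 1)) (h4 (by omega))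
        have h7 := h3 (j + 1)
        have h8 := μ.pn_ne (show j + 1 < 2 * (n + 1) by omega)
        unfold eFun at h6
        clear f1 f2 f3 f4 f5 ih hg
        by_cases c1 : μ.pn (j + 1) = j + 2
        · rw [c1] at h7
          rw [h7, c1, k2]
        · rw [if_neg h8, if_neg c1, h7, if_pos rfl] at h6
          exact h6
      have k3 := f3 j le_rfl (by omega)
      simp only [show j + 2 ≠ j + 1 by omega, if_true, if_false] at f2 k3
      clear hg ih hμ h3 h4
      refine ⟨fi, fun i => if i = j + 1 then g (j + 2) else fs i,
        fun i => if i = j then g (j + 1) else fo i, ?_, ?_, ?_, ?_, f4, ?_⟩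
      · simpa using f0
      · intro i hi
        by_cases h : i = j
        · simp [h]
        · have := f1 i (by omega)
          simp only [h, if_false, show i + 1 ≠ j + 1 by omega, show i + 1 ≠ j + 2 by omega] at this ⊢
          exact this
      · simp
      · intro i h1 h2
        rw [f3 i (by omega) h2]
        simp only [show i + 2 ≠ j + 1 by omega, show i + 2 ≠ j + 2 by omega, if_false]
      · intro i hi
        by_cases h : i = j
        · subst h
          simp [hb, k3, f2, k1, k2]
        · have h5 := f5 i (by omega)
          simpa only [h, if_false, show i + 1 ≠ j + 1 by omega, show i ≠ j + 1 by omega] using h5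
    · simp only [hb, if_true] at hg
      obtain ⟨fi, fs, fo, f0, f1, f2, f3, f4, f5⟩ := ih (by omega) g hg
      refine ⟨fi, fun i => if i = j + 1 then g (j + 2) else fs i,
        fun i => if i = j then g (j + 1) else fo i, ?_, ?_, ?_, ?_, f4, ?_⟩
      · grind
      · intro i hi
        have := f1 i
        grind
      · grind
      · intro i h1 h2
        have := f3 i
        grind
      · intro i hi
        have h5 := f5 i
        have h8 := f3 j (by omega) (by omega)
        grind

theorem isResult_res (S : Fin (2 * n) → Bool) (π : LinkPattern n) : IsResult S π (res S π) := by
  intro i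
  have hi := i.2
  have hn : 0 < 2 * n := by omega
  set μ := run (sext S) 0 (2 * n) (ins 0 π) with hμ
  have key := fun {x} hx => @eqvGen_run n hn S π (2 * n) le_rfl x hx
  rw [← hμ] at key
  have o : ∀ l : ℕ, ∀ hl : l < 2 * n, edgeAt n hn (2 * n) (l + 1) = .outer ⟨l, hl⟩ := by
    intro l hl
    rw [edgeAt, if_neg (by omega), if_pos (by omega), Nat.add_sub_cancel, sideIdx, dif_pos hl]
  have e0 : edgeAt n hn (2 * n) 0 = edgeAt n hn (2 * n) (2 * n + 1) := by simp [edgeAt, sideIdx]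
  have h1 := pn_close μ hi
  have h2 : res S π = close μ := rfl
  have h3 := μ.pn_pn
  have h4 := @pn_lt _ μ
  have h5 := @pn_ne _ μ
  have hr : ((res S π).partner i).val = closeFun μ.pn (2 * n + 1) i := by rw [← h1, ← h2, pn_val]
  have hlt := ((res S π).partner i).2
  have ho : StripEdge.outer ((res S π).partner i) =
      edgeAt n hn (2 * n) (closeFun μ.pn (2 * n + 1) i + 1) := by
    rw [← hr, o _ hlt]
  rw [ho, show StripEdge.outer i = edgeAt n hn (2 * n) (i + 1) from (o _ hi).symm]
  have k1 := key (show (i : ℕ) + 1 < 2 * n + 2 by omega)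
  unfold closeFun
  have h6 := h4 (show (i : ℕ) + 1 < 2 * (n + 1) by omega)
  split_ifs with c1 c2
  · rw [c1, e0] at k1
    have k2 := key (show 2 * n + 1 < 2 * n + 2 by omega)
    have : μ.pn (2 * n + 1) ≠ 0 := by grind
    rw [Nat.sub_add_cancel (by omega)]
    exact k1.trans _ _ _ k2
  · rw [c2, ← e0] at k1
    have k2 := key (show 0 < 2 * n + 2 by omega)
    have : μ.pn 0 ≠ 0 := by grind
    rw [Nat.sub_add_cancel (by omega)]
    exact k1.trans _ _ _ k2
  · rwa [Nat.sub_add_cancel (by omega)]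

/-- The line through `i` is coloured differently from all others, so the outer edge of `i` is
connected to no outer edge besides its own and that of its partner. -/
theorem eq_of_eqvGen (S : Fin (2 * n) → Bool) (π : LinkPattern n) {i k : Fin (2 * n)} (hik : k ≠ i)
    (h : Relation.EqvGen (StripLink S π) (.outer i) (.outer k)) : k = (res S π).partner i := by
  have hi := i.2
  have hn : 0 < 2 * n := by omega
  set μ := run (sext S) 0 (2 * n) (ins 0 π) with hμ
  have h1 := fun {j} hj => @pn_close _ μ j hj
  have h2 : res S π = close μ := rfl
  rw [← h2] at h1
  have h3 := μ.pn_pn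
  have h4 := @pn_lt _ μ
  have h5 := @pn_ne _ μ
  have h6 := (res S π).pn_pn
  have h7 := @pn_lt _ (res S π)
  set c : ℕ → Prop := fun y => y = i + 1 ∨ y = (res S π).pn i + 1 with hc
  have hcc : ∀ x < 2 * n, (c ((res S π).pn x + 1) ↔ c (x + 1)) := by
    intro x hx
    have := h6 x
    have := h6 i
    simp only [hc]
    grind
  have hc0 : ¬ c 0 := by simp [hc]
  have hc1 : ¬ c (2 * n + 1) := by
    have := h7 hi
    simp only [hc]
    omega
  obtain ⟨fi, fs, fo, f0, f1, f2, f3, f4, f5⟩ := exists_coloring S π le_rfl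
    -- The points `0` and `2 * n + 1` sit on the same glued side and need one colour. It is the
    -- distinguished one exactly when the line through that side is the line of `i`.
    (fun x => if x = 0 ∨ x = 2 * n + 1 then c (μ.pn 0) ∨ c (μ.pn (2 * n + 1)) else c x) (by
      intro x hx
      rw [← hμ]
      have a1 := hcc (x - 1)
      have a2 := @h1 (x - 1)
      have a3 := hcc (μ.pn (2 * n + 1) - 1)
      have a4 := @h1 (μ.pn (2 * n + 1) - 1)
      have a5 := h3 x
      have a6 := h3 0
      have a7 := h3 (2 * n + 1)
      have a8 := @h5 0
      have a9 := @h5 (2 * n + 1)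
      have a10 := @h4 0
      have a11 := @h4 (2 * n + 1)
      have a12 := @h4 x
      clear_value c
      clear hcc h1 h3 h4 h5 h6 h7
      apply propext
      unfold closeFun at *
      have a16 : μ.pn 0 ≠ 2 * n + 1 → (c (μ.pn 0) ↔ c (μ.pn (2 * n + 1))) := by
        intro hne
        have b1 : μ.pn (2 * n + 1) ≠ 0 := by grind
        have b2 : μ.pn (2 * n + 1) - 1 + 1 = μ.pn (2 * n + 1) := by omega
        have b3 : μ.pn (2 * n + 1) ≠ 2 * n + 1 := a9 (by omega)
        have b4 := a8 (by omega)
        rw [b2, a7, if_neg (by omega), if_pos rfl] at a4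
        rw [a4 (by omega), b2, Nat.sub_add_cancel (by omega)] at a3
        exact a3 (by omega)
      clear a3 a4
      by_cases x0 : x = 0
      · subst x0; clear a1 a2 a5; grind
      by_cases x1 : x = 2 * n + 1
      · subst x1; clear a1 a2 a5; grind
      have a13 : x - 1 + 1 = x := by omega
      rw [a13] at a1 a2
      have a14 := a2 (by omega)
      have a15 := a1 (by omega)
      clear a1 a2
      grind (splits := 30))
  rw [← hμ] at *
  have fs' : ∀ l : Fin (2 * n), fs (finRotate (2 * n) l) = fs (l + 1) := by
    intro l
    have := l.2
    rw [finRotate_eq_sideIdx hn, sideIdx]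
    split_ifs with hl
    · rfl
    · rw [show (l : ℕ) + 1 = 2 * n by omega, f0, f2]
      simp
  let F : StripEdge (2 * n) → Prop := fun
    | .inner l => fi l
    | .outer l => fo l
    | .side l => fs l
  have hF : ∀ x y, Relation.EqvGen (StripLink S π) x y → F x = F y := by
    intro x y hxy
    induction hxy with
    | rel x y hxy =>
      have hs : ∀ l : Fin (2 * n), sext S l = S l := fun l => dif_pos l.2
      cases hxy with
      | arch l => exact ((f4 l l.2).symm.trans (by rw [pn_val]))
      | firstInner l hl => exact ((f5 l l.2).1 ((hs l).trans hl)).1.trans (fs' l).symm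
      | firstOuter l hl => exact ((f5 l l.2).1 ((hs l).trans hl)).2
      | secondInner l hl => exact ((f5 l l.2).2 ((hs l).trans hl)).1
      | secondOuter l hl => exact ((f5 l l.2).2 ((hs l).trans hl)).2.trans (fs' l).symm
    | refl x => rfl
    | symm x y _ ih => exact ih.symm
    | trans x y z _ _ ih1 ih2 => exact ih1.trans ih2
  have h8 : fo i = fo k := hF _ _ h
  rw [f1 i hi, f1 k k.2, if_neg (by omega), if_neg (by have := k.2; omega)] at h8
  have h9 : c (k + 1) := h8 ▸ Or.inl rfl
  rcases h9 with h9 | h9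
  · exact absurd (Fin.ext (by omega)) hik
  · ext
    rw [← pn_val]
    omega

theorem isResult_iff (S : Fin (2 * n) → Bool) (π π' : LinkPattern n) :
    IsResult S π π' ↔ res S π = π' := by
  refine ⟨fun h => ?_, fun h => h ▸ isResult_res S π⟩
  apply LinkPattern.ext
  funext i
  exact (eq_of_eqvGen S π (π'.partner_ne i) (h i)).symm

end LinkPattern
end

/-! ### Local relations of the transfer matrix -/

section

theorem isPrimitiveRoot_q : IsPrimitiveRoot q 3 := by
  have := Complex.isPrimitiveRoot_exp 3 (by norm_num)
  rwa [show (2 * Real.pi * Complex.I / (3 : ℕ) : ℂ) = 2 * Real.pi * Complex.I / 3 by norm_num] at this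

theorem q_pow_three : q ^ 3 = 1 := isPrimitiveRoot_q.pow_eq_one

theorem q_ne_one : q ≠ 1 := isPrimitiveRoot_q.ne_one (by norm_num)

theorem q_ne_zero : q ≠ 0 := isPrimitiveRoot_q.ne_zero (by norm_num)

theorem q_sq : q ^ 2 = -1 - q := by
  have h : (q - 1) * (q ^ 2 + q + 1) = 0 := by linear_combination q_pow_three
  rcases mul_eq_zero.1 h with h | h
  · exact absurd (sub_eq_zero.1 h) q_ne_one
  · linear_combination h

theorem q_inv : q⁻¹ = q ^ 2 := by
  exact inv_eq_of_mul_eq_one_right (by linear_combination q_pow_three)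

theorem q_sq_ne_one : q ^ 2 ≠ 1 := fun h => q_ne_one (by linear_combination q_pow_three - q * h)

theorem q_sq_ne_q : q ^ 2 ≠ q := fun h => q_ne_one (by
  have : q * (q - 1) = 0 := by linear_combination h
  exact sub_eq_zero.1 ((mul_eq_zero.1 this).resolve_left q_ne_zero))

open scoped Classical in
/-- Linear extension of a map between link patterns. -/
def push {n m : ℕ} (f : LinkPattern n → LinkPattern m) :
    (LinkPattern n → ℂ) →ₗ[ℂ] (LinkPattern m → ℂ) where
  toFun v σ := ∑ π, if f π = σ then v π else 0
  map_add' v w := by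
    funext σ
    simp only [Pi.add_apply, ← Finset.sum_add_distrib]
    exact Finset.sum_congr rfl fun π _ => by split_ifs <;> simp
  map_smul' c v := by
    funext σ
    simp only [Pi.smul_apply, smul_eq_mul, RingHom.id_apply, Finset.mul_sum, mul_ite, mul_zero]

open scoped Classical in
theorem push_apply {n m : ℕ} (f : LinkPattern n → LinkPattern m) (v : LinkPattern n → ℂ)
    (σ : LinkPattern m) : push f v σ = ∑ π, if f π = σ then v π else 0 := rfl

theorem push_push {n m l : ℕ} (g : LinkPattern m → LinkPattern l)
    (f : LinkPattern n → LinkPattern m) (v : LinkPattern n → ℂ) :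
    push g (push f v) = push (fun π => g (f π)) v := by
  classical
  funext σ
  simp only [push_apply]
  simp_rw [← Finset.sum_filter, Finset.sum_filter _ (fun σ => ∑ π with f π = σ, v π)]
  simp_rw [Finset.sum_filter]
  have : ∀ τ : LinkPattern m, (if g τ = σ then ∑ π, (if f π = τ then v π else 0) else 0) =
      ∑ π, if f π = τ then (if g (f π) = σ then v π else 0) else 0 := by
    intro τ
    split_ifs with h
    · exact Finset.sum_congr rfl fun π _ => by split_ifs with h1 h2 <;> simp_all
    · exact (Finset.sum_eq_zero fun π _ => by split_ifs with h1 h2 <;> simp_all).symm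
  simp_rw [this]
  rw [Finset.sum_comm]
  simp

theorem push_inj_apply {n m : ℕ} {f : LinkPattern n → LinkPattern m} (hf : Function.Injective f)
    (v : LinkPattern n → ℂ) (π : LinkPattern n) : push f v (f π) = v π := by
  classical
  simp [push_apply, hf.eq_iff]

theorem push_apply_eq_zero {n m : ℕ} {f : LinkPattern n → LinkPattern m} (v : LinkPattern n → ℂ)
    {σ : LinkPattern m} (h : ∀ π, f π ≠ σ) : push f v σ = 0 := by
  classical
  simp [push_apply, h]

/-- The numerator of the weight of a plaquette. -/
def wt (t w : ℂ) : Bool → ℂ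
  | true => q * w - q⁻¹ * t
  | false => w - t

/-- The transfer matrix multiplied by its denominator. -/
def transferNum {n : ℕ} (t : ℂ) (z : Fin (2 * n) → ℂ) :
    (LinkPattern n → ℂ) →ₗ[ℂ] (LinkPattern n → ℂ) :=
  ∑ S : Fin (2 * n) → Bool, (∏ i, wt t (z i) (S i)) • push (LinkPattern.res S)

theorem transferNum_apply {n : ℕ} (t : ℂ) (z : Fin (2 * n) → ℂ) (v : LinkPattern n → ℂ) :
    transferNum t z v = ∑ S : Fin (2 * n) → Bool,
      (∏ i, wt t (z i) (S i)) • push (LinkPattern.res S) v := by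
  simp [transferNum, LinearMap.sum_apply]

theorem plaquetteWeight_eq (t w : ℂ) (b : Bool) :
    plaquetteWeight t w b = wt t w b / (q * t - q⁻¹ * w) := by cases b <;> rfl

theorem transferMatrix_mulVec {n : ℕ} (t : ℂ) (z : Fin (2 * n) → ℂ) (v : LinkPattern n → ℂ) :
    (transferMatrix n t z).mulVec v = (∏ i, (q * t - q⁻¹ * z i))⁻¹ • transferNum t z v := by
  classical
  funext σ
  rw [transferNum_apply]
  simp only [Matrix.mulVec, dotProduct, transferMatrix, Pi.smul_apply, Finset.sum_apply, push_apply,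
    smul_eq_mul, Finset.mul_sum, Finset.sum_mul]
  rw [Finset.sum_comm]
  refine Finset.sum_congr rfl fun S _ => Finset.sum_congr rfl fun π _ => ?_
  simp only [plaquetteWeight_eq, Finset.prod_div_distrib, LinkPattern.isResult_iff]
  split_ifs <;> ring

theorem prod_wt_ins2 {n : ℕ} (t : ℂ) (k : Fin (2 * n + 1)) (x y : ℂ) (z : Fin (2 * n) → ℂ)
    (b c : Bool) (S : Fin (2 * n) → Bool) :
    ∏ i, wt t (ins2 k x y z i) (ins2 k b c S i) = wt t x b * wt t y c * ∏ i, wt t (z i) (S i) := by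
  rw [prod_skip k]
  simp

/-- Fusion at the special ratio $q^2$. Three of the four plaquette pairs give the same result on a
little arch and their weights cancel. The remaining pair lets the arch through and contributes the
two corresponding denominators. -/
theorem transferNum_ins {n : ℕ} (t : ℂ) (k : Fin (2 * n + 1)) (x : ℂ) (z : Fin (2 * n) → ℂ)
    (v : LinkPattern n → ℂ) :
    transferNum t (ins2 k x (q ^ 2 * x) z) (push (LinkPattern.ins k) v) =
      ((q * t - q⁻¹ * x) * (q * t - q⁻¹ * (q ^ 2 * x))) •
        push (LinkPattern.ins k) (transferNum t z v) := by
  rw [transferNum_apply, transferNum_apply, sum_ins2 k, map_sum, Finset.smul_sum]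
  refine Finset.sum_congr rfl fun S _ => ?_
  simp only [Fintype.sum_bool, prod_wt_ins2, push_push, map_smul, LinkPattern.res_ins2_false_true,
    LinkPattern.res_ins2_ins (show (true, true) ≠ (false, true) by decide),
    LinkPattern.res_ins2_ins (show (false, false) ≠ (false, true) by decide)]
  generalize push (fun π => LinkPattern.res (ins2 k true false S) (LinkPattern.ins k π)) v = V
  generalize push (fun π => LinkPattern.ins k (LinkPattern.res S π)) v = W
  generalize ∏ i, wt t (z i) (S i) = p
  have h2 := q_sq
  -- Total weight of the three plaquette pairs that produce the vector `V`.
  have e1 : wt t x true * wt t (q ^ 2 * x) true + wt t x true * wt t (q ^ 2 * x) false +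
      wt t x false * wt t (q ^ 2 * x) false = 0 := by
    simp only [wt, q_inv]
    grind
  have e2 : wt t x false * wt t (q ^ 2 * x) true =
      (q * t - q⁻¹ * x) * (q * t - q⁻¹ * (q ^ 2 * x)) := by
    simp only [wt, q_inv]
    grind
  funext σ
  simp only [Pi.add_apply, Pi.smul_apply, smul_eq_mul]
  linear_combination p * V σ * e1 + p * W σ * e2

/-- The Yang-Baxter relation: the operator $(qy-q^{-1}x)+(y-x)e_k$ intertwines the transfer matrices
with $x,y$ in either order. Cleared of denominators, it is a comparison of five vectors. -/
theorem transferNum_exchange {n : ℕ} (t : ℂ) (k : Fin (2 * n + 1)) (x y : ℂ) (z : Fin (2 * n) → ℂ)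
    (v : LinkPattern (n + 1) → ℂ) :
    transferNum t (ins2 k y x z)
        ((q * y - q⁻¹ * x) • v + (y - x) • push (LinkPattern.e k) v) =
      (q * y - q⁻¹ * x) • transferNum t (ins2 k x y z) v +
        (y - x) • push (LinkPattern.e k) (transferNum t (ins2 k x y z) v) := by
  simp only [transferNum_apply]
  rw [map_sum, sum_ins2 k, sum_ins2 k, sum_ins2 k, Finset.smul_sum, Finset.smul_sum,
    ← Finset.sum_add_distrib]
  refine Finset.sum_congr rfl fun S _ => ?_
  simp only [Fintype.sum_bool, prod_wt_ins2, push_push, map_smul, map_add,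
    LinkPattern.e_res (show (true, true) ≠ (true, false) by decide),
    LinkPattern.e_res (show (false, false) ≠ (true, false) by decide),
    LinkPattern.e_res (show (false, true) ≠ (true, false) by decide),
    LinkPattern.res_e (show (true, true) ≠ (false, true) by decide),
    LinkPattern.res_e (show (false, false) ≠ (false, true) by decide),
    LinkPattern.res_e (show (true, false) ≠ (false, true) by decide),
    LinkPattern.e_res_eq_res_e]
  generalize push (fun π => LinkPattern.res (ins2 k true false S) π) v = V₁
  generalize push (fun π => LinkPattern.res (ins2 k false true S) π) v = V₂
  generalize push (fun π => LinkPattern.res (ins2 k true true S) π) v = V₃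
  generalize push (fun π => LinkPattern.res (ins2 k false false S) π) v = V₄
  generalize push (fun π => LinkPattern.res (ins2 k false true S) (LinkPattern.e k π)) v = V₅
  generalize ∏ i, wt t (z i) (S i) = p
  have h2 := q_sq
  -- Only the coefficients of `V₁` and `V₂` require an identity; those of `V₃`, `V₄` and `V₅` agree
  -- on sight.
  have e1 : (q * y - q⁻¹ * x) * (wt t x true * wt t y false - wt t y true * wt t x false) =
      (y - x) * (wt t x true * wt t y true + wt t x false * wt t y false +
        wt t y true * wt t x false) := by
    simp only [wt, q_inv]
    grind
  have e2 : (q * y - q⁻¹ * x) * (wt t y false * wt t x true - wt t x false * wt t y true) =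
      (y - x) * (wt t x true * wt t y true + wt t x false * wt t y false +
        wt t x false * wt t y true) := by
    simp only [wt, q_inv]
    grind
  funext σ
  simp only [Pi.add_apply, Pi.smul_apply, smul_eq_mul]
  linear_combination -p * V₁ σ * e1 + p * V₂ σ * e2

end

/-! ### Polynomial interpolation and the wheel condition -/

section

open MvPolynomial (eval aeval degreeOf)

section Polynomials

variable {σ τ : Type*}

theorem eval_aeval_polynomial (f : σ → Polynomial ℂ) (P : MvPolynomial σ ℂ) (x : ℂ) :
    (aeval f P).eval x = eval (fun j => (f j).eval x) P := by
  rw [← Polynomial.coe_aeval_eq_eval, ← AlgHom.comp_apply, MvPolynomial.comp_aeval]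
  simp only [Polynomial.coe_aeval_eq_eval]
  rfl

theorem eval_aeval (f : σ → MvPolynomial τ ℂ) (P : MvPolynomial σ ℂ) (x : τ → ℂ) :
    eval x (aeval f P) = eval (fun j => eval x (f j)) P := by
  rw [← MvPolynomial.coe_aeval_eq_eval, RingHom.coe_coe, ← AlgHom.comp_apply,
    MvPolynomial.comp_aeval]
  rfl

variable [Fintype σ]

theorem natDegree_aeval_le {R : Type*} [CommRing R] [Algebra ℂ R] (f : σ → Polynomial R)
    (P : MvPolynomial σ ℂ) : (aeval f P).natDegree ≤ ∑ j, degreeOf j P * (f j).natDegree := by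
  rw [MvPolynomial.aeval_def, MvPolynomial.eval₂_eq']
  refine Polynomial.natDegree_sum_le_of_forall_le _ _ fun m hm => ?_
  rw [show algebraMap ℂ (Polynomial R) (P.coeff m) = Polynomial.C (algebraMap ℂ R (P.coeff m)) from rfl]
  refine (Polynomial.natDegree_C_mul_le _ _).trans ((Polynomial.natDegree_prod_le _ _).trans ?_)
  refine Finset.sum_le_sum fun j _ => (Polynomial.natDegree_pow_le).trans ?_
  exact Nat.mul_le_mul_right _ (MvPolynomial.monomial_le_degreeOf j hm)

theorem degreeOf_aeval_le (f : σ → MvPolynomial τ ℂ) (P : MvPolynomial σ ℂ) (l : τ) :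
    degreeOf l (aeval f P) ≤ ∑ j, degreeOf j P * degreeOf l (f j) := by
  rw [MvPolynomial.aeval_def, MvPolynomial.eval₂_eq']
  refine (MvPolynomial.degreeOf_sum_le _ _ _).trans (Finset.sup_le fun m hm => ?_)
  rw [MvPolynomial.algebraMap_eq]
  refine (MvPolynomial.degreeOf_C_mul_le _ _ _).trans ((MvPolynomial.degreeOf_prod_le _ _ _).trans ?_)
  refine Finset.sum_le_sum fun j _ => (MvPolynomial.degreeOf_pow_le _ _ _).trans ?_
  exact Nat.mul_le_mul_right _ (MvPolynomial.monomial_le_degreeOf j hm)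

theorem polynomial_eq_zero_of_roots {ι : Type*} [Fintype ι] {p : Polynomial ℂ} {r : ι → ℂ}
    (hr : Function.Injective r) (h : ∀ i, p.eval (r i) = 0) (hp : p.natDegree < Fintype.card ι) :
    p = 0 :=
  Polynomial.eq_zero_of_natDegree_lt_card_of_eval_eq_zero p hr h hp

theorem polynomial_eq_prod_of_roots {R ι : Type*} [CommRing R] [IsDomain R] [Fintype ι]
    {p : Polynomial R} {r : ι → R} (hr : Function.Injective r) (h : ∀ i, p.eval (r i) = 0)
    (hp : p.natDegree ≤ Fintype.card ι) :
    p = Polynomial.C (p.coeff (Fintype.card ι)) * ∏ i, (Polynomial.X - Polynomial.C (r i)) := by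
  have hm : (∏ i, (Polynomial.X - Polynomial.C (r i))).Monic :=
    Polynomial.monic_prod_of_monic _ _ fun i _ => Polynomial.monic_X_sub_C _
  have hd : (∏ i, (Polynomial.X - Polynomial.C (r i))).natDegree = Fintype.card ι := by
    rw [Polynomial.natDegree_prod_of_monic _ _ fun i _ => Polynomial.monic_X_sub_C _]
    simp
  rw [← sub_eq_zero]
  set s := p - Polynomial.C (p.coeff (Fintype.card ι)) * ∏ i, (Polynomial.X - Polynomial.C (r i))
    with hs
  by_contra hne
  have h1 : s.natDegree < Fintype.card ι := by
    refine lt_of_le_of_ne ?_ fun h' => hne ?_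
    · refine (Polynomial.natDegree_sub_le _ _).trans (max_le hp ?_)
      exact (Polynomial.natDegree_C_mul_le _ _).trans hd.le
    · have : s.coeff (Fintype.card ι) = 0 := by
        rw [hs, Polynomial.coeff_sub, Polynomial.coeff_C_mul]
        nth_rewrite 3 [← hd]
        rw [hm.coeff_natDegree, mul_one, sub_self]
      rw [← h'] at this
      exact Polynomial.leadingCoeff_eq_zero.1 this
  refine hne (Polynomial.eq_zero_of_natDegree_lt_card_of_eval_eq_zero s hr (fun i => ?_) h1)
  rw [hs, Polynomial.eval_sub, h, Polynomial.eval_mul, Polynomial.eval_prod,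
    Finset.prod_eq_zero (Finset.mem_univ i) (by simp)]
  simp

/-- Nonzero entries with pairwise distinct cubes. -/
def Generic {ι : Type*} (z : ι → ℂ) : Prop := (∀ i, z i ≠ 0) ∧ ∀ i j, i ≠ j → z i ^ 3 ≠ z j ^ 3

theorem exists_generic (ι : Type*) [Finite ι] : ∃ z : ι → ℂ, Generic z := by
  obtain ⟨m, ⟨f⟩⟩ := Finite.exists_equiv_fin ι
  refine ⟨fun i => ((f i : ℕ) + 1 : ℕ), fun i => Nat.cast_ne_zero.2 (by omega), fun i j hij h => ?_⟩
  simp only at h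
  have h : (((f i : ℕ) + 1) ^ 3 : ℕ) = ((f j : ℕ) + 1) ^ 3 := by exact_mod_cast h
  have := Nat.pow_left_injective (n := 3) (by norm_num) h
  exact hij (f.injective (Fin.ext (by simpa using this)))

/-- Multiplying by the nonzero polynomial $\prod z_i\prod(z_i^3-z_j^3)$ kills the values at
non-generic points. Cubes are used so that the multiples of the coordinates by powers of $q$ remain
distinct. -/
theorem eq_zero_of_generic {P : MvPolynomial σ ℂ} (h : ∀ z, Generic z → eval z P = 0) : P = 0 := by
  classical
  set D : MvPolynomial σ ℂ := (∏ i, MvPolynomial.X i) *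
    ∏ p : σ × σ with p.1 ≠ p.2, (MvPolynomial.X p.1 ^ 3 - MvPolynomial.X p.2 ^ 3) with hD
  have hev : ∀ z, eval z D = (∏ i, z i) * ∏ p : σ × σ with p.1 ≠ p.2, (z p.1 ^ 3 - z p.2 ^ 3) := by
    intro z; simp [hD, map_mul, map_prod]
  have hz : ∀ z, eval z D ≠ 0 ↔ Generic z := by
    intro z
    rw [hev, mul_ne_zero_iff, Finset.prod_ne_zero_iff, Finset.prod_ne_zero_iff]
    simp [Generic, sub_ne_zero]
  have h0 : P * D = 0 := by
    apply MvPolynomial.funext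
    intro z
    rw [map_mul, map_zero]
    by_cases hg : Generic z
    · rw [h z hg, zero_mul]
    · rw [not_not.1 (mt (hz z).1 hg), mul_zero]
  refine (mul_eq_zero.1 h0).resolve_right fun hD0 => ?_
  obtain ⟨z, hg⟩ := exists_generic σ
  exact (hz z).2 hg (by rw [hD0, map_zero])

theorem exists_avoid {ι : Type*} [Finite ι] (z : ι → ℂ) : ∃ x : ℂ, ∀ i, z i ≠ x := by
  obtain ⟨x, hx⟩ := (Set.finite_range z).exists_notMem
  exact ⟨x, fun i h => hx ⟨i, h⟩⟩

end Polynomials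

variable {n : ℕ}

/-- The wheel condition together with the degree condition. -/
structure IsWheel (n : ℕ) (P : MvPolynomial (Fin (2 * n)) ℂ) : Prop where
  degree : ∀ i, degreeOf i P < n
  vanish : ∀ (z : Fin (2 * n) → ℂ) (i j k : Fin (2 * n)), i < j → j < k → z j = q ^ 2 * z i →
    z k = q ^ 2 * z j → eval z P = 0

/-- The space of polynomials satisfying the wheel condition. -/
def wheelSpace (n : ℕ) : Submodule ℂ (MvPolynomial (Fin (2 * n)) ℂ) where
  carrier := {P | IsWheel n P}
  zero_mem' := ⟨fun i => by simpa using Nat.pos_of_ne_zero (by rintro rfl; exact i.elim0),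
    fun z _ _ _ _ _ _ _ => map_zero _⟩
  add_mem' hP hQ := ⟨fun i => (MvPolynomial.degreeOf_add_le i _ _).trans_lt
      (max_lt (hP.degree i) (hQ.degree i)),
    fun z i j k h1 h2 h3 h4 => by
      rw [map_add, hP.vanish z i j k h1 h2 h3 h4, hQ.vanish z i j k h1 h2 h3 h4, add_zero]⟩
  smul_mem' c P hP := ⟨fun i => by
      rw [MvPolynomial.smul_eq_C_mul]
      exact (MvPolynomial.degreeOf_C_mul_le _ _ _).trans_lt (hP.degree i),
    fun z i j k h1 h2 h3 h4 => by
      rw [MvPolynomial.smul_eval, hP.vanish z i j k h1 h2 h3 h4, mul_zero]⟩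

theorem skip_strictMono (k : Fin (2 * n + 1)) : StrictMono (skip k) := by
  intro l m h
  have h : l.val < m.val := h
  unfold skip
  split_ifs <;> simp only [Fin.lt_def] <;> omega

theorem pos_lt_posSucc (k : Fin (2 * n + 1)) : pos k < posSucc k := by
  simp [pos, posSucc, Fin.lt_def]

theorem comp_ins2 {A B : Type*} (g : A → B) (k : Fin (2 * n + 1)) (x y : A) (f : Fin (2 * n) → A)
    (j : Fin (2 * (n + 1))) : g (ins2 k x y f j) = ins2 k (g x) (g y) (fun l => g (f l)) j := by
  rcases pos_or_skip k j with rfl | rfl | ⟨l, rfl⟩ <;> simp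

/-- With $z_k=x$ and $z_{k+1}=q^2x$ the polynomial has degree at most $2n$ in $x$. It vanishes at
$x=q^2z_l$ for each of the $2n$ other variables, by the wheel condition with $z_l$ first or last
according to its position. The cofactor of these linear factors inherits both conditions. -/
theorem IsWheel.exists_restrict {P : MvPolynomial (Fin (2 * (n + 1))) ℂ} (hP : IsWheel (n + 1) P)
    (k : Fin (2 * n + 1)) : ∃ Q, IsWheel n Q ∧ ∀ z x,
      eval (ins2 k x (q ^ 2 * x) z) P = eval z Q * ∏ l, (z l - q * x) := by
  classical
  have hq3 := q_pow_three
  set R := MvPolynomial (Fin (2 * n)) ℂ with hR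
  set f : Fin (2 * (n + 1)) → Polynomial R :=
    ins2 k Polynomial.X (Polynomial.C (MvPolynomial.C (q ^ 2)) * Polynomial.X)
      (fun l => Polynomial.C (MvPolynomial.X l)) with hf
  set g := aeval f P with hg
  have hev : ∀ (z : Fin (2 * n) → ℂ) (r : R), eval z (g.eval r) =
      eval (ins2 k (eval z r) (q ^ 2 * eval z r) z) P := by
    intro z r
    have h1 : eval z (g.eval r) = ((MvPolynomial.aeval z).comp
        ((Polynomial.aeval r).restrictScalars ℂ)) g := by
      simp [Polynomial.coe_aeval_eq_eval, MvPolynomial.aeval_eq_eval]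
    rw [h1, hg, ← AlgHom.comp_apply, MvPolynomial.comp_aeval, MvPolynomial.aeval_eq_eval]
    congr 2
    funext j
    rw [hf]
    rcases pos_or_skip k j with rfl | rfl | ⟨l, rfl⟩ <;>
      simp [Polynomial.coe_aeval_eq_eval, MvPolynomial.aeval_eq_eval]
  have hdeg : g.natDegree ≤ Fintype.card (Fin (2 * n)) := by
    refine (natDegree_aeval_le _ _).trans ?_
    rw [Fintype.card_fin, sum_skip k]
    have h1 : (f (pos k)).natDegree ≤ 1 := by simp [hf]
    have h2 : (f (posSucc k)).natDegree ≤ 1 := by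
      simp only [hf, ins2_posSucc]
      exact (Polynomial.natDegree_C_mul_le _ _).trans (by simp)
    have h3 : ∀ l, (f (skip k l)).natDegree = 0 := by simp [hf]
    have h4 := hP.degree (pos k)
    have h5 := hP.degree (posSucc k)
    simp only [h3, mul_zero, Finset.sum_const_zero, add_zero]
    nlinarith
  have hroot : ∀ l, g.eval (MvPolynomial.C (q ^ 2) * MvPolynomial.X l) = 0 := by
    intro l
    apply MvPolynomial.funext
    intro z
    rw [hev, map_zero]
    simp only [map_mul, MvPolynomial.eval_C, MvPolynomial.eval_X]
    by_cases hl : l.val < k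
    · refine hP.vanish _ (skip k l) (pos k) (posSucc k) ?_ (pos_lt_posSucc k) (by simp) (by simp)
      simp [skip, hl, pos, Fin.lt_def]
    · refine hP.vanish _ (pos k) (posSucc k) (skip k l) (pos_lt_posSucc k) ?_ (by simp) ?_
      · simp [skip, hl, posSucc, Fin.lt_def]; omega
      · simp
        linear_combination (-1 - q ^ 3) * z l * hq3
  have hinj : Function.Injective fun l : Fin (2 * n) =>
      (MvPolynomial.C (q ^ 2) * MvPolynomial.X l : R) := by
    intro l m h
    have := mul_left_cancel₀ (by simpa using q_ne_zero) h
    exact MvPolynomial.X_injective this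
  have hprod := polynomial_eq_prod_of_roots hinj hroot hdeg
  -- Since $z_l-qx=-q(x-q^2z_l)$, changing the shape of the $2n$ factors costs $(-q)^{-2n}=q^n$.
  refine ⟨MvPolynomial.C (q ^ n) * g.coeff (Fintype.card (Fin (2 * n))), ?_⟩
  have key : ∀ z x, eval (ins2 k x (q ^ 2 * x) z) P =
      eval z (MvPolynomial.C (q ^ n) * g.coeff (Fintype.card (Fin (2 * n)))) *
        ∏ l, (z l - q * x) := by
    intro z x
    have h1 := hev z (MvPolynomial.C x)
    rw [MvPolynomial.eval_C] at h1
    rw [← h1]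
    nth_rewrite 1 [hprod]
    rw [Polynomial.eval_mul, Polynomial.eval_C, Polynomial.eval_prod, map_mul, map_mul, map_prod,
      MvPolynomial.eval_C]
    have h2 : ∀ l : Fin (2 * n), z l - q * x = (-q) * (x - q ^ 2 * z l) := fun l => by
      linear_combination -z l * hq3
    simp only [Polynomial.eval_sub, Polynomial.eval_X, Polynomial.eval_C, Polynomial.eval_mul,
      map_sub, map_mul,
      MvPolynomial.eval_C, MvPolynomial.eval_X]
    simp_rw [h2]
    rw [Finset.prod_mul_distrib, Finset.prod_const, Finset.card_univ, Fintype.card_fin]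
    have h3 : q ^ n * (-q) ^ (2 * n) = 1 := by
      rw [pow_mul, neg_sq, ← pow_mul, ← pow_add, show n + 2 * n = 3 * n by ring, pow_mul, hq3, one_pow]
    linear_combination -(eval z (g.coeff (2 * n)) * ∏ l, (x - q ^ 2 * z l)) * h3
  generalize MvPolynomial.C (q ^ n) * g.coeff (Fintype.card (Fin (2 * n))) = Q at key
  refine ⟨⟨fun l => ?_, fun z i j l h1 h2 h3 h4 => ?_⟩, key⟩
  · by_cases hQ : Q = 0
    · rw [hQ]
      simpa using Nat.pos_of_ne_zero (by rintro rfl; exact l.elim0)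
    have hne : ∀ m : Fin (2 * n), (MvPolynomial.X m - MvPolynomial.C q : R) ≠ 0 := by
      intro m h
      have := congrArg (eval fun _ => q + 1) h
      simp at this
    -- At $x=1$ the factor $z_l-q$ uses up one degree in $z_l$, which lowers the degree bound by
    -- one.
    have h1 : aeval (ins2 k (1 : R) (MvPolynomial.C (q ^ 2)) MvPolynomial.X) P =
        Q * ∏ m, (MvPolynomial.X m - MvPolynomial.C q) := by
      apply MvPolynomial.funext
      intro z
      rw [eval_aeval]
      simp only [comp_ins2 (eval z)]
      simpa [map_mul, map_prod] using key z 1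
    have h2 := congrArg (degreeOf l) h1
    rw [MvPolynomial.degreeOf_mul_eq hQ (Finset.prod_ne_zero_iff.2 fun m _ => hne m),
      MvPolynomial.degreeOf_prod_eq _ _ fun m _ => hne m] at h2
    have h3 : 1 ≤ degreeOf l (MvPolynomial.X l - MvPolynomial.C q : R) := by
      have h4 := MvPolynomial.degreeOf_add_le l (MvPolynomial.X l - MvPolynomial.C q : R)
        (MvPolynomial.C q)
      rwa [sub_add_cancel, MvPolynomial.degreeOf_X, if_pos rfl, MvPolynomial.degreeOf_C,
        max_eq_left (Nat.zero_le _)] at h4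
    have h4 := Finset.single_le_sum
      (f := fun m => degreeOf l (MvPolynomial.X m - MvPolynomial.C q : R))
      (fun _ _ => Nat.zero_le _) (Finset.mem_univ l)
    have h5 := degreeOf_aeval_le (ins2 k (1 : R) (MvPolynomial.C (q ^ 2)) MvPolynomial.X) P l
    rw [sum_skip k] at h5
    simp only [ins2_pos, ins2_posSucc, ins2_skip, MvPolynomial.degreeOf_C, MvPolynomial.degreeOf_one,
      mul_zero, zero_add, MvPolynomial.degreeOf_X, mul_ite, mul_one, Finset.sum_ite_eq,
      Finset.mem_univ, if_true] at h5
    have h6 := hP.degree (skip k l)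
    omega
  -- The wheel condition passes to the quotient at a value of $x$ where the product of linear
  -- factors is nonzero.
  · obtain ⟨x, hx⟩ := exists_avoid fun l => q ^ 2 * z l
    have h5 := key z x
    rw [hP.vanish _ (skip k i) (skip k j) (skip k l) (skip_strictMono k h1) (skip_strictMono k h2)
      (by simpa using h3) (by simpa using h4), eq_comm, mul_eq_zero] at h5
    refine h5.resolve_right (Finset.prod_ne_zero_iff.2 fun m _ h => hx m ?_)
    linear_combination q ^ 2 * h + x * hq3

end

/-! ### Evaluation points of link patterns determine wheel polynomials -/

section

open MvPolynomial (eval aeval degreeOf)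

variable {n : ℕ}

namespace LinkPattern

/-- An innermost arch below a given arch joins neighbours. -/
theorem exists_little (τ : LinkPattern n) {j : ℕ} (h : j < τ.pn j) :
    ∃ k, j ≤ k ∧ k + 1 ≤ τ.pn j ∧ τ.pn k = k + 1 := by
  obtain ⟨d, hd⟩ : ∃ d, τ.pn j = j + d := ⟨τ.pn j - j, by omega⟩
  induction d using Nat.strong_induction_on generalizing j with
  | _ d ih =>
    by_cases h1 : τ.pn j = j + 1
    · exact ⟨j, le_rfl, h1.ge, h1⟩
    · have h2 := τ.pn_nest (show j < j + 1 by omega) (by omega)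
      have h3 : j + 1 < 2 * n := by
        by_contra h3
        have := τ.pn_of_le (not_lt.1 h3)
        rcases Nat.lt_or_ge j (2 * n) with h4 | h4
        · have := τ.pn_lt h4
          omega
        · have := τ.pn_of_le h4
          omega
      have h4 := τ.pn_ne h3
      obtain ⟨k, k1, k2, k3⟩ := ih (τ.pn (j + 1) - (j + 1)) (by omega) (j := j + 1) (by omega) (by omega)
      exact ⟨k, by omega, by omega, k3⟩

theorem exists_ins (τ : LinkPattern (n + 1)) {k : ℕ} (hk : k < 2 * n + 1) (h : τ.pn k = k + 1) :
    ∃ τ', τ = ins ⟨k, hk⟩ τ' := by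
  have h1 := τ.pn_pn
  have h2 := @pn_lt _ τ
  have h3 := @pn_ne _ τ
  have h4 : τ.pn (k + 1) = k := by rw [← h, h1]
  set f : ℕ → ℕ := fun j => if τ.pn (if j < k then j else j + 2) < k
    then τ.pn (if j < k then j else j + 2) else τ.pn (if j < k then j else j + 2) - 2 with hf
  have h5 : ∀ j, τ.pn (if j < k then j else j + 2) ≠ k ∧
      τ.pn (if j < k then j else j + 2) ≠ k + 1 := by
    intro j
    have := h1 (if j < k then j else j + 2)
    constructor <;> intro h' <;> rw [h'] at this <;> grind
  refine ⟨ofNat n f ?_ ?_ ?_ ?_, ?_⟩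
  · intro j hj
    have := h5 j
    have := h2 (show (if j < k then j else j + 2) < 2 * (n + 1) by split_ifs <;> omega)
    simp only [hf]
    split_ifs at * <;> omega
  · intro j hj
    have h6 := h5 j
    have h7 := h1 (if j < k then j else j + 2)
    simp only [hf]
    generalize τ.pn (if j < k then j else j + 2) = x at *
    have : (if (if x < k then x else x - 2) < k then (if x < k then x else x - 2)
        else (if x < k then x else x - 2) + 2) = x := by grind
    rw [this, h7]
    grind
  · intro j hj
    have h6 := h5 j
    have h7 := h3 (show (if j < k then j else j + 2) < 2 * (n + 1) by split_ifs <;> omega)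
    simp only [hf]
    split_ifs at * <;> omega
  · intro i j a1 a2 a3 a4
    have h6 := h5 i
    have h7 := h5 j
    have h8 := τ.pn_nc (if i < k then i else i + 2) (if j < k then j else j + 2)
    simp only [hf] at a2 a3 a4
    generalize τ.pn (if i < k then i else i + 2) = x at *
    generalize τ.pn (if j < k then j else j + 2) = y at *
    grind
  · refine ext_pn fun j hj => ?_
    rw [pn_ins]
    unfold insFun
    simp only
    by_cases c1 : j = k
    · rw [if_pos c1, c1, h]
    by_cases c2 : j = k + 1
    · rw [if_neg c1, if_pos c2, c2, h4]
    rw [if_neg c1, if_neg c2, pn_ofNat (by split_ifs <;> omega)]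
    have h6 := h5 (if j < k then j else j - 2)
    have h7 : (if (if j < k then j else j - 2) < k then (if j < k then j else j - 2)
        else (if j < k then j else j - 2) + 2) = j := by grind
    simp only [hf]
    rw [h7] at h6 ⊢
    grind

theorem partner_ins_pos (k : Fin (2 * n + 1)) (τ : LinkPattern n) :
    (ins k τ).partner (pos k) = posSucc k := by
  ext
  rw [← pn_val, pn_ins]
  simp [insFun, pos, posSucc]

theorem partner_ins_posSucc (k : Fin (2 * n + 1)) (τ : LinkPattern n) :
    (ins k τ).partner (posSucc k) = pos k := by
  rw [← partner_ins_pos k τ, partner_partner]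

theorem partner_ins_skip (k : Fin (2 * n + 1)) (τ : LinkPattern n) (l : Fin (2 * n)) :
    (ins k τ).partner (skip k l) = skip k (τ.partner l) := by
  ext
  rw [← pn_val, pn_ins]
  have h := τ.pn_val l
  unfold insFun skip
  grind

theorem ins_injective (k : Fin (2 * n + 1)) : Function.Injective (ins k) := by
  intro σ τ h
  apply LinkPattern.ext
  funext l
  apply skip_injective k
  rw [← partner_ins_skip, ← partner_ins_skip, h]

end LinkPattern

/-- The evaluation point attached to a link pattern: openings get `1`, closings get `q ^ 2`. -/
def point (τ : LinkPattern n) (j : Fin (2 * n)) : ℂ := if j < τ.partner j then 1 else q ^ 2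

theorem point_ins (k : Fin (2 * n + 1)) (τ : LinkPattern n) :
    point (LinkPattern.ins k τ) = ins2 k 1 (q ^ 2 * 1) (point τ) := by
  funext j
  rcases pos_or_skip k j with rfl | rfl | ⟨l, rfl⟩
  · rw [point, LinkPattern.partner_ins_pos, if_pos (pos_lt_posSucc k), ins2_pos]
  · rw [point, LinkPattern.partner_ins_posSucc, if_neg (pos_lt_posSucc k).not_gt, ins2_posSucc, mul_one]
  · rw [point, LinkPattern.partner_ins_skip, ins2_skip, point]
    simp only [(skip_strictMono k).lt_iff_lt]

theorem exists_eq_ins (τ : LinkPattern (n + 1)) : ∃ k τ', τ = LinkPattern.ins k τ' := by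
  have h0 : 0 < τ.pn 0 := Nat.pos_of_ne_zero (τ.pn_ne (by omega))
  obtain ⟨k, -, h1, h2⟩ := τ.exists_little h0
  have := τ.pn_lt (show 0 < 2 * (n + 1) by omega)
  exact ⟨⟨k, by omega⟩, τ.exists_ins (by omega) h2⟩

/-- Each arch contributes $(1-q)(q^2-q)=3q^2$. Only nonvanishing matters for interpolation; the
exact value enters the normalisation of the ground state. -/
theorem prod_point_sub (τ : LinkPattern n) : ∏ l, (point τ l - q * 1) = (3 * q ^ 2) ^ n := by
  induction n with
  | zero => simp
  | succ n ih =>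
    obtain ⟨k, τ', rfl⟩ := exists_eq_ins τ
    rw [point_ins, prod_skip k]
    simp only [ins2_pos, ins2_posSucc, ins2_skip]
    have : (1 - q * 1) * (q ^ 2 * 1 - q * 1) = 3 * q ^ 2 := by
      have := q_sq
      grind
    rw [ih, this, ← pow_succ']

theorem three_mul_q_sq_ne_zero : 3 * q ^ 2 ≠ 0 := mul_ne_zero (by norm_num) (pow_ne_zero _ q_ne_zero)

/-- As a polynomial in $z_0$ with the other variables generic, it would have the $2n+1$ distinct
roots $qz_j$. -/
theorem eq_zero_of_vanish_zero {P : MvPolynomial (Fin (2 * (n + 1))) ℂ}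
    (hd : degreeOf 0 P < 2 * n + 1)
    (h : ∀ (z : Fin (2 * (n + 1)) → ℂ) (j : Fin (2 * (n + 1))), j ≠ 0 → z j = q ^ 2 * z 0 →
      eval z P = 0) : P = 0 := by
  classical
  have hq3 := q_pow_three
  refine eq_zero_of_generic fun z hz => ?_
  set p := aeval (Function.update (fun j => Polynomial.C (z j)) 0 Polynomial.X) P with hp
  have hev : ∀ x, p.eval x = eval (Function.update z 0 x) P := by
    intro x
    rw [hp, eval_aeval_polynomial]
    congr 2
    funext j
    by_cases hj : j = 0
    · subst hj; simp
    · simp [hj]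
  have hp0 : p = 0 := by
    refine polynomial_eq_zero_of_roots (ι := {j : Fin (2 * (n + 1)) // j ≠ 0})
      (r := fun j => q * z j) ?_ ?_ ?_
    · intro i j hij
      by_contra hne
      exact hz.2 i j (fun h => hne (Subtype.ext h)) (by rw [mul_left_cancel₀ q_ne_zero hij])
    · intro j
      rw [hev]
      refine h _ j j.2 ?_
      rw [Function.update_of_ne j.2, Function.update_self]
      linear_combination -z j * hq3
    · rw [Fintype.card_subtype_compl, Fintype.card_fin, Fintype.card_subtype_eq]
      refine (natDegree_aeval_le _ _).trans_lt ?_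
      rw [Finset.sum_eq_single 0]
      · simpa using by omega
      · intro j _ hj
        simp [hj]
      · simp
  have := hev (z 0)
  rwa [hp0, Polynomial.eval_zero, Function.update_eq_self, eq_comm] at this

/-- Vanishing spreads from neighbours to all pairs $(0,j)$ by induction on $j$, after which
`eq_zero_of_vanish_zero` applies. On $z_j=q^2z_0$ the polynomial has degree at most $2n$ in $x=z_0$,
and $2n+1$ roots are available. -/
theorem IsWheel.eq_zero_of_adjacent {P : MvPolynomial (Fin (2 * (n + 1))) ℂ}
    (hP : IsWheel (n + 1) P)
    (h : ∀ (k : Fin (2 * n + 1)) z x, eval (ins2 k x (q ^ 2 * x) z) P = 0) : P = 0 := by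
  classical
  have hq3 := q_pow_three
  have hadj : ∀ (z : Fin (2 * (n + 1)) → ℂ) (k : Fin (2 * n + 1)),
      z (posSucc k) = q ^ 2 * z (pos k) → eval z P = 0 := by
    intro z k hz
    rw [eq_ins2 k z, hz]
    exact h _ _ _
  suffices H : ∀ (m : ℕ) (j : Fin (2 * (n + 1))), j.val = m → j ≠ 0 → ∀ z : Fin (2 * (n + 1)) → ℂ,
      z j = q ^ 2 * z 0 → eval z P = 0 by
    refine eq_zero_of_vanish_zero ?_ fun z j hj hz => H j j rfl hj z hz
    have := hP.degree 0
    omega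
  intro m
  induction m using Nat.strong_induction_on with
  | _ m ih =>
    rintro j rfl hj0 z₀ hz₀
    have hjpos : 0 < j.val := Nat.pos_of_ne_zero fun h => hj0 (Fin.ext h)
    have hj2 := j.2
    by_cases hj1 : j.val = 1
    · refine hadj z₀ 0 ?_
      rw [show posSucc (0 : Fin (2 * n + 1)) = j from Fin.ext hj1.symm,
        show pos (0 : Fin (2 * n + 1)) = 0 from rfl, hz₀]
    set f : Fin (2 * (n + 1)) → MvPolynomial (Fin (2 * (n + 1))) ℂ :=
      Function.update MvPolynomial.X j (MvPolynomial.C (q ^ 2) * MvPolynomial.X 0) with hf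
    have hfe : ∀ z, eval z (aeval f P) = eval (Function.update z j (q ^ 2 * z 0)) P := by
      intro z
      rw [eval_aeval]
      congr 2
      funext l
      by_cases hl : l = j
      · subst hl; simp [hf]
      · simp [hf, hl]
    suffices h0 : aeval f P = 0 by
      have := hfe z₀
      rwa [h0, map_zero, ← hz₀, Function.update_eq_self, eq_comm] at this
    refine eq_zero_of_generic fun z hz => ?_
    rw [hfe]
    set g : Fin (2 * (n + 1)) → Polynomial ℂ :=
      Function.update (Function.update (fun l => Polynomial.C (z l)) 0 Polynomial.X) j
        (Polynomial.C (q ^ 2) * Polynomial.X) with hg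
    have hev : ∀ x, (aeval g P).eval x =
        eval (Function.update (Function.update z 0 x) j (q ^ 2 * x)) P := by
      intro x
      rw [eval_aeval_polynomial]
      congr 2
      funext l
      by_cases hl : l = j
      · subst hl; simp [hg]
      · by_cases hl0 : l = 0
        · subst hl0; simp [hg, hl]
        · simp [hg, hl, hl0]
    set i₁ : Fin (2 * (n + 1)) := ⟨j - 1, by omega⟩ with hi₁
    -- The roots: $z_{j-1}$ from the neighbours $j-1,j$; $qz_l$ for $0<l<j$ from the induction
    -- hypothesis; $q^2z_l$ for $l>j$ from the wheel condition on $0,j,l$.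
    set r : Option {l : Fin (2 * (n + 1)) // l ≠ 0 ∧ l ≠ j} → ℂ := fun o => o.elim (z i₁)
      fun l => if l.1 < j then q * z l.1 else q ^ 2 * z l.1 with hr
    have hcube : ∀ l : {l : Fin (2 * (n + 1)) // l ≠ 0 ∧ l ≠ j}, r (some l) ^ 3 = z l.1 ^ 3 := by
      intro l
      simp only [hr, Option.elim]
      split_ifs
      · rw [mul_pow, hq3, one_mul]
      · rw [mul_pow, ← pow_mul, mul_comm 2 3, pow_mul, hq3, one_pow, one_mul]
    have hp0 : aeval g P = 0 := by
      refine polynomial_eq_zero_of_roots (r := r) ?_ ?_ ?_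
      · have h1 : ∀ l, r none ≠ r (some l) := by
          intro l hl
          by_cases hli : l.1 = i₁
          · have : i₁ < j := by
              rw [hi₁, Fin.lt_def]
              show j.val - 1 < j.val
              omega
            simp only [hr, Option.elim, hli, this, if_true] at hl
            apply q_ne_one
            exact mul_right_cancel₀ (hz.1 i₁) (by rw [one_mul]; exact hl.symm)
          · have h2 := hcube l
            rw [← hl] at h2
            exact hz.2 _ _ hli h2.symm
        rintro (_ | l) (_ | m) h2
        · rfl
        · exact absurd h2 (h1 m)
        · exact absurd h2.symm (h1 l)
        · by_contra hne
          refine hz.2 l.1 m.1 (fun h => hne (by rw [Subtype.ext h])) ?_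
          rw [← hcube, ← hcube, h2]
      · rintro (_ | l)
        · rw [hev]
          refine hadj _ ⟨i₁, by simp [hi₁]; omega⟩ ?_
          have h1 : posSucc (⟨i₁, by simp [hi₁]; omega⟩ : Fin (2 * n + 1)) = j :=
            Fin.ext (by simp [posSucc, hi₁]; omega)
          have h2 : pos (⟨i₁, by simp [hi₁]; omega⟩ : Fin (2 * n + 1)) = i₁ :=
            Fin.ext (by simp [pos])
          have h3 : i₁ ≠ j := fun h => by have := congrArg Fin.val h; simp [hi₁] at this; omega
          have h4 : i₁ ≠ 0 := fun h => by have := congrArg Fin.val h; simp [hi₁] at this; omega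
          rw [h1, h2, Function.update_self, Function.update_of_ne h3, Function.update_of_ne h4]
          rfl
        · rw [hev]
          obtain ⟨l, hl0, hlj⟩ := l
          have hw0 : Function.update (Function.update z 0 (r (some ⟨l, hl0, hlj⟩))) j
              (q ^ 2 * r (some ⟨l, hl0, hlj⟩)) 0 = r (some ⟨l, hl0, hlj⟩) := by
            rw [Function.update_of_ne hj0.symm, Function.update_self]
          have hwl : Function.update (Function.update z 0 (r (some ⟨l, hl0, hlj⟩))) j
              (q ^ 2 * r (some ⟨l, hl0, hlj⟩)) l = z l := by
            rw [Function.update_of_ne hlj, Function.update_of_ne hl0]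
          by_cases hlt : l < j
          · refine ih l hlt l rfl hl0 _ ?_
            rw [hw0, hwl]
            simp only [hr, Option.elim, hlt, if_true]
            linear_combination -z l * hq3
          · refine hP.vanish _ 0 j l (Fin.pos_of_ne_zero hj0) (lt_of_le_of_ne (not_lt.1 hlt) hlj.symm)
              ?_ ?_
            · rw [hw0, Function.update_self]
            · rw [hwl, Function.update_self]
              simp only [hr, Option.elim, hlt, if_false]
              linear_combination -(q ^ 3 + 1) * z l * hq3
      · rw [Fintype.card_option, Fintype.card_subtype]
        have hcard : (Finset.univ.filter fun l : Fin (2 * (n + 1)) => l ≠ 0 ∧ l ≠ j).card = 2 * n := by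
          have : (Finset.univ.filter fun l : Fin (2 * (n + 1)) => l ≠ 0 ∧ l ≠ j) =
              (Finset.univ.erase 0).erase j := by
            ext l; simp [and_comm]
          rw [this, Finset.card_erase_of_mem (by simp [hj0]), Finset.card_erase_of_mem (by simp)]
          simp
          omega
        rw [hcard]
        refine (natDegree_aeval_le _ _).trans_lt ?_
        rw [← Finset.add_sum_erase _ _ (Finset.mem_univ j),
          ← Finset.add_sum_erase _ _ (show (0 : Fin (2 * (n + 1))) ∈ Finset.univ.erase j by
            simp [hj0.symm]), Finset.sum_eq_zero]
        · have d1 := hP.degree 0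
          have d2 := hP.degree j
          have e1 : (g j).natDegree ≤ 1 := by
            simp only [hg, Function.update_self]
            exact (Polynomial.natDegree_C_mul_le _ _).trans (by simp)
          have e2 : (g 0).natDegree ≤ 1 := by
            simp only [hg, Function.update_of_ne hj0.symm, Function.update_self]
            simp
          nlinarith
        · intro l hl
          simp only [Finset.mem_erase, Finset.mem_univ, and_true] at hl
          simp [hg, hl.1, hl.2]
    have := hev (z 0)
    rwa [hp0, Polynomial.eval_zero, Function.update_eq_self, eq_comm] at this

/-- Inserting a little arch inserts the values $1,q^2$ in the evaluation point. Every restriction to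
$z_{k+1}=q^2z_k$ thus vanishes at the points of the smaller size, hence identically by induction. -/
theorem IsWheel.eq_zero_of_points {P : MvPolynomial (Fin (2 * n)) ℂ} (hP : IsWheel n P)
    (h : ∀ τ : LinkPattern n, eval (point τ) P = 0) : P = 0 := by
  induction n with
  | zero =>
    apply MvPolynomial.funext
    intro z
    rw [map_zero, ← h (nested 0)]
    congr 2
    funext j
    exact j.elim0
  | succ n ih =>
    refine hP.eq_zero_of_adjacent fun k z x => ?_
    obtain ⟨Q, hQ, hQP⟩ := hP.exists_restrict k
    have : Q = 0 := by
      refine ih hQ fun τ => ?_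
      have h1 := hQP (point τ) 1
      rw [← point_ins, h, prod_point_sub, eq_comm, mul_eq_zero] at h1
      exact h1.resolve_right (pow_ne_zero _ three_mul_q_sq_ne_zero)
    rw [hQP, this, map_zero, zero_mul]

end

/-! ### Divided differences on wheel polynomials -/

section

open MvPolynomial (eval aeval degreeOf)

variable {n : ℕ}

/-- Replace three consecutive values. -/
def upd3 {A : Type*} {N : ℕ} (p : ℕ) (a b c : A) (z : Fin N → A) (j : Fin N) : A :=
  if j.val = p then a else if j.val = p + 1 then b else if j.val = p + 2 then c else z j

theorem comp_upd3 {A B : Type*} {N : ℕ} (g : A → B) (p : ℕ) (a b c : A) (z : Fin N → A) (j : Fin N) :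
    g (upd3 p a b c z j) = upd3 p (g a) (g b) (g c) (fun l => g (z l)) j := by
  unfold upd3
  split_ifs <;> rfl

theorem natDegree_aeval_upd3_le {P : MvPolynomial (Fin (2 * n)) ℂ} (hP : ∀ i, degreeOf i P < n)
    {p : ℕ} (hp : p + 2 < 2 * n) (A B C : Polynomial ℂ) (z : Fin (2 * n) → ℂ) :
    (aeval (upd3 p A B C fun l => Polynomial.C (z l)) P).natDegree ≤
      (n - 1) * (A.natDegree + B.natDegree + C.natDegree) := by
  refine (natDegree_aeval_le _ _).trans ?_
  have h1 : ∀ j : Fin (2 * n), degreeOf j P *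
      (upd3 p A B C (fun l => Polynomial.C (z l)) j).natDegree ≤
      (n - 1) * ((if j.val = p then A.natDegree else 0) + (if j.val = p + 1 then B.natDegree else 0) +
        (if j.val = p + 2 then C.natDegree else 0)) := by
    intro j
    refine Nat.mul_le_mul (by have := hP j; omega) ?_
    unfold upd3
    split_ifs <;> first | omega | simp
  refine (Finset.sum_le_sum fun j _ => h1 j).trans ?_
  rw [← Finset.mul_sum, Finset.sum_add_distrib, Finset.sum_add_distrib]
  refine Nat.mul_le_mul le_rfl ?_
  have h2 : ∀ (m d : ℕ), m < 2 * n → ∑ j : Fin (2 * n), (if j.val = m then d else 0) = d := by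
    intro m d hm
    rw [Finset.sum_eq_single ⟨m, hm⟩]
    · simp
    · intro j _ hj
      rw [if_neg fun h => hj (Fin.ext h)]
    · simp
  rw [h2 p _ (by omega), h2 (p + 1) _ (by omega), h2 (p + 2) _ hp]

/-- Both sides have degree at most $2n-1$ in $y$. They agree for $2n$ values: $y=q^2z_l$ for the
$2n-3$ other variables, where every term is killed by a wheel, and $y=x,qx,q^2x$, where the relation
is checked directly. -/
theorem IsWheel.three_term {P : MvPolynomial (Fin (2 * n)) ℂ} (hP : IsWheel n P)
    {p : ℕ} (hp : p + 2 < 2 * n) (z : Fin (2 * n) → ℂ) (x y : ℂ) :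
    (x - q * y) * eval (upd3 p y x (q ^ 2 * y) z) P =
      q ^ 2 * (y - x) * eval (upd3 p y (q ^ 2 * y) x z) P +
        (y - q * x) * eval (upd3 p x y (q ^ 2 * y) z) P := by
  classical
  have hq3 := q_pow_three
  have hq4 : q ^ 4 = q := by linear_combination q * q_pow_three
  set p0 : Fin (2 * n) := ⟨p, by omega⟩ with hp0
  set p1 : Fin (2 * n) := ⟨p + 1, by omega⟩ with hp1
  set p2 : Fin (2 * n) := ⟨p + 2, hp⟩ with hp2
  have e0 : ∀ (a b c : ℂ) (z : Fin (2 * n) → ℂ), upd3 p a b c z p0 = a := by simp [upd3, hp0]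
  have e1 : ∀ (a b c : ℂ) (z : Fin (2 * n) → ℂ), upd3 p a b c z p1 = b := by simp [upd3, hp1]
  have e2 : ∀ (a b c : ℂ) (z : Fin (2 * n) → ℂ), upd3 p a b c z p2 = c := by simp [upd3, hp2]
  have e3 : ∀ (a b c : ℂ) (z : Fin (2 * n) → ℂ) l, l ≠ p0 → l ≠ p1 → l ≠ p2 →
      upd3 p a b c z l = z l := by
    intro a b c z l h0 h1 h2
    simp only [hp0, hp1, hp2, ne_eq, Fin.ext_iff] at h0 h1 h2
    simp [upd3, h0, h1, h2]
  have h01 : p0 < p1 := by simp [hp0, hp1]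
  have h12 : p1 < p2 := by simp [hp1, hp2]
  open MvPolynomial in
  set F : MvPolynomial (Fin (2 * n)) ℂ :=
    (X p1 - C q * X p0) * aeval (upd3 p (X p0) (X p1) (C (q ^ 2) * X p0) X) P -
      (C (q ^ 2) * (X p0 - X p1) * aeval (upd3 p (X p0) (C (q ^ 2) * X p0) (X p1) X) P +
        (X p0 - C q * X p1) * aeval (upd3 p (X p1) (X p0) (C (q ^ 2) * X p0) X) P) with hF
  have hFe : ∀ z : Fin (2 * n) → ℂ, eval z F =
    (z p1 - q * z p0) * eval (upd3 p (z p0) (z p1) (q ^ 2 * z p0) z) P -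
      (q ^ 2 * (z p0 - z p1) * eval (upd3 p (z p0) (q ^ 2 * z p0) (z p1) z) P +
        (z p0 - q * z p1) * eval (upd3 p (z p1) (z p0) (q ^ 2 * z p0) z) P) := by
    intro z
    simp only [hF, map_sub, map_add, map_mul, MvPolynomial.eval_X, MvPolynomial.eval_C, eval_aeval,
      comp_upd3 (eval z)]
  suffices hF0 : F = 0 by
    have h := hFe (upd3 p y x 0 z)
    have hu : ∀ a b c, upd3 p a b c (upd3 p y x 0 z) = upd3 p a b c z := by
      intro a b c; funext j; unfold upd3; split_ifs <;> rfl
    rw [hF0, map_zero, e0, e1, hu, hu, hu] at h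
    linear_combination -h
  refine eq_zero_of_generic fun z hz => ?_
  set x := z p1
  set g : Polynomial ℂ := (Polynomial.C x - Polynomial.C q * Polynomial.X) *
      aeval (upd3 p Polynomial.X (Polynomial.C x) (Polynomial.C (q ^ 2) * Polynomial.X)
        fun l => Polynomial.C (z l)) P -
    (Polynomial.C (q ^ 2) * (Polynomial.X - Polynomial.C x) *
      aeval (upd3 p Polynomial.X (Polynomial.C (q ^ 2) * Polynomial.X) (Polynomial.C x)
        fun l => Polynomial.C (z l)) P +
      (Polynomial.X - Polynomial.C (q * x)) *
      aeval (upd3 p (Polynomial.C x) Polynomial.X (Polynomial.C (q ^ 2) * Polynomial.X)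
        fun l => Polynomial.C (z l)) P) with hg
  have hge : ∀ y, g.eval y = (x - q * y) * eval (upd3 p y x (q ^ 2 * y) z) P -
      (q ^ 2 * (y - x) * eval (upd3 p y (q ^ 2 * y) x z) P +
        (y - q * x) * eval (upd3 p x y (q ^ 2 * y) z) P) := by
    intro y
    rw [hg]
    simp only [Polynomial.eval_sub, Polynomial.eval_mul, Polynomial.eval_add, Polynomial.eval_C,
      Polynomial.eval_X, eval_aeval_polynomial, comp_upd3 (Polynomial.eval y)]
  have hg0 : g = 0 := by
    refine polynomial_eq_zero_of_roots (ι := {l : Fin (2 * n) // ¬ (l = p0 ∨ l = p1 ∨ l = p2)} ⊕ Fin 3)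
      (r := Sum.elim (fun l => q ^ 2 * z l.1) ![x, q * x, q ^ 2 * x]) ?_ ?_ ?_
    · refine Function.Injective.sumElim ?_ ?_ ?_
      · intro l m h
        by_contra hne
        exact hz.2 l m (fun h => hne (Subtype.ext h)) (by rw [mul_left_cancel₀ (pow_ne_zero 2 q_ne_zero) h])
      · have hx : x ≠ 0 := hz.1 p1
        have a1 : x ≠ q * x := fun h => q_ne_one (mul_right_cancel₀ hx (by rw [← h, one_mul]))
        have a2 : x ≠ q ^ 2 * x := fun h => q_sq_ne_one (mul_right_cancel₀ hx (by rw [← h, one_mul]))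
        have a3 : q * x ≠ q ^ 2 * x := fun h => q_sq_ne_q (mul_right_cancel₀ hx h.symm)
        intro i j h
        fin_cases i <;> fin_cases j <;> simp_all
      · intro l m h
        have hl : l.1 ≠ p1 := fun h => l.2 (by simp [h])
        refine hz.2 _ _ hl ?_
        have : (q ^ 2 * z l.1) ^ 3 = x ^ 3 := by
          rw [h]
          fin_cases m <;> simp [mul_pow, hq3, ← pow_mul, show q ^ 6 = 1 by linear_combination (q ^ 3 + 1) * hq3]
        rw [← this]
        linear_combination (-(z l.1) ^ 3) * (q ^ 3 + 1) * hq3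
    · rintro (⟨l, hl⟩ | m)
      · rw [hge]
        simp only [Sum.elim_inl]
        -- The variable $z_l$ lies before or after the whole block of three, so it is the first or
        -- the last element of each wheel.
        simp only [not_or] at hl
        obtain ⟨l0, l1, l2⟩ := hl
        have hlt : l < p0 ∨ p2 < l := by
          simp only [hp0, hp1, hp2, Fin.ext_iff, Fin.lt_def] at *
          omega
        rcases hlt with hlt | hlt
        · rw [hP.vanish _ l p0 p2 hlt (h01.trans h12) (by rw [e0, e3 _ _ _ _ _ l0 l1 l2]) (by rw [e0, e2]),
            hP.vanish _ l p0 p1 hlt h01 (by rw [e0, e3 _ _ _ _ _ l0 l1 l2]) (by rw [e0, e1]),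
            hP.vanish _ l p1 p2 (hlt.trans h01) h12 (by rw [e1, e3 _ _ _ _ _ l0 l1 l2]) (by rw [e1, e2])]
          ring
        · have hc : z l = q ^ 2 * (q ^ 2 * (q ^ 2 * z l)) := by
            linear_combination (-(z l)) * (q ^ 3 + 1) * hq3
          rw [hP.vanish _ p0 p2 l (h01.trans h12) hlt (by rw [e0, e2]) (by rw [e2, e3 _ _ _ _ _ l0 l1 l2]; exact hc),
            hP.vanish _ p0 p1 l h01 (h12.trans hlt) (by rw [e0, e1]) (by rw [e1, e3 _ _ _ _ _ l0 l1 l2]; exact hc),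
            hP.vanish _ p1 p2 l h12 hlt (by rw [e1, e2]) (by rw [e2, e3 _ _ _ _ _ l0 l1 l2]; exact hc)]
          ring
      · rw [hge]
        fin_cases m
        · simp only [Sum.elim_inr, Fin.zero_eta, Matrix.cons_val_zero]
          ring
        · simp only [Sum.elim_inr, Fin.mk_one, Matrix.cons_val_one, Matrix.cons_val_zero]
          rw [show q ^ 2 * (q * x) = x by linear_combination x * hq3]
          linear_combination -(x * eval (upd3 p (q * x) x x z) P) * (hq3)
        · simp only [Sum.elim_inr, Fin.reduceFinMk, Matrix.cons_val]
          have v1 : eval (upd3 p (q ^ 2 * x) (q ^ 2 * (q ^ 2 * x)) x z) P = 0 :=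
            hP.vanish _ p0 p1 p2 h01 h12 (by rw [e0, e1])
              (by rw [e1, e2]; linear_combination (-x) * (q ^ 3 + 1) * hq3)
          have v2 : eval (upd3 p x (q ^ 2 * x) (q ^ 2 * (q ^ 2 * x)) z) P = 0 :=
            hP.vanish _ p0 p1 p2 h01 h12 (by rw [e0, e1]) (by rw [e1, e2])
          rw [v1, v2]
          linear_combination -(x * eval (upd3 p (q ^ 2 * x) x (q ^ 2 * (q ^ 2 * x)) z) P) * hq3
    · have hcard : Fintype.card ({l : Fin (2 * n) // ¬ (l = p0 ∨ l = p1 ∨ l = p2)} ⊕ Fin 3) = 2 * n := by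
        rw [Fintype.card_sum, Fintype.card_subtype_compl, Fintype.card_fin, Fintype.card_fin,
          Fintype.card_subtype]
        have : (Finset.univ.filter fun l => l = p0 ∨ l = p1 ∨ l = p2) = {p0, p1, p2} := by
          ext l; simp
        rw [this, Finset.card_eq_three.2 ⟨p0, p1, p2, h01.ne, (h01.trans h12).ne, h12.ne, rfl⟩]
        omega
      rw [hcard]
      have hX : (Polynomial.X : Polynomial ℂ).natDegree ≤ 1 := Polynomial.natDegree_X_le
      have hX2 : (Polynomial.C (q ^ 2) * Polynomial.X : Polynomial ℂ).natDegree ≤ 1 :=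
        (Polynomial.natDegree_C_mul_le _ _).trans Polynomial.natDegree_X_le
      have hCx : (Polynomial.C x).natDegree = 0 := Polynomial.natDegree_C _
      have hmul : ∀ A B D : Polynomial ℂ, A.natDegree + B.natDegree + D.natDegree ≤ 2 →
          ∀ u : Polynomial ℂ, u.natDegree ≤ 1 →
          (u * aeval (upd3 p A B D fun l => Polynomial.C (z l)) P).natDegree ≤ 2 * n - 1 := by
        intro A B D h u hu
        refine Polynomial.natDegree_mul_le.trans ?_
        have h1 := natDegree_aeval_upd3_le hP.degree hp A B D z
        have h2 := Nat.mul_le_mul (le_refl (n - 1)) h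
        omega
      have : g.natDegree ≤ 2 * n - 1 := by
        rw [hg]
        refine (Polynomial.natDegree_sub_le_of_le (hmul _ _ _ (by omega) _ ?_)
          (Polynomial.natDegree_add_le_of_degree_le (hmul _ _ _ (by omega) _ ?_)
          (hmul _ _ _ (by omega) _ ?_))).trans (by simp)
        · compute_degree
        · compute_degree
        · compute_degree
      omega
  rw [hFe]
  have := hge (z p0)
  rw [hg0, Polynomial.eval_zero] at this
  exact this.symm

/-- `R` is the image of `P` under the divided difference operator exchanging two neighbours. -/
def IsTheta (k : Fin (2 * n + 1)) (P R : MvPolynomial (Fin (2 * (n + 1))) ℂ) : Prop :=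
  ∀ z : Fin (2 * (n + 1)) → ℂ, (z (posSucc k) - z (pos k)) * eval z R =
    (q * z (pos k) - q⁻¹ * z (posSucc k)) *
      (eval z P - eval (fun j => z (Equiv.swap (pos k) (posSucc k) j)) P)

theorem eq_of_punctured {f g : ℂ → ℂ} (hf : Continuous f) (hg : Continuous g) {x : ℂ}
    (h : ∀ y, y ≠ x → f y = g y) : f x = g x :=
  congrFun (Continuous.ext_on (dense_compl_singleton x) hf hg fun y hy => h y hy) x

theorem continuous_eval_of {σ : Type*} {f : ℂ → σ → ℂ} (hf : ∀ j, Continuous fun y => f y j)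
    (P : MvPolynomial σ ℂ) : Continuous fun y => eval (f y) P :=
  (MvPolynomial.continuous_eval P).comp (continuous_pi hf)

theorem upd3_swap {A : Type*} (k : Fin (2 * n + 1)) (x y w : A) (z : Fin (2 * (n + 1)) → A) :
    (fun j => upd3 k x y w z (Equiv.swap (pos k) (posSucc k) j)) = upd3 k y x w z := by
  funext j
  rcases pos_or_skip k j with rfl | rfl | ⟨l, rfl⟩
  · rw [Equiv.swap_apply_left]; simp [upd3, pos, posSucc]
  · rw [Equiv.swap_apply_right]; simp [upd3, pos, posSucc]
  · rw [Equiv.swap_apply_of_ne_of_ne (skip_ne_pos k l) (skip_ne_posSucc k l)]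
    have h1 : (skip k l).val ≠ k := fun h => skip_ne_pos k l (Fin.ext h)
    have h2 : (skip k l).val ≠ k + 1 := fun h => skip_ne_posSucc k l (Fin.ext h)
    simp [upd3, h1, h2]

theorem upd3_swap' {A : Type*} {p : ℕ} (k : Fin (2 * n + 1)) (hk : k.val = p + 1) (x y w : A)
    (z : Fin (2 * (n + 1)) → A) :
    (fun j => upd3 p x y w z (Equiv.swap (pos k) (posSucc k) j)) = upd3 p x w y z := by
  funext j
  rcases pos_or_skip k j with rfl | rfl | ⟨l, rfl⟩
  · rw [Equiv.swap_apply_left]; simp [upd3, pos, posSucc, hk, show p + 1 + 1 ≠ p by omega]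
  · rw [Equiv.swap_apply_right]; simp [upd3, pos, posSucc, hk, show p + 1 + 1 ≠ p by omega]
  · rw [Equiv.swap_apply_of_ne_of_ne (skip_ne_pos k l) (skip_ne_posSucc k l)]
    have h1 : (skip k l).val ≠ k := fun h => skip_ne_pos k l (Fin.ext h)
    have h2 : (skip k l).val ≠ k + 1 := fun h => skip_ne_posSucc k l (Fin.ext h)
    rw [hk] at h1 h2
    simp [upd3, h1, h2]

/-- The definition of the divided difference involves the three values in the orders $x,y,q^2y$ and
$y,x,q^2y$; `IsWheel.three_term` trades the second for $y,q^2y,x$ and the denominator $y-x$ cancels.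
The case $x=y$, the one needed at evaluation points, follows by continuity. -/
theorem IsTheta.eval_flat_open {k : Fin (2 * n + 1)} {P R : MvPolynomial (Fin (2 * (n + 1))) ℂ}
    (h : IsTheta k P R) (hP : IsWheel (n + 1) P) (hk : k.val + 2 < 2 * (n + 1))
    (z : Fin (2 * (n + 1)) → ℂ) (x y : ℂ) :
    eval (upd3 k x y (q ^ 2 * y) z) R = eval (upd3 k x y (q ^ 2 * y) z) P -
      eval (upd3 k y (q ^ 2 * y) x z) P := by
  have h2 := q_sq
  have key : ∀ x, x ≠ y → eval (upd3 k x y (q ^ 2 * y) z) R = eval (upd3 k x y (q ^ 2 * y) z) P -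
      eval (upd3 k y (q ^ 2 * y) x z) P := by
    intro x hx
    have h1 := h (upd3 k x y (q ^ 2 * y) z)
    rw [upd3_swap, show upd3 k x y (q ^ 2 * y) z (pos k) = x by simp [upd3, pos],
      show upd3 k x y (q ^ 2 * y) z (posSucc k) = y by simp [upd3, posSucc], q_inv] at h1
    have h3 := hP.three_term hk z x y
    refine mul_left_cancel₀ (sub_ne_zero.2 hx.symm) ?_
    generalize eval (upd3 k x y (q ^ 2 * y) z) R = r at *
    generalize eval (upd3 k x y (q ^ 2 * y) z) P = a at *
    generalize eval (upd3 k y (q ^ 2 * y) x z) P = b at *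
    generalize eval (upd3 k y x (q ^ 2 * y) z) P = c at *
    grind
  by_cases hx : x = y
  · subst hx
    have hc : ∀ j, Continuous fun u => upd3 k u x (q ^ 2 * x) z j := by
      intro j; unfold upd3; split_ifs <;> fun_prop
    have hc' : ∀ j, Continuous fun u => upd3 k x (q ^ 2 * x) u z j := by
      intro j; unfold upd3; split_ifs <;> fun_prop
    exact eq_of_punctured (continuous_eval_of hc R)
      ((continuous_eval_of hc P).sub (continuous_eval_of hc' P)) key
  · exact key x hx

/-- The mirror case, where the exchanged pair consists of the last two positions of the block. -/
theorem IsTheta.eval_flat_close {k : Fin (2 * n + 1)} {P R : MvPolynomial (Fin (2 * (n + 1))) ℂ}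
    (h : IsTheta k P R) (hP : IsWheel (n + 1) P) {p : ℕ} (hk : k.val = p + 1)
    (z : Fin (2 * (n + 1)) → ℂ) (x y : ℂ) :
    eval (upd3 p y (q ^ 2 * y) x z) R = eval (upd3 p y (q ^ 2 * y) x z) P -
      eval (upd3 p x y (q ^ 2 * y) z) P := by
  have h2 := q_sq
  have hp : p + 2 < 2 * (n + 1) := by have := k.2; omega
  have key : ∀ x, x ≠ q ^ 2 * y → eval (upd3 p y (q ^ 2 * y) x z) R =
      eval (upd3 p y (q ^ 2 * y) x z) P - eval (upd3 p x y (q ^ 2 * y) z) P := by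
    intro x hx
    have h1 := h (upd3 p y (q ^ 2 * y) x z)
    rw [upd3_swap' k hk, show upd3 p y (q ^ 2 * y) x z (pos k) = q ^ 2 * y by simp [upd3, pos, hk],
      show upd3 p y (q ^ 2 * y) x z (posSucc k) = x by
        simp [upd3, posSucc, hk, show p + 1 + 1 ≠ p by omega], q_inv] at h1
    have h3 := hP.three_term hp z x y
    refine mul_left_cancel₀ (sub_ne_zero.2 hx) ?_
    generalize eval (upd3 p y (q ^ 2 * y) x z) R = r at *
    generalize eval (upd3 p x y (q ^ 2 * y) z) P = a at *
    generalize eval (upd3 p y (q ^ 2 * y) x z) P = b at *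
    generalize eval (upd3 p y x (q ^ 2 * y) z) P = c at *
    grind
  by_cases hx : x = q ^ 2 * y
  · subst hx
    have hc : ∀ j, Continuous fun u => upd3 p y (q ^ 2 * y) u z j := by
      intro j; unfold upd3; split_ifs <;> fun_prop
    have hc' : ∀ j, Continuous fun u => upd3 p u y (q ^ 2 * y) z j := by
      intro j; unfold upd3; split_ifs <;> fun_prop
    exact eq_of_punctured (continuous_eval_of hc R)
      ((continuous_eval_of hc P).sub (continuous_eval_of hc' P)) key
  · exact key x hx

theorem X_sub_X_dvd_sub_rename {σ : Type*} [DecidableEq σ] (i j : σ) (P : MvPolynomial σ ℂ) :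
    (MvPolynomial.X j - MvPolynomial.X i : MvPolynomial σ ℂ) ∣
      P - MvPolynomial.rename (Equiv.swap i j) P := by
  rw [← Ideal.mem_span_singleton, ← Ideal.Quotient.eq]
  set I := Ideal.span {(MvPolynomial.X j - MvPolynomial.X i : MvPolynomial σ ℂ)} with hI
  have hij : Ideal.Quotient.mkₐ ℂ I (MvPolynomial.X j) = Ideal.Quotient.mkₐ ℂ I (MvPolynomial.X i) := by
    rw [Ideal.Quotient.mkₐ_eq_mk, Ideal.Quotient.eq]
    exact Ideal.mem_span_singleton_self _
  have : Ideal.Quotient.mkₐ ℂ I = (Ideal.Quotient.mkₐ ℂ I).comp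
      (MvPolynomial.rename (Equiv.swap i j)) := by
    refine MvPolynomial.algHom_ext fun l => ?_
    rw [AlgHom.comp_apply, MvPolynomial.rename_X]
    rcases eq_or_ne l i with rfl | hi
    · rw [Equiv.swap_apply_left, hij]
    rcases eq_or_ne l j with rfl | hj
    · rw [Equiv.swap_apply_right, hij]
    · rw [Equiv.swap_apply_of_ne_of_ne hi hj]
  exact DFunLike.congr_fun this P

/-- Dividing by $z_j-z_i$ and multiplying by the other linear form does not raise the degree in any
variable. -/
theorem degreeOf_linear_le {σ : Type*} {i j : σ} (hij : i ≠ j) (a b : ℂ) (l : σ) :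
    degreeOf l (MvPolynomial.C a * MvPolynomial.X i - MvPolynomial.C b * MvPolynomial.X j) ≤
      degreeOf l (MvPolynomial.X j - MvPolynomial.X i : MvPolynomial σ ℂ) := by
  classical
  have h1 : degreeOf l (MvPolynomial.C a * MvPolynomial.X i - MvPolynomial.C b * MvPolynomial.X j) ≤
      max (degreeOf l (MvPolynomial.X i : MvPolynomial σ ℂ))
        (degreeOf l (MvPolynomial.X j : MvPolynomial σ ℂ)) :=
    (MvPolynomial.degreeOf_sub_le _ _ _).trans (max_le_max (MvPolynomial.degreeOf_C_mul_le _ _ _)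
      (MvPolynomial.degreeOf_C_mul_le _ _ _))
  refine h1.trans ?_
  have hi := MvPolynomial.degreeOf_sub_le l (MvPolynomial.X j : MvPolynomial σ ℂ)
    (MvPolynomial.X j - MvPolynomial.X i)
  have hj := MvPolynomial.degreeOf_add_le l (MvPolynomial.X j - MvPolynomial.X i : MvPolynomial σ ℂ)
    (MvPolynomial.X i)
  rw [sub_sub_cancel] at hi
  rw [sub_add_cancel] at hj
  simp only [MvPolynomial.degreeOf_X] at *
  split_ifs at * with c1 c2 <;> first | exact absurd (c1.symm.trans c2) hij | omega

/-- On a wheel $i<j<l$ the term $P$ vanishes. The exchanged term vanishes as well when the exchange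
keeps the order of the three indices. Otherwise two consecutive indices of the wheel are the
exchanged neighbours, and the prefactor $qz_k-q^{-1}z_{k+1}$ is zero. -/
theorem IsWheel.exists_theta {P : MvPolynomial (Fin (2 * (n + 1))) ℂ} (hP : IsWheel (n + 1) P)
    (k : Fin (2 * n + 1)) : ∃ R, IsWheel (n + 1) R ∧ IsTheta k P R := by
  classical
  obtain ⟨Q, hQ⟩ := X_sub_X_dvd_sub_rename (pos k) (posSucc k) P
  set L : MvPolynomial (Fin (2 * (n + 1))) ℂ :=
    MvPolynomial.C q * MvPolynomial.X (pos k) - MvPolynomial.C q⁻¹ * MvPolynomial.X (posSucc k) with hL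
  have hT : IsTheta k P (L * Q) := by
    intro z
    have h1 := congrArg (eval z) hQ
    rw [map_sub, MvPolynomial.eval_rename, map_mul, map_sub, MvPolynomial.eval_X, MvPolynomial.eval_X] at h1
    rw [map_mul, hL, map_sub, map_mul, map_mul, MvPolynomial.eval_C, MvPolynomial.eval_C,
      MvPolynomial.eval_X, MvPolynomial.eval_X]
    simp only [Function.comp_def] at h1
    rw [h1]
    ring
  refine ⟨L * Q, ⟨fun i => ?_, ?_⟩, hT⟩
  · by_cases hQ0 : Q = 0
    · rw [hQ0, mul_zero, MvPolynomial.degreeOf_zero]; omega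
    · have hne : (MvPolynomial.X (posSucc k) - MvPolynomial.X (pos k) :
          MvPolynomial (Fin (2 * (n + 1))) ℂ) ≠ 0 := by
        rw [sub_ne_zero]
        exact fun h => pos_ne_posSucc k (MvPolynomial.X_injective h).symm
      have h1 := congrArg (degreeOf i) hQ
      rw [MvPolynomial.degreeOf_mul_eq hne hQ0] at h1
      have h2 := MvPolynomial.degreeOf_sub_le i P (MvPolynomial.rename (Equiv.swap (pos k) (posSucc k)) P)
      have h3 : degreeOf i (MvPolynomial.rename (Equiv.swap (pos k) (posSucc k)) P) =
          degreeOf (Equiv.swap (pos k) (posSucc k) i) P := by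
        conv_lhs => rw [← Equiv.swap_apply_self (pos k) (posSucc k) i]
        exact MvPolynomial.degreeOf_rename_of_injective (Equiv.injective _) _
      have h4 := hP.degree i
      have h5 := hP.degree (Equiv.swap (pos k) (posSucc k) i)
      have h6 := degreeOf_linear_le (pos_ne_posSucc k) q q⁻¹ i
      have h7 := MvPolynomial.degreeOf_mul_le i L Q
      rw [hL] at *
      have h8 := max_lt h4 h5
      rw [h3] at h2
      omega
  · intro z i j l hij hjl hj hl
    set w : (Fin (2 * (n + 1)) → ℂ) → Fin (2 * (n + 1)) → ℂ := fun z m =>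
      if m = j then q ^ 2 * z i else if m = l then q ^ 2 * (q ^ 2 * z i) else z m with hw
    open MvPolynomial in
    set f : Fin (2 * (n + 1)) → MvPolynomial (Fin (2 * (n + 1))) ℂ := fun m =>
      if m = j then C (q ^ 2) * X i else if m = l then C (q ^ 2) * (C (q ^ 2) * X i) else X m with hf
    have hfw : ∀ z, (fun m => eval z (f m)) = w z := by
      intro z; funext m; simp only [hf, hw]; split_ifs <;> simp
    have hwz : w z = z := by
      funext m; simp only [hw]; split_ifs with c1 c2
      · rw [c1, hj]
      · rw [c2, hl, hj]
      · rfl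
    have hli : i ≠ j := hij.ne
    have hlj : l ≠ j := hjl.ne'
    have hil : i ≠ l := (hij.trans hjl).ne
    have hwi : ∀ z, w z i = z i := fun z => by simp [hw, hli, hil]
    have hwj : ∀ z, w z j = q ^ 2 * z i := fun z => by simp [hw]
    have hwl : ∀ z, w z l = q ^ 2 * (q ^ 2 * z i) := fun z => by simp [hw, hlj]
    suffices h0 : aeval f (L * Q) = 0 by
      have := congrArg (eval z) h0
      rwa [eval_aeval, hfw, hwz, map_zero] at this
    -- The argument is carried out on the plane $z_j=q^2z_i$, $z_l=q^4z_i$ parametrised by `w`,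
    -- after multiplication by the denominator $z_{k+1}-z_k$.
    have hprod : aeval f (MvPolynomial.X (posSucc k) - MvPolynomial.X (pos k) :
        MvPolynomial (Fin (2 * (n + 1))) ℂ) * aeval f (L * Q) = 0 := by
      refine MvPolynomial.funext fun z => ?_
      rw [map_mul, eval_aeval, eval_aeval, hfw, map_sub, MvPolynomial.eval_X, MvPolynomial.eval_X, hT,
        map_zero, hP.vanish (w z) i j l hij hjl (by rw [hwi, hwj]) (by rw [hwj, hwl]), zero_sub, mul_neg,
        neg_eq_zero, mul_eq_zero]
      by_cases hadj : (i = pos k ∧ j = posSucc k) ∨ (j = pos k ∧ l = posSucc k)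
      · left
        rw [q_inv]
        have := q_pow_three
        rcases hadj with ⟨rfl, rfl⟩ | ⟨rfl, rfl⟩
        · rw [hwi, hwj]; linear_combination (-(q * z (pos k))) * this
        · rw [hwj, hwl]; linear_combination (-(q ^ 3 * z i)) * this
      · right
        have hs : ∀ u v : Fin (2 * (n + 1)), u < v → ¬ (u = pos k ∧ v = posSucc k) →
            Equiv.swap (pos k) (posSucc k) u < Equiv.swap (pos k) (posSucc k) v := by
          intro u v huv hne
          simp only [Equiv.swap_apply_def]
          simp only [pos, posSucc, Fin.lt_def, Fin.ext_iff] at *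
          split_ifs <;> (try simp only at *) <;> omega
        refine hP.vanish _ _ _ _ (hs i j hij fun h => hadj (.inl h)) (hs j l hjl fun h => hadj (.inr h)) ?_ ?_
        · rw [Equiv.swap_apply_self, Equiv.swap_apply_self, hwi, hwj]
        · rw [Equiv.swap_apply_self, Equiv.swap_apply_self, hwj, hwl]
    -- The denominator is not identically zero on this plane, as a generic point shows; it can be
    -- cancelled.
    refine (mul_eq_zero.1 hprod).resolve_left fun h => ?_
    obtain ⟨z, hz⟩ := exists_generic (Fin (2 * (n + 1)))
    have h1 := congrArg (eval z) h
    rw [eval_aeval, hfw, map_sub, MvPolynomial.eval_X, MvPolynomial.eval_X, map_zero, sub_eq_zero] at h1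
    have hq3 := q_pow_three
    have hwo : ∀ m, m ≠ j → m ≠ l → w z m = z m := fun m h1 h2 => by simp [hw, h1, h2]
    have hz2 : ∀ u v, z u ^ 3 = z v ^ 3 → u = v := fun u v h => by
      by_contra hne
      exact hz.2 u v hne h
    have hzi := hz.1 i
    have c1 : ∀ m, z m = q ^ 2 * z i → m = i ∧ False := fun m h => by
      have : m = i := hz2 m i (by rw [h]; linear_combination (z i ^ 3 * (q ^ 3 + 1)) * hq3)
      subst this
      exact ⟨rfl, q_sq_ne_one (mul_right_cancel₀ hzi (by rw [← h, one_mul]))⟩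
    have c2 : ∀ m, z m = q ^ 2 * (q ^ 2 * z i) → m = i ∧ False := fun m h => by
      have : m = i := hz2 m i (by rw [h]; linear_combination (z i ^ 3 * (q ^ 9 + q ^ 6 + q ^ 3 + 1)) * hq3)
      subst this
      exact ⟨rfl, q_ne_one (mul_right_cancel₀ hzi (by linear_combination -h - z m * q * hq3))⟩
    have c3 : q ^ 2 * z i ≠ q ^ 2 * (q ^ 2 * z i) := fun h =>
      q_sq_ne_one (mul_right_cancel₀ hzi (by
        rw [one_mul]; exact (mul_left_cancel₀ (pow_ne_zero 2 q_ne_zero) h).symm))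
    have hne := pos_ne_posSucc k
    generalize pos k = u at *
    generalize posSucc k = v at *
    by_cases u1 : u = j
    · subst u1
      by_cases v2 : v = l
      · subst v2
        rw [hwj, hwl] at h1
        exact c3 h1.symm
      · rw [hwj, hwo v hne.symm v2] at h1
        exact (c1 v h1).2
    by_cases u2 : u = l
    · subst u2
      by_cases v1 : v = j
      · subst v1
        rw [hwj, hwl] at h1
        exact c3 h1
      · rw [hwl, hwo v v1 hne.symm] at h1
        exact (c2 v h1).2
    rw [hwo u u1 u2] at h1
    by_cases v1 : v = j
    · subst v1
      rw [hwj] at h1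
      exact (c1 u h1.symm).2
    by_cases v2 : v = l
    · subst v2
      rw [hwl] at h1
      exact (c2 u h1.symm).2
    rw [hwo v v1 v2] at h1
    exact hne (hz2 u v (by rw [h1]))

end

/-! ### Divided differences are dual to the Temperley-Lieb generators -/

section

open MvPolynomial (eval aeval degreeOf)

variable {n : ℕ}

theorem skip_val (k : Fin (2 * n + 1)) (l : Fin (2 * n)) :
    (skip k l).val = if l.val < k.val then l.val else l.val + 2 := by
  unfold skip
  split_ifs <;> rfl

theorem point_eq (τ : LinkPattern n) (j : Fin (2 * n)) :
    point τ j = if j.val < τ.pn j then 1 else q ^ 2 := by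
  rw [LinkPattern.pn_val]
  rfl

theorem ins2_swap {A : Type*} (m : Fin (2 * n + 1)) (a b : A) (z : Fin (2 * n) → A) (u v : Fin (2 * n)) :
    (fun j => ins2 m a b z (Equiv.swap (skip m u) (skip m v) j)) =
      ins2 m a b (fun l => z (Equiv.swap u v l)) := by
  funext j
  rcases pos_or_skip m j with rfl | rfl | ⟨l, rfl⟩
  · rw [Equiv.swap_apply_of_ne_of_ne (skip_ne_pos m u).symm (skip_ne_pos m v).symm, ins2_pos, ins2_pos]
  · rw [Equiv.swap_apply_of_ne_of_ne (skip_ne_posSucc m u).symm (skip_ne_posSucc m v).symm, ins2_posSucc,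
      ins2_posSucc]
  · rw [(skip_injective m).swap_apply, ins2_skip, ins2_skip]

/-- The exchange happens away from the inserted pair and permutes the factors of the restriction
product, so that product cancels once $x$ is chosen to make it nonzero. -/
theorem IsTheta.restrict {P R : MvPolynomial (Fin (2 * (n + 1 + 1))) ℂ} {k : Fin (2 * (n + 1) + 1)}
    (h : IsTheta k P R) {m : Fin (2 * (n + 1) + 1)} {k' : Fin (2 * n + 1)}
    (h1 : pos k = skip m (pos k')) (h2 : posSucc k = skip m (posSucc k'))
    {P' R' : MvPolynomial (Fin (2 * (n + 1))) ℂ}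
    (hP : ∀ z x, eval (ins2 m x (q ^ 2 * x) z) P = eval z P' * ∏ l, (z l - q * x))
    (hR : ∀ z x, eval (ins2 m x (q ^ 2 * x) z) R = eval z R' * ∏ l, (z l - q * x)) :
    IsTheta k' P' R' := by
  intro z
  obtain ⟨x, hx⟩ := exists_avoid fun l => q⁻¹ * z l
  have hprod : ∏ l, (z l - q * x) ≠ 0 := by
    refine Finset.prod_ne_zero_iff.2 fun l _ => sub_ne_zero.2 fun h' => hx l ?_
    rw [h', inv_mul_cancel_left₀ q_ne_zero]
  have h3 := h (ins2 m x (q ^ 2 * x) z)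
  rw [h1, h2, ins2_swap, hP, hP, hR, ins2_skip, ins2_skip,
    Equiv.prod_comp (Equiv.swap (pos k') (posSucc k')) fun l => z l - q * x] at h3
  refine mul_right_cancel₀ hprod ?_
  linear_combination h3

theorem LinkPattern.e_of_pn_eq (τ : LinkPattern (n + 1)) {k : ℕ} (h : τ.pn k = k + 1)
    (hk : k < 2 * n + 1) : e k τ = τ := by
  obtain ⟨τ', rfl⟩ := τ.exists_ins hk h
  exact e_ins_self ⟨k, hk⟩ τ'

theorem LinkPattern.pn_eq_succ (τ : LinkPattern n) {k : ℕ} (h1 : k < τ.pn k)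
    (h2 : τ.pn (k + 1) ≤ k + 1) (hk : k + 1 < 2 * n) : τ.pn k = k + 1 := by
  by_contra hne
  have h3 := τ.pn_nest (show k < k + 1 by omega) (by omega)
  have := τ.pn_ne hk
  omega

/-- A closing followed by an opening becomes a little arch, while the arch joining the former
partners keeps the type of both its ends. -/
theorem point_e_valley (τ : LinkPattern (n + 1)) (k : Fin (2 * n + 1)) (h1 : τ.pn k < k)
    (h2 : k.val + 1 < τ.pn (k + 1)) :
    point (τ.e k) = fun j => point τ (Equiv.swap (pos k) (posSucc k) j) := by
  have hk := k.2
  have h4 := τ.pn_pn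
  funext j
  rw [point_eq, point_eq, LinkPattern.pn_e (by omega)]
  rcases pos_or_skip k j with rfl | rfl | ⟨l, rfl⟩
  · rw [Equiv.swap_apply_left]
    simp only [pos, posSucc, LinkPattern.eFun]
    grind
  · rw [Equiv.swap_apply_right]
    simp only [pos, posSucc, LinkPattern.eFun]
    grind
  · rw [Equiv.swap_apply_of_ne_of_ne (skip_ne_pos k l) (skip_ne_posSucc k l)]
    have h6 : (skip k l).val ≠ k := fun h => skip_ne_pos k l (Fin.ext h)
    have h7 : (skip k l).val ≠ k + 1 := fun h => skip_ne_posSucc k l (Fin.ext h)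
    generalize (skip k l).val = j at *
    have h5 := h4 j
    unfold LinkPattern.eFun
    rw [if_neg h6, if_neg h7]
    have : j = τ.pn k ↔ τ.pn j = k := ⟨fun h => by rw [h, h4], fun h => by rw [← h, h4]⟩
    have : j = τ.pn (k + 1) ↔ τ.pn j = k + 1 := ⟨fun h => by rw [h, h4], fun h => by rw [← h, h4]⟩
    congr 1
    grind

theorem IsTheta.eval_point_peak {k : Fin (2 * n + 1)} {P R : MvPolynomial (Fin (2 * (n + 1))) ℂ}
    (h : IsTheta k P R) {τ : LinkPattern (n + 1)} (hk : τ.pn k = k + 1) :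
    eval (point τ) R = eval (point τ) P - eval (point (τ.e k)) P := by
  rw [τ.e_of_pn_eq hk k.2, sub_self]
  have h1 := h (point τ)
  have h2 : τ.pn (k + 1) = k := by rw [← hk, τ.pn_pn]
  have e1 : point τ (pos k) = 1 := by rw [point_eq]; simp [pos, hk]
  have e2 : point τ (posSucc k) = q ^ 2 := by rw [point_eq]; simp [posSucc, h2]
  rw [e1, e2, show q * 1 - q⁻¹ * q ^ 2 = 0 by rw [q_inv]; linear_combination -q * q_pow_three,
    zero_mul] at h1
  exact (mul_eq_zero.1 h1).resolve_left (sub_ne_zero.2 q_sq_ne_one)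

/-- Here the prefactor and the denominator both equal $1-q^2$, and the exchanged point is that of
`τ.e k`. -/
theorem IsTheta.eval_point_valley {k : Fin (2 * n + 1)} {P R : MvPolynomial (Fin (2 * (n + 1))) ℂ}
    (h : IsTheta k P R) {τ : LinkPattern (n + 1)} (hk : τ.pn k < k) (hk' : k.val + 1 < τ.pn (k + 1)) :
    eval (point τ) R = eval (point τ) P - eval (point (τ.e k)) P := by
  have h1 := h (point τ)
  have e1 : point τ (pos k) = q ^ 2 := by
    rw [point_eq, if_neg]; simpa [pos] using hk.le
  have e2 : point τ (posSucc k) = 1 := by rw [point_eq]; simp [posSucc, hk']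
  rw [e1, e2, ← point_e_valley τ k hk hk', q_inv] at h1
  refine mul_left_cancel₀ (sub_ne_zero.2 q_sq_ne_one.symm) (h1.trans ?_)
  linear_combination (eval (point τ) P - eval (point (τ.e k)) P) * q_pow_three

/-- A little arch or a valley at `k` is immediate. If both points open, a little arch is found below
the arch of `k + 1`. When it starts at `k + 1`, `IsTheta.eval_flat_open` applies with all parameters
$1$; otherwise it is disjoint from the exchanged pair and is removed by restriction, so that
induction applies. Two closings are symmetric. -/
theorem IsTheta.eval_point {k : Fin (2 * n + 1)} {P R : MvPolynomial (Fin (2 * (n + 1))) ℂ}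
    (h : IsTheta k P R) (hP : IsWheel (n + 1) P) (hR : IsWheel (n + 1) R) (τ : LinkPattern (n + 1)) :
    eval (point τ) R = eval (point τ) P - eval (point (τ.e k)) P := by
  induction n with
  | zero =>
    refine h.eval_point_peak ?_
    have h1 := τ.pn_lt (show 0 < 2 * (0 + 1) by omega)
    have h2 := τ.pn_ne (show 0 < 2 * (0 + 1) by omega)
    have h3 : k.val = 0 := by have := k.2; omega
    rw [h3]
    omega
  | succ n ih => 
    have red : ∀ (m : Fin (2 * (n + 1) + 1)) (τ' : LinkPattern (n + 1)) (k' : Fin (2 * n + 1)),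
        τ = τ'.ins m → pos k = skip m (pos k') → posSucc k = skip m (posSucc k') →
        τ.e k = (τ'.e k').ins m → 
        eval (point τ) R = eval (point τ) P - eval (point (τ.e k)) P := by
      intro m τ' k' hτ h1 h2 he
      obtain ⟨P', hP', hP1⟩ := hP.exists_restrict m
      obtain ⟨R', hR', hR1⟩ := hR.exists_restrict m
      have := ih (h.restrict h1 h2 hP1 hR1) hP' hR' τ'
      rw [he, hτ, point_ins, point_ins, hP1, hP1, hR1, this, prod_point_sub, prod_point_sub, sub_mul]
    have hk := k.2
    have hk0 := τ.pn_ne (show k.val < _ by omega)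
    have hk1 := τ.pn_ne (show k.val + 1 < _ by omega)
    have hk2 : k.val + 1 < 2 * (n + 1 + 1) := by omega
    by_cases o1 : k.val < τ.pn k
    · by_cases o2 : k.val + 1 < τ.pn (k + 1)
      · obtain ⟨m, m1, m2, m3⟩ := τ.exists_little o2
        have m4 := τ.pn_lt hk2
        obtain ⟨τ', hτ'⟩ := τ.exists_ins (k := m) (by omega) m3
        by_cases hm : m = k + 1
        · subst hm
          have hf := h.eval_flat_open hP (by omega) (point τ) 1 1
          have m5 : τ.pn (k + 2) = k + 1 := by rw [← τ.pn_pn (k + 1), m3]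
          have e1 : upd3 k 1 1 (q ^ 2 * 1) (point τ) = point τ := by
            funext j
            unfold upd3
            split_ifs with c1 c2 c3
            · rw [point_eq, c1, if_pos o1]
            · rw [point_eq, c2, if_pos o2]
            · rw [point_eq, c3, m5, if_neg (by omega), mul_one]
            · rfl
          have e2 : upd3 k 1 (q ^ 2 * 1) 1 (point τ) = point (τ.e k) := by
            have m6 := τ.pn_pn
            funext j
            rw [point_eq, LinkPattern.pn_e hk2]
            unfold upd3 LinkPattern.eFun
            rw [point_eq]
            generalize j.val = j
            have := m6 j
            grind (splits := 30)
          rw [e1, e2] at hf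
          exact hf
        · refine red ⟨m, by omega⟩ τ' ⟨k, by omega⟩ hτ' ?_ ?_ ?_
          · refine Fin.ext ?_; rw [skip_val]; simp only [pos]; grind
          · refine Fin.ext ?_; rw [skip_val]; simp only [posSucc]; grind
          · exact (congrArg _ hτ').trans (LinkPattern.e_ins_of_lt _ (by simp only; omega) _)
      · exact h.eval_point_peak (τ.pn_eq_succ o1 (by omega) hk2)
    · by_cases o2 : k.val + 1 < τ.pn (k + 1)
      · exact h.eval_point_valley (by omega) o2
      · have o3 : τ.pn k < τ.pn (τ.pn k) := by rw [τ.pn_pn]; omega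
        obtain ⟨m, m1, m2, m3⟩ := τ.exists_little o3
        rw [τ.pn_pn] at m2
        obtain ⟨τ', hτ'⟩ := τ.exists_ins (k := m) (by omega) m3
        by_cases hm : k = m + 1
        · have hf := h.eval_flat_close hP hm (point τ) (q ^ 2) 1
          have m5 : τ.pn (m + 1) = m := by rw [← m3, τ.pn_pn]
          have e1 : upd3 m 1 (q ^ 2 * 1) (q ^ 2) (point τ) = point τ := by
            funext j
            unfold upd3
            split_ifs with c1 c2 c3
            · rw [point_eq, c1, if_pos (by omega)]
            · rw [point_eq, c2, if_neg (by omega), mul_one]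
            · rw [point_eq, c3, if_neg (by rw [hm] at o2; exact o2)]
            · rfl
          have e2 : upd3 m (q ^ 2) 1 (q ^ 2 * 1) (point τ) = point (τ.e k) := by
            have m6 := τ.pn_pn
            rw [hm] at o1 o2 hk0 hk1 hk2 ⊢
            funext j
            rw [point_eq, LinkPattern.pn_e hk2]
            unfold upd3 LinkPattern.eFun
            rw [point_eq]
            generalize j.val = j
            have := m6 j
            grind (splits := 30)
          rw [e1, e2] at hf
          exact hf
        · refine red ⟨m, by omega⟩ τ' ⟨k - 2, by omega⟩ hτ' ?_ ?_ ?_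
          · refine Fin.ext ?_; rw [skip_val]; simp only [pos]; grind
          · refine Fin.ext ?_; rw [skip_val]; simp only [posSucc]; grind
          · have := LinkPattern.e_ins_of_ge (i := k - 2) ⟨m, by omega⟩ (by simp only; omega) (by omega) τ'
            rw [show k.val - 2 + 2 = k by omega] at this
            exact (congrArg _ hτ').trans this

end

/-! ### The dual basis and the ground state -/

section

open MvPolynomial (eval aeval degreeOf)

variable {n : ℕ}

/-- Extension of a finite sequence by zero. -/
def extz {A : Type*} [Zero A] {N : ℕ} (z : Fin N → A) (i : ℕ) : A := if h : i < N then z ⟨i, h⟩ else 0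

theorem extz_of_lt {A : Type*} [Zero A] {N : ℕ} (z : Fin N → A) {i : ℕ} (h : i < N) :
    extz z i = z ⟨i, h⟩ := dif_pos h

/-- The component of the ground state on nested arches, up to sign. -/
def nestedPoly (n : ℕ) : MvPolynomial (Fin (2 * n)) ℂ :=
  ∏ j ∈ Finset.range n, ∏ i ∈ Finset.range j,
    ((MvPolynomial.C q * extz MvPolynomial.X i - MvPolynomial.C q⁻¹ * extz MvPolynomial.X j) *
      (MvPolynomial.C q * extz MvPolynomial.X (n + i) - MvPolynomial.C q⁻¹ * extz MvPolynomial.X (n + j)))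

theorem eval_extz_X (z : Fin (2 * n) → ℂ) (i : ℕ) :
    eval z (extz MvPolynomial.X i) = extz z i := by
  unfold extz
  split_ifs <;> simp

theorem eval_nestedPoly (z : Fin (2 * n) → ℂ) : eval z (nestedPoly n) =
    ∏ j ∈ Finset.range n, ∏ i ∈ Finset.range j,
      ((q * extz z i - q⁻¹ * extz z j) * (q * extz z (n + i) - q⁻¹ * extz z (n + j))) := by
  simp only [nestedPoly, map_prod, map_mul, map_sub, MvPolynomial.eval_C, eval_extz_X]

theorem eval_nestedPoly_eq_zero {z : Fin (2 * n) → ℂ} {i j : Fin (2 * n)} (hij : i < j)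
    (h : j.val < n ∨ n ≤ i.val) (hz : z j = q ^ 2 * z i) : eval z (nestedPoly n) = 0 := by
  have hq : q * z i - q⁻¹ * z j = 0 := by
    rw [hz, q_inv]; linear_combination (-q * z i) * q_pow_three
  have hij : i.val < j.val := hij
  have hj := j.2
  rw [eval_nestedPoly]
  rcases h with h | h
  · refine Finset.prod_eq_zero (Finset.mem_range.2 h) (Finset.prod_eq_zero (Finset.mem_range.2 hij) ?_)
    rw [extz_of_lt _ i.2, extz_of_lt _ j.2, hq, zero_mul]
  · refine Finset.prod_eq_zero (i := j.val - n) (Finset.mem_range.2 (by omega))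
      (Finset.prod_eq_zero (i := i.val - n) (Finset.mem_range.2 (by omega)) ?_)
    rw [show n + (i.val - n) = i by omega, show n + (j.val - n) = j by omega,
      extz_of_lt _ i.2, extz_of_lt _ j.2, hq, mul_zero]

theorem sum_sum_indicator (n l : ℕ) :
    ∑ j ∈ Finset.range n, ∑ i ∈ Finset.range j, ((if i = l then 1 else 0) + (if j = l then 1 else 0)) =
      if l < n then n - 1 else 0 := by
  induction n with
  | zero => simp
  | succ n ih =>
    rw [Finset.sum_range_succ, ih, Finset.sum_add_distrib, Finset.sum_ite_eq']
    simp only [Finset.mem_range, Finset.sum_const, Finset.card_range, smul_eq_mul]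
    split_ifs <;> omega

theorem degreeOf_extz_X_le (l : Fin (2 * n)) (i : ℕ) :
    degreeOf l (extz MvPolynomial.X i : MvPolynomial (Fin (2 * n)) ℂ) ≤ if i = l then 1 else 0 := by
  unfold extz
  split_ifs with h1 h2
  · rw [MvPolynomial.degreeOf_X]; split_ifs <;> omega
  · rw [MvPolynomial.degreeOf_X, if_neg]
    intro h; exact h2 (by rw [h])
  · simp
  · simp

/-- Among three increasing positions the first two lie in the left half or the last two lie in the
right half, and the corresponding factor vanishes. Each variable meets the $n-1$ others of its half.
-/
theorem isWheel_nestedPoly (n : ℕ) : IsWheel n (nestedPoly n) := by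
  refine ⟨fun l => ?_, fun z i j k hij hjk hj hk => ?_⟩
  · have hl := l.2
    have h1 : ∀ i j, degreeOf l (MvPolynomial.C q * extz MvPolynomial.X i -
        MvPolynomial.C q⁻¹ * extz MvPolynomial.X j : MvPolynomial (Fin (2 * n)) ℂ) ≤
        (if i = l.val then 1 else 0) + (if j = l.val then 1 else 0) := by
      intro i j
      refine (MvPolynomial.degreeOf_sub_le _ _ _).trans (max_le ?_ ?_)
      · exact ((MvPolynomial.degreeOf_C_mul_le _ _ _).trans (degreeOf_extz_X_le l i)).trans (Nat.le_add_right _ _)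
      · exact ((MvPolynomial.degreeOf_C_mul_le _ _ _).trans (degreeOf_extz_X_le l j)).trans (Nat.le_add_left _ _)
    have h2 : degreeOf l (nestedPoly n) ≤ ∑ j ∈ Finset.range n, ∑ i ∈ Finset.range j,
        (((if i = l.val then 1 else 0) + (if j = l.val then 1 else 0)) +
        ((if n + i = l.val then 1 else 0) + (if n + j = l.val then 1 else 0))) := by
      refine (MvPolynomial.degreeOf_prod_le _ _ _).trans (Finset.sum_le_sum fun j _ => ?_)
      refine (MvPolynomial.degreeOf_prod_le _ _ _).trans (Finset.sum_le_sum fun i _ => ?_)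
      exact (MvPolynomial.degreeOf_mul_le _ _ _).trans (add_le_add (h1 _ _) (h1 _ _))
    simp only [Finset.sum_add_distrib (f := fun i => (if i = l.val then 1 else 0) + (if _ = l.val then 1 else 0))] at h2
    rw [Finset.sum_add_distrib, sum_sum_indicator] at h2
    by_cases hln : l.val < n
    · have h3 : ∀ i, n + i ≠ l.val := fun i => by omega
      simp only [h3, if_false, add_zero, Finset.sum_const_zero, hln, if_true] at h2
      omega
    · have h3 : ∀ i, (n + i = l.val) = (i = l.val - n) := fun i => propext (by omega)
      simp only [h3, hln, if_false, sum_sum_indicator] at h2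
      split_ifs at h2 <;> omega
  · by_cases h : j.val < n
    · exact eval_nestedPoly_eq_zero hij (.inl h) hj
    · exact eval_nestedPoly_eq_zero hjk (.inr (by omega)) hk

theorem eval_point_nestedPoly_nested (n : ℕ) :
    eval (point (nested n)) (nestedPoly n) = (-3 * q ^ 2) ^ (n * (n - 1) / 2) := by
  rw [eval_nestedPoly, ← Finset.sum_range_id, ← Finset.prod_pow_eq_pow_sum]
  refine Finset.prod_congr rfl fun j hj => ?_
  have h1 : ∀ i, i < n → extz (point (nested n)) i = 1 := by
    intro i hi
    rw [extz_of_lt _ (by omega), point, if_pos]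
    simp only [nested, Fin.lt_def, Fin.val_rev]; omega
  have h2 : ∀ i, i < n → extz (point (nested n)) (n + i) = q ^ 2 := by
    intro i hi
    rw [extz_of_lt _ (by omega), point, if_neg]
    simp only [nested, Fin.lt_def, Fin.val_rev]; omega
  rw [Finset.mem_range] at hj
  rw [Finset.prod_congr rfl (g := fun _ => -3 * q ^ 2), Finset.prod_const, Finset.card_range]
  intro i hi
  rw [Finset.mem_range] at hi
  rw [h1 i (by omega), h1 j hj, h2 i (by omega), h2 j hj, q_inv]
  have := q_sq
  grind

/-- Every arch crosses the middle, and non-crossing makes the partner strictly decreasing on the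
first half, which leaves one possibility. -/
theorem LinkPattern.eq_nested_of_halves (τ : LinkPattern n) (h1 : ∀ j < n, j < τ.pn j)
    (h2 : ∀ j < n, τ.pn (n + j) < n + j) : τ = nested n := by
  have hpp := τ.pn_pn
  have hge : ∀ j < n, n ≤ τ.pn j := by
    intro j hj
    by_contra h
    have := h1 _ (not_le.1 h)
    rw [hpp] at this
    have := h1 j hj
    omega
  have hlt : ∀ j, j + 1 < n → τ.pn (j + 1) < τ.pn j := by
    intro j hj
    exact (τ.pn_nest (show j < j + 1 by omega) (by have := hge j (by omega); omega)).2
  have up : ∀ j, j < n → τ.pn j + j < 2 * n := by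
    intro j
    induction j with
    | zero => intro h; exact τ.pn_lt (by omega)
    | succ j ih =>
      intro h
      have := hlt j h
      have := ih (by omega)
      omega
  have dn : ∀ d, d < n → n + d ≤ τ.pn (n - 1 - d) := by
    intro d
    induction d with
    | zero => intro h; have := hge (n - 1) (by omega); simpa using this
    | succ d ih =>
      intro h
      have a1 := hlt (n - 1 - (d + 1)) (by omega)
      rw [show n - 1 - (d + 1) + 1 = n - 1 - d by omega] at a1
      have := ih (by omega)
      omega
  have key : ∀ j, j < n → τ.pn j = 2 * n - 1 - j := by
    intro j hj
    have a1 := up j hj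
    have a2 := dn (n - 1 - j) (by omega)
    rw [show n - 1 - (n - 1 - j) = j by omega] at a2
    omega
  refine ext_pn fun j hj => ?_
  have : (nested n).pn j = 2 * n - 1 - j := by
    rw [pn_of_lt _ hj]
    simp only [nested, Fin.val_rev]; omega
  rw [this]
  by_cases hjn : j < n
  · exact key j hjn
  · have := key (2 * n - 1 - j) (by omega)
    rw [← hpp (2 * n - 1 - j), this]
    congr 1
    omega

/-- Another pattern has a closing in the first half, which pairs with position `0`, or an opening in
the second half, which pairs with the last position. -/
theorem eval_point_nestedPoly (τ : LinkPattern n) (h : τ ≠ nested n) :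
    eval (point τ) (nestedPoly n) = 0 := by
  by_contra hne
  refine h (τ.eq_nested_of_halves (fun j hj => ?_) fun j hj => ?_)
  · have h0 := τ.pn_ne (show 0 < 2 * n by omega)
    by_cases hj0 : j = 0
    · rw [hj0]; omega
    · by_contra hj1
      refine hne (eval_nestedPoly_eq_zero (i := ⟨0, by omega⟩) (j := ⟨j, by omega⟩)
        (by rw [Fin.lt_def]; simp only; omega) (.inl hj) ?_)
      rw [point_eq, point_eq, if_neg hj1, if_pos (by simp only; omega), mul_one]
  · have h0 := τ.pn_ne (show 2 * n - 1 < 2 * n by omega)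
    have h0' := τ.pn_lt (show 2 * n - 1 < 2 * n by omega)
    have h2 := τ.pn_ne (show n + j < 2 * n by omega)
    by_cases hj0 : n + j = 2 * n - 1
    · rw [hj0]; omega
    · by_contra hj1
      refine hne (eval_nestedPoly_eq_zero (i := ⟨n + j, by omega⟩) (j := ⟨2 * n - 1, by omega⟩)
        (by rw [Fin.lt_def]; simp only; omega) (.inr (by simp only; omega)) ?_)
      rw [point_eq, point_eq, if_neg (by simp only; omega), if_pos (by simp only; omega), mul_one]

/-- Sum of the positions of the openings. -/
def LinkPattern.height (τ : LinkPattern n) : ℤ :=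
  ∑ j ∈ Finset.range (2 * n), if j < τ.pn j then (j : ℤ) else 0

theorem LinkPattern.height_eq {σ τ : LinkPattern n} {u v : ℕ} (hu : u < 2 * n) (hv : v < 2 * n)
    (h : ∀ j < 2 * n, (if j < σ.pn j then (j : ℤ) else 0) =
      (if j < τ.pn j then (j : ℤ) else 0) + ((if j = v then (v : ℤ) else 0) - if j = u then (u : ℤ) else 0)) :
    σ.height = τ.height + (v - u) := by
  unfold height
  rw [Finset.sum_congr rfl fun j hj => h j (Finset.mem_range.1 hj), Finset.sum_add_distrib,
    Finset.sum_sub_distrib, Finset.sum_ite_eq', Finset.sum_ite_eq', if_pos (Finset.mem_range.2 hv),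
    if_pos (Finset.mem_range.2 hu)]

theorem LinkPattern.height_e_valley (τ : LinkPattern n) {k : ℕ} (hk : k + 1 < 2 * n)
    (h1 : τ.pn k < k) (h2 : k + 1 < τ.pn (k + 1)) : (e k τ).height = τ.height - 1 := by
  rw [height_eq (σ := e k τ) (τ := τ) (u := k + 1) (v := k) hk (by omega)]
  · push_cast; ring
  · intro j hj
    have h3 := τ.pn_pn
    have h4 := h3 j
    rw [pn_e hk]
    unfold eFun
    grind (splits := 30)

theorem LinkPattern.height_le_of_open (τ : LinkPattern n) {k : ℕ} (hk : k + 1 < 2 * n)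
    (h1 : k < τ.pn k) (h2 : k + 1 < τ.pn (k + 1)) : τ.height ≤ (e k τ).height := by
  have h5 := τ.pn_lt hk
  rw [height_eq (σ := e k τ) (τ := τ) (u := k + 1) (v := τ.pn (k + 1)) hk (by omega)]
  · push_cast; omega
  · intro j hj
    have h3 := τ.pn_pn
    have h4 := h3 j
    have h6 := τ.pn_nest (i := k) (j := k + 1) (by omega)
    have h7 := τ.pn_ne hk
    rw [pn_e hk]
    unfold eFun
    grind (splits := 30)

theorem LinkPattern.height_le_of_close (τ : LinkPattern n) {k : ℕ} (hk : k + 1 < 2 * n)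
    (h1 : τ.pn k < k) (h2 : τ.pn (k + 1) < k + 1) : τ.height ≤ (e k τ).height := by
  have h5 := τ.pn_lt hk
  rw [height_eq (σ := e k τ) (τ := τ) (u := τ.pn k) (v := k) (by omega) (by omega)]
  · omega
  · intro j hj
    have h3 := τ.pn_pn
    have h4 := h3 j
    have h6 := τ.pn_nest (i := τ.pn (k + 1)) (j := k)
    have h7 := τ.pn_ne hk
    rw [h3] at h6
    rw [pn_e hk]
    unfold eFun
    grind (splits := 30)

theorem pn_of_point_eq {σ τ : LinkPattern n} (h : point σ = point τ) {j : ℕ} (hj : j < 2 * n) :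
    j < σ.pn j ↔ j < τ.pn j := by
  have h1 := congrFun h ⟨j, hj⟩
  rw [point_eq, point_eq] at h1
  split_ifs at h1 with c1 c2 c3
  · exact iff_of_true c1 c2
  · exact absurd h1.symm q_sq_ne_one
  · exact absurd h1 q_sq_ne_one
  · exact iff_of_false c1 c3

theorem point_injective : Function.Injective (point : LinkPattern n → _) := by
  induction n with
  | zero => exact fun σ τ _ => LinkPattern.ext (funext fun j => j.elim0)
  | succ n ih =>
    intro σ τ h
    obtain ⟨k, τ', rfl⟩ := exists_eq_ins τ
    have hk := k.2
    have h1 : (τ'.ins k).pn k = k + 1 := by rw [LinkPattern.pn_ins]; simp [LinkPattern.insFun]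
    have h2 : (τ'.ins k).pn (k + 1) = k := by rw [LinkPattern.pn_ins]; simp [LinkPattern.insFun]
    have h3 : σ.pn k = k + 1 := by
      refine σ.pn_eq_succ ((pn_of_point_eq h (by omega)).2 (by omega)) ?_ (by omega)
      have := pn_of_point_eq h (j := k + 1) (by omega)
      omega
    obtain ⟨σ', rfl⟩ := σ.exists_ins hk h3
    congr 1
    apply ih
    rw [point_ins, point_ins] at h
    funext l
    have := congrFun h (skip k l)
    simpa using this

/-- Without a valley the openings form an initial segment. As there are as many openings as
closings, this segment is the first half. -/
theorem LinkPattern.exists_valley {τ : LinkPattern n} (h : τ ≠ nested n) :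
    ∃ k, k + 1 < 2 * n ∧ τ.pn k < k ∧ k + 1 < τ.pn (k + 1) := by
  by_contra! hc
  have hc' : ∀ k, k + 1 < 2 * n → τ.pn k < k → τ.pn (k + 1) < k + 1 := fun k hk h1 => by
    have := hc k hk h1
    have := τ.pn_ne hk
    omega
  have mono : ∀ d k, k + d < 2 * n → τ.pn k < k → τ.pn (k + d) < k + d := by
    intro d
    induction d with
    | zero => intro k _ h; exact h
    | succ d ih => intro k hk h1; exact hc' (k + d) (by omega) (ih k (by omega) h1)
  set s := (Finset.range (2 * n)).filter fun j => j < τ.pn j with hs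
  set t := (Finset.range (2 * n)).filter fun j => ¬ j < τ.pn j with ht
  have hcard : s.card = t.card := by
    refine Finset.card_bij' (fun j _ => τ.pn j) (fun j _ => τ.pn j) ?_ ?_ ?_ ?_
    · intro j hj
      simp only [hs, ht, Finset.mem_filter, Finset.mem_range, τ.pn_pn, τ.pn_lt_iff] at *
      omega
    · intro j hj
      simp only [hs, ht, Finset.mem_filter, Finset.mem_range, τ.pn_pn, τ.pn_lt_iff] at *
      have := τ.pn_ne hj.1
      omega
    · intro j _; exact τ.pn_pn j
    · intro j _; exact τ.pn_pn j
  have hst : s.card + t.card = 2 * n := by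
    rw [hs, ht, Finset.card_filter_add_card_filter_not, Finset.card_range]
  refine h (τ.eq_nested_of_halves (fun j hj => ?_) fun j hj => ?_)
  · by_contra hj1
    have hj2 := τ.pn_ne (show j < 2 * n by omega)
    have : s ⊆ Finset.range j := by
      intro i hi
      simp only [hs, Finset.mem_filter, Finset.mem_range] at *
      by_contra hij
      have := mono (i - j) j (by omega) (by omega)
      rw [show j + (i - j) = i by omega] at this
      omega
    have := Finset.card_le_card this
    rw [Finset.card_range] at this
    omega
  · by_contra hj1
    have hj2 := τ.pn_ne (show n + j < 2 * n by omega)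
    have : Finset.range (n + j + 1) ⊆ s := by
      intro i hi
      simp only [hs, Finset.mem_filter, Finset.mem_range] at *
      refine ⟨by omega, ?_⟩
      by_contra hij
      have hi2 := τ.pn_ne (show i < 2 * n by omega)
      have := mono (n + j - i) i (by omega) (by omega)
      rw [show i + (n + j - i) = n + j by omega] at this
      omega
    have := Finset.card_le_card this
    rw [Finset.card_range] at this
    omega

-- Induction on the height, starting from `nestedPoly`. For a valley of `π` at `k`, let `σ` be the
-- lower pattern `π.e k` and $F_\sigma$ its dual polynomial. Then $F_\sigma-\theta_kF_\sigma$ takes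
-- at $\tau$ the value of $F_\sigma$ at $e_k\tau$, so it is the indicator of the preimages of `σ`.
-- Apart from `π` these are no higher than `σ`, and their dual polynomials can be subtracted.
open scoped Classical in
theorem exists_dual (π : LinkPattern n) :
    ∃ P, IsWheel n P ∧ ∀ τ, eval (point τ) P = if τ = π then 1 else 0 := by
  obtain ⟨d, hd⟩ : ∃ d : ℕ, π.height = d := ⟨π.height.toNat, (Int.toNat_of_nonneg
    (Finset.sum_nonneg fun j _ => by split_ifs <;> simp)).symm⟩
  induction d using Nat.strong_induction_on generalizing π with
  | _ d ih =>
    by_cases hπ : π = nested n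
    · subst hπ
      have hne : (-3 * q ^ 2) ^ (n * (n - 1) / 2) ≠ 0 :=
        pow_ne_zero _ (mul_ne_zero (by norm_num) (pow_ne_zero _ q_ne_zero))
      refine ⟨((-3 * q ^ 2) ^ (n * (n - 1) / 2))⁻¹ • nestedPoly n,
        (wheelSpace n).smul_mem _ (isWheel_nestedPoly n), fun τ => ?_⟩
      rw [MvPolynomial.smul_eval]
      split_ifs with h
      · rw [h, eval_point_nestedPoly_nested, inv_mul_cancel₀ hne]
      · rw [eval_point_nestedPoly _ h, mul_zero]
    · obtain ⟨k, hk, k1, k2⟩ := LinkPattern.exists_valley hπ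
      obtain ⟨n, rfl⟩ : ∃ m, n = m + 1 := ⟨n - 1, by omega⟩
      have hkn : k < 2 * n + 1 := by omega
      set σ := π.e k with hσ
      have hA : σ.height = π.height - 1 := π.height_e_valley hk k1 k2
      have hsn : ∀ τ : LinkPattern (n + 1), 0 ≤ τ.height := fun τ =>
        Finset.sum_nonneg fun j _ => by split_ifs <;> simp
      -- Two openings or two closings at `k` give a pattern no higher than its image; a little arch
      -- gives `σ` itself; a valley determines the evaluation point and hence `π`.
      have low : ∀ τ : LinkPattern (n + 1), τ.e k = σ → τ ≠ π → τ.height ≤ σ.height := by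
        intro τ hτ hne
        have a1 := τ.pn_ne (show k < _ by omega)
        have a2 := τ.pn_ne hk
        by_cases o1 : k < τ.pn k
        · by_cases o2 : k + 1 < τ.pn (k + 1)
          · rw [← hτ]; exact τ.height_le_of_open hk o1 o2
          · rw [← hτ, τ.e_of_pn_eq (τ.pn_eq_succ o1 (by omega) hk) hkn]
        · by_cases o2 : k + 1 < τ.pn (k + 1)
          · exfalso
            apply hne
            apply point_injective
            have e1 := point_e_valley τ ⟨k, hkn⟩ (by simp only; omega) o2
            have e2 := point_e_valley π ⟨k, hkn⟩ k1 k2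
            simp only at e1 e2
            rw [hτ, hσ, e2] at e1
            funext j
            have := congrFun e1 (Equiv.swap (pos ⟨k, hkn⟩) (posSucc ⟨k, hkn⟩) j)
            simp only [Equiv.swap_apply_self] at this
            exact this.symm
          · rw [← hτ]; exact τ.height_le_of_close hk (by omega) (by omega)
      have ih' : ∀ τ : LinkPattern (n + 1), τ.height ≤ σ.height → ∃ P, IsWheel (n + 1) P ∧
          ∀ ρ, eval (point ρ) P = if ρ = τ then 1 else 0 := by
        intro τ hτ
        refine ih τ.height.toNat ?_ τ (Int.toNat_of_nonneg (hsn τ)).symm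
        have := hsn τ
        omega
      choose! F hF1 hF2 using ih'
      obtain ⟨R, hR, hT⟩ := (hF1 σ le_rfl).exists_theta ⟨k, hkn⟩
      have hRe := fun τ => hT.eval_point (hF1 σ le_rfl) hR τ
      refine ⟨F σ - R - ∑ τ with τ.e k = σ ∧ τ ≠ π, F τ, ?_, fun τ => ?_⟩
      · refine (wheelSpace (n + 1)).sub_mem ((wheelSpace (n + 1)).sub_mem (hF1 σ le_rfl) hR)
          ((wheelSpace (n + 1)).sum_mem fun τ hτ => ?_)
        rw [Finset.mem_filter] at hτ
        exact hF1 τ (low τ hτ.2.1 hτ.2.2)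
      · rw [map_sub, map_sub, map_sum, hRe, sub_sub_cancel, hF2 σ le_rfl]
        rw [Finset.sum_congr rfl (g := fun ρ => if τ = ρ then 1 else 0), Finset.sum_ite_eq]
        · simp only [Finset.mem_filter, Finset.mem_univ, true_and]
          by_cases c1 : τ = π
          · subst c1; simp [hσ]
          · by_cases c2 : τ.e k = σ <;> simp [c1, c2]
        · intro ρ hρ
          rw [Finset.mem_filter] at hρ
          exact hF2 ρ (low ρ hρ.2.1 hρ.2.2) τ

/-- The ground state, as the dual basis of the evaluation points. -/
def groundState (π : LinkPattern n) : MvPolynomial (Fin (2 * n)) ℂ :=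
  (3 * q ^ 2) ^ (n * (n - 1) / 2) • (exists_dual π).choose

theorem isWheel_groundState (π : LinkPattern n) : IsWheel n (groundState π) :=
  (wheelSpace n).smul_mem _ (exists_dual π).choose_spec.1

open scoped Classical in
theorem eval_point_groundState (π τ : LinkPattern n) :
    eval (point τ) (groundState π) = if τ = π then (3 * q ^ 2) ^ (n * (n - 1) / 2) else 0 := by
  rw [groundState, MvPolynomial.smul_eval, (exists_dual π).choose_spec.2]
  split_ifs <;> simp

theorem IsWheel.ext {P Q : MvPolynomial (Fin (2 * n)) ℂ} (hP : IsWheel n P) (hQ : IsWheel n Q)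
    (h : ∀ τ, eval (point τ) P = eval (point τ) Q) : P = Q :=
  sub_eq_zero.1 (((wheelSpace n).sub_mem hP hQ).eq_zero_of_points fun τ => by rw [map_sub, h, sub_self])

theorem groundState_nested (n : ℕ) :
    groundState (nested n) = (-1) ^ (n * (n - 1) / 2) * nestedPoly n := by
  have h : (-1) ^ (n * (n - 1) / 2) * nestedPoly n = ((-1 : ℂ) ^ (n * (n - 1) / 2)) • nestedPoly n := by
    rw [MvPolynomial.smul_eq_C_mul]; simp
  rw [h]
  refine (isWheel_groundState _).ext ((wheelSpace n).smul_mem _ (isWheel_nestedPoly n)) fun τ => ?_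
  rw [eval_point_groundState, MvPolynomial.smul_eval]
  split_ifs with c
  · rw [c, eval_point_nestedPoly_nested, ← mul_pow]; congr 1; ring
  · rw [eval_point_nestedPoly _ c, mul_zero]

/-- The vector of values of the ground state. -/
def gs (z : Fin (2 * n) → ℂ) (π : LinkPattern n) : ℂ := eval z (groundState π)

/-- Values at the points identify $\theta_k\Psi_\pi$ with $\Psi_\pi-\sum_{e_k\tau=\pi}\Psi_\tau$.
Solving the definition of $\theta_k$ for the exchanged argument gives this form. -/
theorem gs_exchange (k : Fin (2 * n + 1)) (x y : ℂ) (z : Fin (2 * n) → ℂ) :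
    (q * x - q⁻¹ * y) • gs (ins2 k y x z) =
      (q * y - q⁻¹ * x) • gs (ins2 k x y z) + (y - x) • push (LinkPattern.e k) (gs (ins2 k x y z)) := by
  classical
  funext π
  obtain ⟨R, hR, hT⟩ := (isWheel_groundState π).exists_theta k
  have hRe : R = groundState π - ∑ τ with LinkPattern.e k τ = π, groundState τ := by
    refine hR.ext ((wheelSpace (n + 1)).sub_mem (isWheel_groundState π)
      ((wheelSpace (n + 1)).sum_mem fun τ _ => isWheel_groundState τ)) fun τ => ?_
    rw [hT.eval_point (isWheel_groundState π) hR, map_sub, map_sum]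
    congr 1
    simp only [eval_point_groundState]
    rw [Finset.sum_ite_eq]
    simp
  have h1 := hT (ins2 k x y z)
  have h2 : (fun j => ins2 k x y z (Equiv.swap (pos k) (posSucc k) j)) = ins2 k y x z := by
    funext j
    rcases pos_or_skip k j with rfl | rfl | ⟨l, rfl⟩
    · simp
    · simp
    · rw [Equiv.swap_apply_of_ne_of_ne (skip_ne_pos k l) (skip_ne_posSucc k l), ins2_skip, ins2_skip]
  rw [h2, ins2_pos, ins2_posSucc, hRe, map_sub, map_sum] at h1
  simp only [Pi.smul_apply, Pi.add_apply, smul_eq_mul, push_apply, gs]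
  rw [← Finset.sum_filter]
  rw [q_inv] at *
  have := q_sq
  generalize (∑ τ with LinkPattern.e k τ = π, eval (ins2 k x y z) (groundState τ)) = s at *
  grind

/-- The quotient of the restriction is again a wheel polynomial, identified by its values. The power
of $3q^2$ in `groundState` absorbs the factor $(3q^2)^n$ of `prod_point_sub`, so that no constant
remains. -/
theorem gs_restrict (k : Fin (2 * n + 1)) (x : ℂ) (z : Fin (2 * n) → ℂ) :
    gs (ins2 k x (q ^ 2 * x) z) = (∏ l, (z l - q * x)) • push (LinkPattern.ins k) (gs z) := by
  classical
  funext π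
  obtain ⟨Q, hQ, hQe⟩ := (isWheel_groundState π).exists_restrict k
  have : Q = ∑ τ with LinkPattern.ins k τ = π, groundState τ := by
    refine hQ.ext ((wheelSpace n).sum_mem fun τ _ => isWheel_groundState τ) fun τ => ?_
    have h1 := hQe (point τ) 1
    rw [← point_ins, prod_point_sub, eval_point_groundState] at h1
    rw [map_sum]
    simp only [eval_point_groundState]
    rw [Finset.sum_ite_eq]
    simp only [Finset.mem_filter, Finset.mem_univ, true_and]
    refine mul_right_cancel₀ (pow_ne_zero n three_mul_q_sq_ne_zero) (h1.symm.trans ?_)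
    split_ifs
    · rw [← pow_add]
      congr 1
      have : (n + 1) * (n + 1 - 1) = n * (n - 1) + n * 2 := by
        rcases n with _ | n
        · rfl
        · simp only [Nat.add_sub_cancel]; ring
      rw [this, Nat.add_mul_div_right _ _ (by norm_num)]
    · rw [zero_mul]
  simp only [gs, Pi.smul_apply, smul_eq_mul, push_apply]
  rw [hQe, this, map_sum, Finset.sum_filter, mul_comm]

end

/-! ### The eigenvector equation -/

section

open MvPolynomial (eval aeval degreeOf)

variable {n : ℕ}

theorem sum_push {m : ℕ} (f : LinkPattern n → LinkPattern m) (v : LinkPattern n → ℂ) :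
    ∑ σ, push f v σ = ∑ π, v π := by
  classical
  simp only [push_apply]
  rw [Finset.sum_comm]
  simp

/-- The two numerators of a plaquette add up to its denominator, so the normalised matrix preserves
the sum of components. This settles the sizes with a single link pattern. -/
theorem sum_transferNum (t : ℂ) (z : Fin (2 * n) → ℂ) (v : LinkPattern n → ℂ) :
    ∑ σ, transferNum t z v σ = (∏ i, (q * t - q⁻¹ * z i)) * ∑ π, v π := by
  rw [transferNum_apply]
  simp only [Finset.sum_apply, Pi.smul_apply, smul_eq_mul]
  rw [Finset.sum_comm]
  simp only [← Finset.mul_sum, sum_push]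
  rw [← Finset.sum_mul]
  congr 1
  have h : ∀ i, q * t - q⁻¹ * z i = ∑ b, wt t (z i) b := by
    intro i
    rw [Fintype.sum_bool]
    simp only [wt, q_inv]
    have := q_sq
    grind
  simp only [h, Finset.prod_univ_sum, Fintype.piFinset_univ]

theorem subsingleton_linkPattern (h : n ≤ 1) : Subsingleton (LinkPattern n) := by
  refine ⟨fun σ τ => LinkPattern.ext_pn fun j hj => ?_⟩
  have h1 := σ.pn_lt hj
  have h2 := τ.pn_lt hj
  have h3 := σ.pn_ne hj
  have h4 := τ.pn_ne hj
  omega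

/-- The components of the eigenvector equation, as polynomials. -/
def eigenDefect (t : ℂ) (π : LinkPattern n) : MvPolynomial (Fin (2 * n)) ℂ :=
  open scoped Classical in
  (∑ S : Fin (2 * n) → Bool, (∏ i, bif S i then
      (MvPolynomial.C q * MvPolynomial.X i - MvPolynomial.C (q⁻¹ * t)) else
      (MvPolynomial.X i - MvPolynomial.C t)) *
        ∑ τ with LinkPattern.res S τ = π, groundState τ) -
    (∏ i, (MvPolynomial.C (q * t) - MvPolynomial.C q⁻¹ * MvPolynomial.X i)) * groundState π

theorem eval_eigenDefect (t : ℂ) (π : LinkPattern n) (z : Fin (2 * n) → ℂ) :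
    eval z (eigenDefect t π) =
      transferNum t z (gs z) π - (∏ i, (q * t - q⁻¹ * z i)) * gs z π := by
  classical
  rw [eigenDefect, map_sub, map_sum, transferNum_apply]
  simp only [map_mul, map_prod, map_sum, map_sub, MvPolynomial.eval_C, MvPolynomial.eval_X,
    Finset.sum_apply, Pi.smul_apply, smul_eq_mul, push_apply, gs]
  congr 1
  · refine Finset.sum_congr rfl fun S _ => ?_
    rw [Finset.sum_filter]
    congr 1
    refine Finset.prod_congr rfl fun i _ => ?_
    cases S i <;> simp [wt]

theorem degreeOf_linear_le_ite (l i : Fin (2 * n)) (a b : ℂ) :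
    degreeOf l (MvPolynomial.C a * MvPolynomial.X i - MvPolynomial.C b :
      MvPolynomial (Fin (2 * n)) ℂ) ≤ if l = i then 1 else 0 := by
  refine (MvPolynomial.degreeOf_sub_le _ _ _).trans (max_le ?_ ?_)
  · refine (MvPolynomial.degreeOf_C_mul_le _ _ _).trans ?_
    rw [MvPolynomial.degreeOf_X]
  · rw [MvPolynomial.degreeOf_C]; exact Nat.zero_le _

theorem degreeOf_prod_linear_le (l : Fin (2 * n)) {F : Fin (2 * n) → MvPolynomial (Fin (2 * n)) ℂ}
    (hF : ∀ i, degreeOf l (F i) ≤ if l = i then 1 else 0) : degreeOf l (∏ i, F i) ≤ 1 :=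
  ((MvPolynomial.degreeOf_prod_le _ _ _).trans (Finset.sum_le_sum fun i _ => hF i)).trans (by simp)

theorem degreeOf_eigenDefect_le (t : ℂ) (π : LinkPattern n) (l : Fin (2 * n)) :
    degreeOf l (eigenDefect t π) ≤ n := by
  classical
  have hw : ∀ P, IsWheel n P → ∀ F, degreeOf l F ≤ 1 → degreeOf l (F * P) ≤ n := by
    intro P hP F hF
    have h1 := MvPolynomial.degreeOf_mul_le l F P
    have h2 := hP.degree l
    omega
  rw [eigenDefect]
  refine (MvPolynomial.degreeOf_sub_le _ _ _).trans (max_le ?_ ?_)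
  · refine (MvPolynomial.degreeOf_sum_le _ _ _).trans (Finset.sup_le fun S _ => ?_)
    refine hw _ ((wheelSpace n).sum_mem fun τ _ => isWheel_groundState τ) _
      (degreeOf_prod_linear_le l fun i => ?_)
    cases S i
    · simpa using degreeOf_linear_le_ite l i 1 t
    · exact degreeOf_linear_le_ite l i q (q⁻¹ * t)
  · refine hw _ (isWheel_groundState π) _ (degreeOf_prod_linear_le l fun i => ?_)
    rw [← neg_sub, MvPolynomial.degreeOf_neg]
    exact degreeOf_linear_le_ite l i q⁻¹ (q * t)

theorem transferNum_gs (t : ℂ) (z : Fin (2 * n) → ℂ) :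
    transferNum t z (gs z) = (∏ i, (q * t - q⁻¹ * z i)) • gs z := by
  induction n with
  | zero =>
    have := subsingleton_linkPattern (n := 0) (by omega)
    funext π
    have h := sum_transferNum t z (gs z)
    rw [Fintype.sum_subsingleton _ π, Fintype.sum_subsingleton _ π] at h
    exact h
  | succ n ih =>
    rcases Nat.eq_zero_or_pos n with rfl | hn
    · have := subsingleton_linkPattern (n := 0 + 1) (by omega)
      funext π
      have h := sum_transferNum t z (gs z)
      rw [Fintype.sum_subsingleton _ π, Fintype.sum_subsingleton _ π] at h
      exact h
    have hadj : ∀ (k : Fin (2 * n + 1)) x z, transferNum t (ins2 k x (q ^ 2 * x) z)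
        (gs (ins2 k x (q ^ 2 * x) z)) =
        (∏ i, (q * t - q⁻¹ * (ins2 k x (q ^ 2 * x) z i))) • gs (ins2 k x (q ^ 2 * x) z) := by
      intro k x z
      rw [gs_restrict, map_smul, transferNum_ins, ih, map_smul, prod_skip k]
      simp only [ins2_pos, ins2_posSucc, ins2_skip, smul_smul]
      congr 1
      ring
    -- The defect vanishes on $z_j=q^2z_0$. For $j=1$ this is fusion together with the smaller size;
    -- the exchange relation then moves the second variable one place to the right at each step.
    have H : ∀ (m : ℕ) (j : Fin (2 * (n + 1))), j.val = m → j ≠ 0 → ∀ z : Fin (2 * (n + 1)) → ℂ,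
        z j = q ^ 2 * z 0 → ∀ π, eval z (eigenDefect t π) = 0 := by
      intro m
      induction m with
      | zero => intro j hj hj0; exact absurd (Fin.ext hj) hj0
      | succ m ihm =>
        intro j hj hj0 z hz π
        have hj2 := j.2
        set k : Fin (2 * n + 1) := ⟨m, by omega⟩ with hk
        have hjk : posSucc k = j := Fin.ext hj.symm
        rcases Nat.eq_zero_or_pos m with rfl | hm
        · have hk0 : pos k = 0 := rfl
          rw [eval_eigenDefect, eq_ins2 k z, hjk, hz, hk0, hadj]
          simp
        have hpk : pos k ≠ 0 := by
          intro h
          have := congrArg Fin.val h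
          simp only [pos, hk, Fin.val_zero] at this
          omega
        set z₀ := fun l => z (skip k l) with hz₀
        obtain ⟨l₀, hl₀⟩ : ∃ l, skip k l = 0 := by
          refine ⟨⟨0, by omega⟩, Fin.ext ?_⟩
          rw [skip_val]
          simp [hk, hm]
        set y := z j with hy
        have hzx : z = ins2 k (z (pos k)) y z₀ := by
          conv_lhs => rw [eq_ins2 k z, hjk]
        rw [hzx]
        have hc : ∀ j, Continuous fun x => ins2 k x y z₀ j := by
          intro j
          rcases pos_or_skip k j with rfl | rfl | ⟨l, rfl⟩ <;> simp <;> fun_prop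
        -- For $x\ne q^2y$ the factor $qy-q^{-1}x$ produced by the exchange can be cancelled; the
        -- excluded value is recovered by continuity.
        have key : ∀ x, x ≠ q ^ 2 * y → eval (ins2 k x y z₀) (eigenDefect t π) = 0 := by
          intro x hx
          have h1 : ∀ π, eval (ins2 k y x z₀) (eigenDefect t π) = 0 := by
            refine ihm (pos k) rfl hpk _ ?_
            rw [ins2_pos, ← hl₀, ins2_skip, hz₀]
            simp only
            rw [hl₀, hz]
          have h2 : transferNum t (ins2 k y x z₀) (gs (ins2 k y x z₀)) =
              (∏ i, (q * t - q⁻¹ * ins2 k y x z₀ i)) • gs (ins2 k y x z₀) := by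
            funext π
            have := h1 π
            rw [eval_eigenDefect, sub_eq_zero] at this
            exact this
          have h3 := gs_exchange k y x z₀
          have h4 := transferNum_exchange t k y x z₀ (gs (ins2 k y x z₀))
          rw [← h3, h2, map_smul, map_smul, smul_comm _ (∏ i, (q * t - q⁻¹ * ins2 k y x z₀ i)),
            smul_comm _ (∏ i, (q * t - q⁻¹ * ins2 k y x z₀ i)), ← smul_add, ← h3] at h4
          have h5 := congrFun h4 π
          simp only [Pi.smul_apply, smul_eq_mul] at h5
          have hne : q * y - q⁻¹ * x ≠ 0 := by
            rw [q_inv]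
            intro h
            apply hx
            have := q_pow_three
            linear_combination (-q) * h - x * this
          rw [eval_eigenDefect, sub_eq_zero]
          refine mul_left_cancel₀ hne (h5.trans ?_)
          have h6 : ∏ i, (q * t - q⁻¹ * ins2 k y x z₀ i) = ∏ i, (q * t - q⁻¹ * ins2 k x y z₀ i) := by
            rw [prod_skip k, prod_skip k]
            simp only [ins2_pos, ins2_posSucc, ins2_skip]
            ring
          rw [h6]
          ring
        by_cases hx : z (pos k) = q ^ 2 * y
        · rw [hx]
          exact eq_of_punctured (continuous_eval_of hc _) continuous_const key
        · exact key _ hx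
    -- The defect has degree at most $n+1$ in $z_0$, less than $2n+1$ because $n$ is positive here.
    have hzero : ∀ π : LinkPattern (n + 1), eigenDefect t π = 0 := fun π =>
      eq_zero_of_vanish_zero (by have := degreeOf_eigenDefect_le t π 0; omega)
        fun z j hj hz => H j j rfl hj z hz π
    funext π
    have := eval_eigenDefect t π z
    rw [hzero, map_zero, eq_comm, sub_eq_zero] at this
    exact this

end

section

open MvPolynomial (eval aeval degreeOf)

variable {n : ℕ}

/-! ### Uniqueness of the ground state -/

/-- The link pattern linking `2m` with `2m + 1`. -/
def LinkPattern.pairs (n : ℕ) : LinkPattern n :=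
  ofNat n (fun j => if j % 2 = 0 then j + 1 else j - 1)
    (fun j hj => by grind) (fun j hj => by grind) (fun j hj => by grind) (fun i j h1 h2 h3 _ => by grind)

/-- The alternating strip connects the outer points $2m$ and $2m+1$ directly through their common
side, so it forgets the pattern inside. This is what makes the Markov kernel contracting. -/
theorem res_alternating (π : LinkPattern n) :
    LinkPattern.res (fun i => decide (i.val % 2 = 1)) π = LinkPattern.pairs n := by
  rw [← LinkPattern.isResult_iff]
  have key : ∀ m (hm : 2 * m + 1 < 2 * n), Relation.EqvGen
      (StripLink (fun i : Fin (2 * n) => decide (i.val % 2 = 1)) π)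
      (.outer ⟨2 * m, by omega⟩) (.outer ⟨2 * m + 1, hm⟩) := by
    intro m hm
    have hr : finRotate (2 * n) ⟨2 * m, by omega⟩ = ⟨2 * m + 1, hm⟩ := by
      obtain ⟨N, hN⟩ : ∃ N, 2 * n = N + 1 := ⟨2 * n - 1, by omega⟩
      have aux : ∀ M (h : M = N + 1) (h1 : 2 * m < M) (h2 : 2 * m + 1 < M),
          finRotate M ⟨2 * m, h1⟩ = ⟨2 * m + 1, h2⟩ := by
        rintro M rfl h1 h2
        exact finRotate_of_lt (by omega)
      exact aux _ hN _ _
    refine .trans _ (.side ⟨2 * m + 1, hm⟩) _ ?_ ?_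
    · have := StripLink.secondOuter (S := fun i : Fin (2 * n) => decide (i.val % 2 = 1)) (π := π)
        ⟨2 * m, by omega⟩ (by simp)
      rw [hr] at this
      exact .rel _ _ this
    · exact .symm _ _ (.rel _ _ (StripLink.firstOuter ⟨2 * m + 1, hm⟩ (by simp [Nat.add_mod])))
  rintro ⟨i, hi⟩
  rcases Nat.even_or_odd' i with ⟨m, rfl | rfl⟩
  · rw [show (LinkPattern.pairs n).partner ⟨2 * m, hi⟩ = ⟨2 * m + 1, by omega⟩ by
      apply Fin.ext; simp [LinkPattern.pairs, LinkPattern.ofNat]]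
    exact key m (by omega)
  · rw [show (LinkPattern.pairs n).partner ⟨2 * m + 1, hi⟩ = ⟨2 * m, by omega⟩ by
      apply Fin.ext; simp [LinkPattern.pairs, LinkPattern.ofNat, Nat.add_mod]]
    exact .symm _ _ (key m (by omega))

theorem sum_norm_push_le {m : ℕ} (f : LinkPattern n → LinkPattern m) (v : LinkPattern n → ℂ) :
    ∑ σ, ‖push f v σ‖ ≤ ∑ π, ‖v π‖ := by
  classical
  simp only [push_apply]
  refine (Finset.sum_le_sum fun σ _ => norm_sum_le _ _).trans ?_
  rw [Finset.sum_comm]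
  refine Finset.sum_le_sum fun π _ => ?_
  simp [apply_ite norm]

theorem push_const {m : ℕ} {f : LinkPattern n → LinkPattern m} {ρ : LinkPattern m} (hf : ∀ π, f π = ρ)
    {v : LinkPattern n → ℂ} (hv : ∑ π, v π = 0) : push f v = 0 := by
  classical
  funext σ
  simp only [push_apply, hf]
  split_ifs
  · exact hv
  · simp

/-- The spectral parameter for which a plaquette is of the first kind with probability `p`. -/
def prob (p : ℝ) : ℂ := (q ^ 2 + p * q) / (q + p * q ^ 2)

theorem norm_q : ‖q‖ = 1 := Complex.norm_eq_one_of_pow_eq_one q_pow_three (by norm_num)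

theorem prob_denom_ne {p : ℝ} (hp : p ∈ Set.Ioo (0 : ℝ) 1) : q + p * q ^ 2 ≠ 0 := by
  intro h
  have h1 : (p : ℂ) * q = -1 := by
    have : q * (1 + p * q) = 0 := by linear_combination h
    linear_combination (mul_eq_zero.1 this).resolve_left q_ne_zero
  have h2 := congrArg norm h1
  rw [norm_mul, norm_q, mul_one, norm_neg, norm_one, Complex.norm_real, Real.norm_eq_abs,
    abs_of_pos hp.1] at h2
  exact hp.2.ne h2

theorem prob_ne {p : ℝ} (hp : p ∈ Set.Ioo (0 : ℝ) 1) : q * 1 - q⁻¹ * prob p ≠ 0 := by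
  have h := prob_denom_ne hp
  have e : prob p * (q + p * q ^ 2) = q ^ 2 + p * q := div_mul_cancel₀ _ h
  rw [q_inv]
  intro h1
  apply q_sq_ne_q
  linear_combination (q + p * q ^ 2) * h1 + q ^ 2 * e + q * q_pow_three

theorem plaquetteWeight_prob {p : ℝ} (hp : p ∈ Set.Ioo (0 : ℝ) 1) (b : Bool) :
    plaquetteWeight 1 (prob p) b = ((if b then p else 1 - p : ℝ) : ℂ) := by
  rw [plaquetteWeight_eq, div_eq_iff (prob_ne hp)]
  have h := prob_denom_ne hp
  have h2 := q_sq
  have e : prob p * (q + p * q ^ 2) = q ^ 2 + p * q := div_mul_cancel₀ _ h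
  cases b
  · simp only [wt, q_inv]
    refine mul_right_cancel₀ h ?_
    simp only [Bool.false_eq_true, if_false]
    push_cast
    grind
  · simp only [wt, q_inv, if_true]
    refine mul_right_cancel₀ h ?_
    grind

/-- Doeblin's argument: the matrix is a convex combination of deterministic maps, one of which is
constant. That one annihilates vectors of sum zero, so the $\ell^1$ norm shrinks by the factor
$1-W(S_0)<1$ and a fixed vector is zero. -/
theorem eq_zero_of_sum_eq_zero {p : Fin (2 * n) → ℝ} (hp : ∀ i, p i ∈ Set.Ioo (0 : ℝ) 1)
    {v : LinkPattern n → ℂ} (hv : (transferMatrix n 1 fun i => prob (p i)).mulVec v = v)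
    (h0 : ∑ π, v π = 0) : v = 0 := by
  classical
  set S₀ : Fin (2 * n) → Bool := fun i => decide (i.val % 2 = 1) with hS₀
  set W : (Fin (2 * n) → Bool) → ℝ := fun S => ∏ i, (if S i then p i else 1 - p i) with hW
  have hWpos : ∀ S, 0 < W S := fun S => Finset.prod_pos fun i _ => by
    have := hp i
    split_ifs
    · exact this.1
    · linarith [this.2]
  have hWsum : ∑ S, W S = 1 := by
    have h : ∀ i, (1 : ℝ) = ∑ b : Bool, (if b then p i else 1 - p i) := by
      intro i; rw [Fintype.sum_bool]; simp
    rw [← Finset.prod_const_one (ι := Fin (2 * n)) (s := Finset.univ), Finset.prod_congr rfl fun i _ => h i,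
      Finset.prod_univ_sum, Fintype.piFinset_univ]
  have hexp : v = ∑ S, (W S : ℂ) • push (LinkPattern.res S) v := by
    conv_lhs => rw [← hv, transferMatrix_mulVec, transferNum_apply, Finset.smul_sum]
    refine Finset.sum_congr rfl fun S _ => ?_
    rw [smul_smul, ← Finset.prod_inv_distrib, ← Finset.prod_mul_distrib, hW]
    congr 1
    push_cast
    refine Finset.prod_congr rfl fun i _ => ?_
    have := plaquetteWeight_prob (hp i) (S i)
    rw [plaquetteWeight_eq, div_eq_inv_mul] at this
    rw [this]
  have hS : push (LinkPattern.res S₀) v = 0 := push_const (fun π => res_alternating π) h0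
  have hle : ∑ π, ‖v π‖ ≤ (1 - W S₀) * ∑ π, ‖v π‖ := by
    calc ∑ π, ‖v π‖ = ∑ π, ‖∑ S ∈ Finset.univ.erase S₀, (W S : ℂ) * push (LinkPattern.res S) v π‖ := by
          refine Finset.sum_congr rfl fun π _ => ?_
          congr 1
          conv_lhs => rw [hexp]
          rw [Finset.sum_apply, ← Finset.add_sum_erase _ _ (Finset.mem_univ S₀), hS]
          simp
      _ ≤ ∑ π, ∑ S ∈ Finset.univ.erase S₀, W S * ‖push (LinkPattern.res S) v π‖ := by
          refine Finset.sum_le_sum fun π _ => (norm_sum_le _ _).trans (Finset.sum_le_sum fun S _ => ?_)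
          rw [norm_mul, Complex.norm_real, Real.norm_eq_abs, abs_of_pos (hWpos S)]
      _ = ∑ S ∈ Finset.univ.erase S₀, W S * ∑ π, ‖push (LinkPattern.res S) v π‖ := by
          rw [Finset.sum_comm]
          simp only [Finset.mul_sum]
      _ ≤ ∑ S ∈ Finset.univ.erase S₀, W S * ∑ π, ‖v π‖ :=
          Finset.sum_le_sum fun S _ => mul_le_mul_of_nonneg_left (sum_norm_push_le _ _) (hWpos S).le
      _ = (1 - W S₀) * ∑ π, ‖v π‖ := by
          rw [← Finset.sum_mul, ← hWsum, ← Finset.add_sum_erase _ _ (Finset.mem_univ S₀), add_sub_cancel_left]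
  have hsum : ∑ π, ‖v π‖ = 0 := by
    refine le_antisymm ?_ (Finset.sum_nonneg fun _ _ => norm_nonneg _)
    have := hWpos S₀
    nlinarith
  funext π
  have := (Finset.sum_eq_zero_iff_of_nonneg fun _ _ => norm_nonneg _).1 hsum π (Finset.mem_univ _)
  exact norm_eq_zero.1 this

theorem infinite_prob : (prob '' Set.Ioo (0 : ℝ) 1).Infinite := by
  refine Set.Infinite.image ?_ (Set.Ioo_infinite one_pos)
  intro x hx y hy h
  have h1 := plaquetteWeight_prob hx true
  rw [h, plaquetteWeight_prob hy true] at h1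
  simpa using h1.symm

theorem ext_prob {P Q : MvPolynomial (Fin (2 * n)) ℂ}
    (h : ∀ p : Fin (2 * n) → ℝ, (∀ i, p i ∈ Set.Ioo (0 : ℝ) 1) →
      eval (fun i => prob (p i)) P = eval (fun i => prob (p i)) Q) : P = Q := by
  refine MvPolynomial.funext_set (fun _ => prob '' Set.Ioo (0 : ℝ) 1) (fun _ => infinite_prob)
    fun x hx => ?_
  choose p hp hpx using fun i => hx i (Set.mem_univ i)
  rw [show x = fun i => prob (p i) from funext fun i => (hpx i).symm]
  exact h p hp

theorem IsGroundState.sum_ne_zero {Ψ : LinkPattern n → MvPolynomial (Fin (2 * n)) ℂ}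
    (h : IsGroundState n Ψ) : ∑ π, Ψ π ≠ 0 := by
  intro h0
  have : Ψ (nested n) = 0 := by
    refine ext_prob fun p hp => ?_
    have := eq_zero_of_sum_eq_zero hp (h.eigenvector 1 _ fun i => prob_ne (hp i))
      (by rw [← map_sum, h0, map_zero])
    rw [map_zero]
    exact congrFun this (nested n)
  have h1 := h.normalized
  rw [this, map_zero] at h1
  exact pow_ne_zero _ (by norm_num) h1.symm

/-- The vector $(\sum\Psi)\Psi'-(\sum\Psi')\Psi$ has sum zero and is fixed, hence vanishes at all
probabilistic parameters and so as a polynomial vector. -/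
theorem IsGroundState.unique {Ψ Ψ' : LinkPattern n → MvPolynomial (Fin (2 * n)) ℂ}
    (h : IsGroundState n Ψ) (h' : IsGroundState n Ψ') : Ψ' = Ψ := by
  have hprop : ∀ π, (∑ σ, Ψ σ) * Ψ' π = (∑ σ, Ψ' σ) * Ψ π := by
    intro π
    refine ext_prob fun p hp => ?_
    set z : Fin (2 * n) → ℂ := fun i => prob (p i) with hz
    have e1 := h.eigenvector 1 z fun i => prob_ne (hp i)
    have e2 := h'.eigenvector 1 z fun i => prob_ne (hp i)
    have := eq_zero_of_sum_eq_zero (v := eval z (∑ σ, Ψ σ) • (fun π => eval z (Ψ' π)) -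
      eval z (∑ σ, Ψ' σ) • (fun π => eval z (Ψ π))) hp
      (by rw [Matrix.mulVec_sub, Matrix.mulVec_smul, Matrix.mulVec_smul, ← hz, e1, e2]) (by
        simp only [Pi.sub_apply, Pi.smul_apply, smul_eq_mul, Finset.sum_sub_distrib, ← Finset.mul_sum,
          map_sum]
        ring)
    have := congrFun this π
    simp only [Pi.sub_apply, Pi.smul_apply, smul_eq_mul, Pi.zero_apply, sub_eq_zero] at this
    rw [map_mul, map_mul, this]
  -- In lowest terms $a\Psi'=b\Psi$ with $a,b$ coprime. Then $a$ divides every component of $\Psi$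
  -- and $b$ every component of $\Psi'$, so both are constants, equal by normalisation.
  obtain ⟨a, b, c, hab, ha, hb⟩ := UniqueFactorizationMonoid.exists_reduced_factors' (∑ σ, Ψ σ)
    (∑ σ, Ψ' σ) h'.sum_ne_zero
  have hc : c ≠ 0 := by
    rintro rfl
    exact h.sum_ne_zero (by rw [← ha, zero_mul])
  have hab' : ∀ π, a * Ψ' π = b * Ψ π := by
    intro π
    have := hprop π
    rw [← ha, ← hb, mul_assoc, mul_assoc] at this
    exact mul_left_cancel₀ hc this
  have hau : IsUnit a := h.coprime a fun π => hab.dvd_of_dvd_mul_left ⟨_, (hab' π).symm⟩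
  have hbu : IsUnit b := h'.coprime b fun π => hab.symm.dvd_of_dvd_mul_left ⟨_, hab' π⟩
  obtain ⟨r, -, rfl⟩ := MvPolynomial.isUnit_iff_eq_C_of_isReduced.1 hau
  obtain ⟨s, hs, rfl⟩ := MvPolynomial.isUnit_iff_eq_C_of_isReduced.1 hbu
  have h3 := congrArg (eval fun _ => 1) (hab' (nested n))
  rw [map_mul, map_mul, h.normalized, h'.normalized, MvPolynomial.eval_C, MvPolynomial.eval_C] at h3
  have hrs : r = s := mul_right_cancel₀ (pow_ne_zero _ (by norm_num)) h3
  funext π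
  refine mul_left_cancel₀ hbu.ne_zero ?_
  rw [← hab' π, hrs]

/-! ### The ground state -/

theorem exists_open_close {i j : ℕ} (hij : i < j) (hj : j < 2 * n) (h : j < n ∨ n ≤ i) :
    ∃ σ : LinkPattern n, i < σ.pn i ∧ σ.pn j < j := by
  -- Two adjacent sets of nested arches, with their sizes chosen so that `j` is the first closing of
  -- the left set or `i` the last opening of the right set.
  obtain ⟨a, c, rfl, h1, h2⟩ : ∃ a c, n = a + 0 + c ∧ ((i < a ∧ a ≤ j ∧ j < 2 * a) ∨
      (2 * a ≤ i ∧ i < 2 * a + c ∧ 2 * a + c ≤ j)) := by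
    rcases h with h | h
    · exact ⟨j, n - j, by omega, by omega⟩
    · exact ⟨i + 1 - n, 2 * n - (i + 1), by omega, by omega⟩
  all_goals
    refine ⟨threeArches a 0 c, ?_, ?_⟩
    · rw [LinkPattern.pn_of_lt _ (by omega)]
      simp only [threeArches, threePartner]
      split_ifs <;> omega
    · rw [LinkPattern.pn_of_lt _ (by omega)]
      simp only [threeArches, threePartner]
      split_ifs <;> omega

theorem irreducible_linear {σ : Type*} {i j : σ} (hij : i ≠ j) :
    Irreducible (MvPolynomial.C q * MvPolynomial.X i - MvPolynomial.C q⁻¹ * MvPolynomial.X j :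
      MvPolynomial σ ℂ) := by
  classical
  set L : MvPolynomial σ ℂ := MvPolynomial.C q * MvPolynomial.X i - MvPolynomial.C q⁻¹ * MvPolynomial.X j
    with hL
  have hne : L ≠ 0 := by
    intro h
    have := congrArg (eval fun l => if l = i then 1 else 0) h
    simp [hL, hij.symm, q_ne_zero] at this
  have hh : L.IsHomogeneous 1 :=
    ((MvPolynomial.isHomogeneous_C_mul_X q i).sub (MvPolynomial.isHomogeneous_C_mul_X q⁻¹ j))
  refine MvPolynomial.irreducible_of_totalDegree_eq_one (hh.totalDegree hne) fun x hx => ?_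
  rw [isUnit_iff_ne_zero]
  rintro rfl
  exact hne (MvPolynomial.ext _ _ fun m => by rw [MvPolynomial.coeff_zero]; exact zero_dvd_iff.1 (hx m))

theorem nestedPoly_ne_zero (n : ℕ) : nestedPoly n ≠ 0 := by
  intro h
  have := eval_point_nestedPoly_nested n
  rw [h, map_zero] at this
  exact pow_ne_zero _ (mul_ne_zero (by norm_num) (pow_ne_zero _ q_ne_zero)) this.symm

theorem isGroundState_groundState (n : ℕ) : IsGroundState n groundState where
  eigenvector t z h := by
    have h1 := transferNum_gs t z
    have h2 : ∏ i, (q * t - q⁻¹ * z i) ≠ 0 := Finset.prod_ne_zero_iff.2 fun i _ => h i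
    rw [transferMatrix_mulVec]
    change _ • transferNum t z (gs z) = gs z
    rw [h1, smul_smul, inv_mul_cancel₀ h2, one_smul]
  coprime d hd := by
    classical
    by_contra hu
    have hdn : d ∣ nestedPoly n := by
      have := hd (nested n)
      rw [groundState_nested] at this
      exact (IsUnit.dvd_mul_left (isUnit_one.neg.pow _)).1 this
    have hd0 : d ≠ 0 := by
      rintro rfl
      exact nestedPoly_ne_zero n (zero_dvd_iff.1 hdn)
    obtain ⟨p, hp, hpd⟩ := WfDvdMonoid.exists_irreducible_factor hu hd0
    have hpp : Prime p := hp.prime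
    obtain ⟨j, hj, hpj⟩ := hpp.exists_mem_finset_dvd (hpd.trans hdn)
    obtain ⟨i, hi, hpi⟩ := hpp.exists_mem_finset_dvd hpj
    rw [Finset.mem_range] at hi hj
    -- A common irreducible factor divides the nested component, so it is associated to some
    -- $qz_i-q^{-1}z_j$ with $i<j$ in one half. It would vanish at the point of a pattern opening at
    -- $i$ and closing at $j$, where the component of that pattern is nonzero.
    have key : ∀ (i j : ℕ) (hij : i < j) (hj : j < 2 * n), (j < n ∨ n ≤ i) →
        ¬ p ∣ (MvPolynomial.C q * extz MvPolynomial.X i - MvPolynomial.C q⁻¹ * extz MvPolynomial.X j) := by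
      intro i j hij hj h hdvd
      rw [extz_of_lt _ hj, extz_of_lt _ (show i < 2 * n by omega)] at hdvd
      have hL := irreducible_linear (i := (⟨i, by omega⟩ : Fin (2 * n))) (j := ⟨j, hj⟩)
        (by simp only [ne_eq, Fin.mk.injEq]; omega)
      have has := hp.associated_of_dvd hL hdvd
      obtain ⟨σ, h1, h2⟩ := exists_open_close hij hj h
      obtain ⟨Q, hQ⟩ := (has.symm.dvd.trans hpd).trans (hd σ)
      have h3 := congrArg (eval (point σ)) hQ
      rw [eval_point_groundState, if_pos rfl, map_mul, map_sub, map_mul, map_mul, MvPolynomial.eval_C,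
        MvPolynomial.eval_C, MvPolynomial.eval_X, MvPolynomial.eval_X, point_eq, point_eq, if_pos h1,
        if_neg h2.not_gt, q_inv, show q * 1 - q ^ 2 * q ^ 2 = 0 by linear_combination -q * q_pow_three,
        zero_mul] at h3
      exact pow_ne_zero _ three_mul_q_sq_ne_zero h3
    rcases hpp.dvd_or_dvd hpi with h | h
    · exact key i j hi (by omega) (.inl hj) h
    · exact key (n + i) (n + j) (by omega) (by omega) (.inr (by omega)) h
  normalized := by
    rw [groundState_nested, map_mul, map_pow, map_neg, map_one, eval_nestedPoly, ← Finset.sum_range_id,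
      ← Finset.prod_pow_eq_pow_sum, ← Finset.prod_pow_eq_pow_sum, ← Finset.prod_mul_distrib]
    refine Finset.prod_congr rfl fun j hj => ?_
    rw [Finset.mem_range] at hj
    rw [Finset.prod_congr rfl (g := fun _ => (-3 : ℂ)), Finset.prod_const, Finset.card_range, ← mul_pow]
    · norm_num
    · intro i hi
      rw [Finset.mem_range] at hi
      rw [extz_of_lt _ (by omega), extz_of_lt _ (by omega), extz_of_lt _ (by omega), extz_of_lt _ (by omega),
        q_inv]
      have := q_sq
      grind

end

section

/-! ### The vertex model of lozenge tilings -/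

/-- The weight of a cell of the vertex model: `l`, `b`, `r`, `t` tell which of the left, bottom,
right and top edges of the cell are crossed by a lozenge. -/
def cellWeight (x y g : ℂ) : Bool → Bool → Bool → Bool → ℂ
  | false, false, false, false => x - y
  | true, false, true, false => g - y
  | true, false, false, true => g - y
  | false, true, true, false => x - g
  | false, true, false, true => x - g
  | _, _, _, _ => 0

/-- The weight of the first `N` cells of a column with given left, right and top edges. -/
def colSum (β g : ℕ → ℂ) (x : ℂ) : (N : ℕ) → (A B : Fin N → Bool) → Bool → ℂ
  | 0, _, _, t => bif t then 0 else 1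
  | N + 1, A, B, t => ∑ b, cellWeight x (β N) (g N) (A (Fin.last N)) b (B (Fin.last N)) t *
      colSum β g x N (Fin.init A) (Fin.init B) b

/-- The transfer matrix of a column. -/
def colMat (β g : ℕ → ℂ) (N : ℕ) (x : ℂ) : Matrix (Fin N → Bool) (Fin N → Bool) ℂ :=
  fun A B => colSum β g x N A B false

/-- The weight of the first cells of two consecutive columns. -/
def twoSum (β g : ℕ → ℂ) (x y : ℂ) (N : ℕ) (A C : Fin N → Bool) (s t : Bool) : ℂ :=
  ∑ B, colSum β g x N A B s * colSum β (fun r => g (r + 1)) y N B C t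

theorem sum_snoc {N : ℕ} (F : (Fin (N + 1) → Bool) → ℂ) :
    ∑ f, F f = ∑ f : Fin N → Bool, ∑ b : Bool, F (Fin.snoc (α := fun _ => Bool) f b) := by
  rw [← (Fin.snocEquiv fun _ => Bool).sum_comp, Fintype.sum_prod_type_right]
  rfl

theorem twoSum_succ (β g : ℕ → ℂ) (x y : ℂ) (N : ℕ) (A C : Fin (N + 1) → Bool) (s t : Bool) :
    twoSum β g x y (N + 1) A C s t = ∑ b, ∑ b', (∑ m,
      cellWeight x (β N) (g N) (A (Fin.last N)) b m s *
        cellWeight y (β N) (g (N + 1)) m b' (C (Fin.last N)) t) *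
          twoSum β g x y N (Fin.init A) (Fin.init C) b b' := by
  unfold twoSum
  rw [sum_snoc]
  simp only [colSum, Fin.snoc_last, Fin.init_snoc, Fintype.sum_bool, Finset.mul_sum,
    ← Finset.sum_add_distrib]
  refine Finset.sum_congr rfl fun f _ => ?_
  ring

/-- Exchanging the parameters of two columns, one row at a time. For uncrossed tops the sums are
symmetric, but the induction must also carry crossed tops, where symmetry holds only after the
triangular change of basis in the last two relations. -/
theorem twoSum_invariant (β g : ℕ → ℂ) (x y : ℂ) (N : ℕ) (A C : Fin N → Bool) :
    twoSum β g x y N A C false false = twoSum β g y x N A C false false ∧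
    twoSum β g x y N A C false true = twoSum β g y x N A C false true ∧
    (x - g N) * twoSum β g x y N A C true false - x * twoSum β g x y N A C false true =
      (y - g N) * twoSum β g y x N A C true false - y * twoSum β g y x N A C false true ∧
    (x - g N) * twoSum β g x y N A C true true = (y - g N) * twoSum β g y x N A C true true := by
  induction N with
  | zero => simp [twoSum, colSum]
  | succ N ih =>
    obtain ⟨h1, h2, h3, h4⟩ := ih (Fin.init A) (Fin.init C)
    simp only [twoSum_succ, Fintype.sum_bool]
    generalize A (Fin.last N) = a
    generalize C (Fin.last N) = c
    generalize twoSum β g x y N (Fin.init A) (Fin.init C) false false = s00 at *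
    generalize twoSum β g x y N (Fin.init A) (Fin.init C) false true = s01 at *
    generalize twoSum β g x y N (Fin.init A) (Fin.init C) true false = s10 at *
    generalize twoSum β g x y N (Fin.init A) (Fin.init C) true true = s11 at *
    generalize twoSum β g y x N (Fin.init A) (Fin.init C) false false = t00 at *
    generalize twoSum β g y x N (Fin.init A) (Fin.init C) false true = t01 at *
    generalize twoSum β g y x N (Fin.init A) (Fin.init C) true false = t10 at *
    generalize twoSum β g y x N (Fin.init A) (Fin.init C) true true = t11 at *
    subst h1 h2
    refine ⟨?_, ?_, ?_, ?_⟩ <;> cases a <;> cases c <;> simp only [cellWeight] <;> grind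

theorem colMat_swap (β g : ℕ → ℂ) (N : ℕ) (x y : ℂ) :
    colMat β g N x * colMat β (fun r => g (r + 1)) N y =
      colMat β g N y * colMat β (fun r => g (r + 1)) N x := by
  ext A C
  exact (twoSum_invariant β g x y N A C).1

/-- The product of the transfer matrices of consecutive columns. -/
def colProd (β : ℕ → ℂ) (N : ℕ) : (M : ℕ) → (g : ℕ → ℂ) → (α : ℕ → ℂ) →
    Matrix (Fin N → Bool) (Fin N → Bool) ℂ
  | 0, _, _ => 1
  | M + 1, g, α => colMat β g N (α 0) * colProd β N M (fun r => g (r + 1)) fun i => α (i + 1)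

theorem colProd_swap (β : ℕ → ℂ) (N M : ℕ) (g α : ℕ → ℂ) {i : ℕ} (hi : i + 1 < M) :
    colProd β N M g (fun j => α (Equiv.swap i (i + 1) j)) = colProd β N M g α := by
  induction M generalizing g α i with
  | zero => omega
  | succ M ih =>
    rcases i with _ | i
    · rcases M with _ | M
      · omega
      · simp only [colProd, ← mul_assoc, zero_add, Equiv.swap_apply_left, Equiv.swap_apply_right]
        rw [colMat_swap]
        congr 2
    · simp only [colProd]
      rw [Equiv.swap_apply_of_ne_of_ne (by omega) (by omega)]
      congr 1
      rw [← ih (fun r => g (r + 1)) (fun i => α (i + 1)) (i := i) (by omega)]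
      congr 1
      funext j
      congr 1
      simp only [Equiv.swap_apply_def]
      grind

end

/-! ### Frozen rows and columns of the vertex model -/

section

/-- The state in which the first `m` edges are crossed. -/
def firstEdges (m N : ℕ) (r : Fin N) : Bool := decide (r.val < m)

/-- The state in which all edges but the first `m` are crossed. -/
def lastEdges (m N : ℕ) (r : Fin N) : Bool := decide (m ≤ r.val)

theorem eq_iff_init {N : ℕ} (B f : Fin (N + 1) → Bool) :
    B = f ↔ Fin.init B = Fin.init f ∧ B (Fin.last N) = f (Fin.last N) := by
  constructor
  · rintro rfl; exact ⟨rfl, rfl⟩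
  · rintro ⟨h1, h2⟩
    rw [← Fin.snoc_init_self B, ← Fin.snoc_init_self f, h1, h2]

theorem init_firstEdges (m N : ℕ) : Fin.init (firstEdges m (N + 1)) = firstEdges m N := rfl

theorem colSum_first_false (β g : ℕ → ℂ) (x : ℂ) {m N : ℕ} (h : N ≤ m) (B : Fin N → Bool) :
    colSum β g x N (firstEdges m N) B false =
      if B = firstEdges m N then ∏ r ∈ Finset.range N, (g r - β r) else 0 := by
  induction N with
  | zero => simp [colSum, Subsingleton.elim B (firstEdges m 0)]
  | succ N ih =>
    rw [colSum, init_firstEdges, Fintype.sum_bool, ih (by omega)]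
    have h1 : firstEdges m (N + 1) (Fin.last N) = true := by simp [firstEdges]; omega
    rw [h1]
    simp only [eq_iff_init B, init_firstEdges, h1, Finset.prod_range_succ]
    cases B (Fin.last N) <;> simp [cellWeight, mul_comm]

/-- Lines run straight through the lower cells. The topmost one has to turn upwards, since nothing
else can cross the top edge, and then rises to the top. -/
theorem colSum_first_true (β g : ℕ → ℂ) (x : ℂ) {m N : ℕ} (hm : 0 < m) (h : m ≤ N) (B : Fin N → Bool) :
    colSum β g x N (firstEdges m N) B true =
      if B = firstEdges (m - 1) N then
        (∏ r ∈ Finset.range m, (g r - β r)) * ∏ r ∈ Finset.Ico m N, (x - g r) else 0 := by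
  induction N with
  | zero => omega
  | succ N ih =>
    rw [colSum, init_firstEdges, Fintype.sum_bool]
    simp only [eq_iff_init B, init_firstEdges]
    have h2 : firstEdges (m - 1) (N + 1) (Fin.last N) = false := by simp [firstEdges]; omega
    rw [h2]
    rcases h.eq_or_lt with rfl | h
    · have h1 : firstEdges (N + 1) (N + 1) (Fin.last N) = true := by simp [firstEdges]
      rw [h1, colSum_first_false β g x (by omega)]
      have h3 : firstEdges (N + 1) N = firstEdges N N := by
        funext r; simp [firstEdges]
      simp only [h3, Nat.add_sub_cancel, Finset.Ico_self, Finset.prod_empty, mul_one,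
        Finset.prod_range_succ]
      cases B (Fin.last N) <;> simp [cellWeight, mul_comm]
    · have h1 : firstEdges m (N + 1) (Fin.last N) = false := by simp [firstEdges]; omega
      rw [h1, ih (by omega), Finset.prod_Ico_succ_top (by omega)]
      cases B (Fin.last N)
      · simp only [cellWeight, zero_mul, add_zero, and_true, mul_ite, mul_zero]
        congr 1
        ring
      · simp [cellWeight]

/-- The top of the column is uncrossed, so a line entering the last cell from the left leaves it on
the right. -/
theorem colMat_snoc_true (β g : ℕ → ℂ) (N : ℕ) (x : ℂ) (A B : Fin N → Bool) (b : Bool) :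
    colMat β g (N + 1) x (Fin.snoc (α := fun _ => Bool) A true) (Fin.snoc (α := fun _ => Bool) B b) =
      if b then (g N - β N) * colMat β g N x A B else 0 := by
  unfold colMat
  rw [colSum, Fintype.sum_bool]
  simp only [Fin.snoc_last, Fin.init_snoc]
  cases b <;> simp [cellWeight]

theorem colProd_snoc_true (β : ℕ → ℂ) (N M : ℕ) (g α : ℕ → ℂ) (A C : Fin N → Bool) :
    colProd β (N + 1) M g α (Fin.snoc (α := fun _ => Bool) A true)
        (Fin.snoc (α := fun _ => Bool) C true) =
      (∏ i ∈ Finset.range M, (g (i + N) - β N)) * colProd β N M g α A C := by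
  induction M generalizing g α A with
  | zero =>
    simp only [colProd, Finset.range_zero, Finset.prod_empty, one_mul, Matrix.one_apply]
    congr 1
    rw [eq_iff_init, Fin.init_snoc, Fin.init_snoc]
    simp
  | succ M ih =>
    simp only [colProd, Matrix.mul_apply]
    rw [sum_snoc, Finset.mul_sum]
    refine Finset.sum_congr rfl fun B _ => ?_
    rw [Fintype.sum_bool, colMat_snoc_true, colMat_snoc_true, ih]
    simp only [if_true, Bool.false_eq_true, if_false, zero_mul, add_zero]
    rw [Finset.prod_range_succ']
    simp only [zero_add, add_assoc, add_comm N 1]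
    ring

theorem colSum_empty (β g : ℕ → ℂ) (x : ℂ) (N : ℕ) (B : Fin N → Bool) (t : Bool) :
    colSum β g x N (fun _ => false) B t =
      if t = false ∧ B = fun _ => false then ∏ r ∈ Finset.range N, (x - β r) else 0 := by
  induction N generalizing t with
  | zero => cases t <;> simp [colSum, eq_iff_true_of_subsingleton]
  | succ N ih =>
    have h1 : Fin.init (fun _ : Fin (N + 1) => false) = fun _ => false := rfl
    rw [colSum, h1, Fintype.sum_bool, ih, ih]
    simp only [eq_iff_init B, h1, Finset.prod_range_succ]
    cases t <;> cases B (Fin.last N) <;> simp [cellWeight, mul_comm]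

theorem colProd_empty (β : ℕ → ℂ) (N M : ℕ) (g α : ℕ → ℂ) :
    colProd β N M g α (fun _ => false) (fun _ => false) =
      ∏ i ∈ Finset.range M, ∏ r ∈ Finset.range N, (α i - β r) := by
  induction M generalizing g α with
  | zero => simp [colProd]
  | succ M ih =>
    rw [colProd, Matrix.mul_apply, Finset.sum_eq_single fun _ => false]
    · rw [ih, colMat, colSum_empty, if_pos ⟨rfl, rfl⟩, Finset.prod_range_succ', mul_comm]
    · intro B _ hB
      rw [colMat, colSum_empty, if_neg fun h => hB h.2, zero_mul]
    · simp

/-- The hypothesis kills the empty state of the top cell of the first column. That cell must carry a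
line to the right, which fixes the whole column and makes the line run straight along the last row.
The remaining cells form a smaller rectangle of the same kind. -/
theorem colProd_corner (β : ℕ → ℂ) (a c M : ℕ) (g α : ℕ → ℂ) (h : α 0 = β (a + c)) :
    colProd β (a + c + 1) (M + 1) g α (firstEdges (c + 1) (a + c + 1)) (lastEdges a (a + c + 1)) =
      (∏ r ∈ Finset.range (c + 1), (g r - β r)) *
        (∏ r ∈ Finset.Ico (c + 1) (a + c + 1), (α 0 - g r)) *
        (∏ i ∈ Finset.range M, (g (i + (a + c) + 1) - β (a + c))) *
        colProd β (a + c) M (fun r => g (r + 1)) (fun i => α (i + 1)) (firstEdges c (a + c))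
          (lastEdges a (a + c)) := by
  have key : ∀ B : Fin (a + c + 1) → Bool,
      colMat β g (a + c + 1) (α 0) (firstEdges (c + 1) (a + c + 1)) B =
      if B = Fin.snoc (α := fun _ => Bool) (firstEdges c (a + c)) true then
        (∏ r ∈ Finset.range (c + 1), (g r - β r)) * ∏ r ∈ Finset.Ico (c + 1) (a + c + 1), (α 0 - g r)
      else 0 := by
    intro B
    rw [colMat, colSum, init_firstEdges, Fintype.sum_bool]
    simp only [eq_iff_init B, Fin.init_snoc, Fin.snoc_last]
    -- For `a = 0` the top left edge is already crossed, and the column is frozen without using the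
    -- hypothesis.
    rcases Nat.eq_zero_or_pos a with rfl | ha
    · have h1 : firstEdges (c + 1) (0 + c + 1) (Fin.last (0 + c)) = true := by simp [firstEdges]
      have h3 : firstEdges (c + 1) (0 + c) = firstEdges c (0 + c) := by
        funext r; have := r.2; simp [firstEdges]; omega
      rw [h1, colSum_first_false β g (α 0) (by omega), h3]
      simp only [zero_add, Finset.Ico_self, Finset.prod_empty, mul_one, Finset.prod_range_succ]
      cases B (Fin.last (0 + c)) <;> simp [cellWeight, mul_comm]
    · have h1 : firstEdges (c + 1) (a + c + 1) (Fin.last (a + c)) = false := by simp [firstEdges]; omega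
      rw [h1, colSum_first_true β g (α 0) (by omega) (by omega), Finset.prod_Ico_succ_top (by omega), h]
      cases B (Fin.last (a + c))
      · simp [cellWeight]
      · simp only [cellWeight, zero_mul, add_zero, and_true, mul_ite, mul_zero,
          Nat.add_sub_cancel]
        congr 1
        ring
  have hlast : lastEdges a (a + c + 1) = Fin.snoc (α := fun _ => Bool) (lastEdges a (a + c)) true := by
    rw [eq_iff_init, Fin.init_snoc, Fin.snoc_last]
    exact ⟨rfl, by simp [lastEdges]⟩
  rw [colProd, Matrix.mul_apply, Finset.sum_eq_single (Fin.snoc (α := fun _ => Bool) (firstEdges c (a + c)) true)]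
  · rw [key, if_pos rfl, hlast, colProd_snoc_true]
    ring
  · intro B _ hB
    rw [key, if_neg hB, zero_mul]
  · simp

end

/-! ### Products of column matrices as sums over configurations -/

section

theorem colSum_eq_sum (β g : ℕ → ℂ) (x : ℂ) (N : ℕ) (A B : Fin N → Bool) (t : Bool) :
    colSum β g x N A B t = ∑ V : Fin (N + 1) → Bool, if V 0 = false ∧ V (Fin.last N) = t then
      ∏ r : Fin N, cellWeight x (β r) (g r) (A r) (V r.castSucc) (B r) (V r.succ) else 0 := by
  induction N generalizing t with
  | zero =>
    rw [sum_snoc]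
    simp only [Finset.univ_unique, Finset.sum_singleton, Fintype.sum_bool]
    cases t <;> simp [colSum, Fin.snoc]
  | succ N ih =>
    rw [colSum, sum_snoc]
    simp only [Fin.snoc_last, Fintype.sum_bool]
    simp only [ih, Finset.mul_sum, ← Finset.sum_add_distrib]
    refine Finset.sum_congr rfl fun V _ => ?_
    have h0 : ∀ b, (Fin.snoc (α := fun _ => Bool) V b : Fin (N + 2) → Bool) 0 = V 0 := fun b =>
      Fin.snoc_castSucc (α := fun _ => Bool) (i := (0 : Fin (N + 1))) ..
    have h1 : ∀ (b : Bool) (r : Fin (N + 1)), (Fin.snoc (α := fun _ => Bool) V b : Fin (N + 2) → Bool) r.castSucc = V r :=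
      fun b r => Fin.snoc_castSucc (α := fun _ => Bool) ..
    have h2 : ∀ b, ∏ r : Fin (N + 1), cellWeight x (β r) (g r) (A r)
        ((Fin.snoc (α := fun _ => Bool) V b : Fin (N + 2) → Bool) r.castSucc) (B r)
        ((Fin.snoc (α := fun _ => Bool) V b : Fin (N + 2) → Bool) r.succ) =
        (∏ r : Fin N, cellWeight x (β r) (g r) (Fin.init A r) (V r.castSucc) (Fin.init B r) (V r.succ)) *
          cellWeight x (β N) (g N) (A (Fin.last N)) (V (Fin.last N)) (B (Fin.last N)) b := by
      intro b
      rw [Fin.prod_univ_castSucc]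
      simp only [h1, Fin.succ_last, Fin.snoc_last, Fin.succ_castSucc]
      rfl
    simp only [h0, h2]
    cases t <;> cases hV : V (Fin.last N) <;> by_cases hV0 : V 0 = false <;> simp [hV0, mul_comm]

theorem sum_cons {S : Type*} [Fintype S] {M : ℕ} (F : (Fin (M + 1) → S) → ℂ) :
    ∑ f, F f = ∑ s : S, ∑ f : Fin M → S, F (Fin.cons (α := fun _ => S) s f) := by
  rw [← (Fin.consEquiv fun _ => S).sum_comp, Fintype.sum_prod_type]
  rfl

theorem colProd_eq_sum (β : ℕ → ℂ) (N M : ℕ) (g α : ℕ → ℂ) (A C : Fin N → Bool) :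
    colProd β N M g α A C = ∑ H : Fin (M + 1) → Fin N → Bool, if H 0 = A ∧ H (Fin.last M) = C then
      ∏ i : Fin M, colMat β (fun r => g (r + i)) N (α i) (H i.castSucc) (H i.succ) else 0 := by
  classical
  induction M generalizing g α A with
  | zero =>
    rw [sum_cons]
    simp only [Finset.univ_unique, Finset.sum_singleton, colProd, Matrix.one_apply]
    simp only [Fin.cons_zero, Finset.univ_eq_empty, Finset.prod_empty]
    rw [Finset.sum_eq_single A]
    · simp
    · intro B _ hB; simp [hB]
    · simp
  | succ M ih =>
    rw [sum_cons, Finset.sum_eq_single A]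
    · rw [colProd, Matrix.mul_apply]
      simp only [ih, Finset.mul_sum]
      rw [Finset.sum_comm]
      refine Finset.sum_congr rfl fun H _ => ?_
      rw [Finset.sum_eq_single (H 0)]
      · simp only [Fin.cons_zero, true_and, Fin.prod_univ_succ, Fin.castSucc_zero, Fin.cons_succ,
          ← Fin.succ_last, ← Fin.succ_castSucc]
        split_ifs
        · simp [add_assoc]
        · simp
      · intro B _ hB
        rw [if_neg fun h => hB h.1.symm, mul_zero]
      · simp
    · intro B _ hB
      refine Finset.sum_eq_zero fun H _ => ?_
      rw [if_neg]
      rw [Fin.cons_zero]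
      exact fun h => hB h.1
    · simp

/-- The local constraint of the vertex model. -/
def CellOk (l b r t : Bool) : Prop := ¬ (l ∧ b) ∧ ¬ (r ∧ t) ∧ ((l ∨ b) ↔ (r ∨ t))

instance (l b r t : Bool) : Decidable (CellOk l b r t) := by unfold CellOk; infer_instance

/-- The weight of an allowed cell. -/
def cellVal (x y g : ℂ) (l b : Bool) : ℂ := bif l then g - y else bif b then x - g else x - y

theorem cellWeight_eq (x y g : ℂ) (l b r t : Bool) :
    cellWeight x y g l b r t = if CellOk l b r t then cellVal x y g l b else 0 := by
  cases l <;> cases b <;> cases r <;> cases t <;> simp [cellWeight, CellOk, cellVal]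

/-- The configurations of the vertex model on a rectangle with given left and right boundaries. -/
structure IsConfig {M N : ℕ} (A C : Fin N → Bool) (H : Fin (M + 1) → Fin N → Bool)
    (V : Fin M → Fin (N + 1) → Bool) : Prop where
  left : H 0 = A
  right : H (Fin.last M) = C
  bottom : ∀ i, V i 0 = false
  top : ∀ i, V i (Fin.last N) = false
  cell : ∀ i r, CellOk (H i.castSucc r) (V i r.castSucc) (H i.succ r) (V i r.succ)

open scoped Classical in
theorem colProd_eq_sum_config (β : ℕ → ℂ) (N M : ℕ) (g α : ℕ → ℂ) (A C : Fin N → Bool) :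
    colProd β N M g α A C =
      ∑ X : (Fin (M + 1) → Fin N → Bool) × (Fin M → Fin (N + 1) → Bool) with IsConfig A C X.1 X.2,
        ∏ p : Fin M × Fin N, cellVal (α p.1) (β p.2) (g (p.2 + p.1)) (X.1 p.1.castSucc p.2)
          (X.2 p.1 p.2.castSucc) := by
  rw [colProd_eq_sum, Finset.sum_filter, Fintype.sum_prod_type]
  refine Finset.sum_congr rfl fun H _ => ?_
  have h1 : ∏ i : Fin M, colMat β (fun r => g (r + i)) N (α i) (H i.castSucc) (H i.succ) =
      ∑ V : Fin M → Fin (N + 1) → Bool, ∏ i, if V i 0 = false ∧ V i (Fin.last N) = false then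
        ∏ r : Fin N, cellWeight (α i) (β r) (g (r + i)) (H i.castSucc r) (V i r.castSucc) (H i.succ r)
          (V i r.succ) else 0 := by
    simp only [colMat, colSum_eq_sum]
    rw [Finset.prod_univ_sum, Fintype.piFinset_univ]
  rw [h1]
  by_cases hH : H 0 = A ∧ H (Fin.last M) = C
  · rw [if_pos hH]
    refine Finset.sum_congr rfl fun V _ => ?_
    by_cases hc : IsConfig A C H V
    · rw [if_pos hc, Fintype.prod_prod_type]
      refine Finset.prod_congr rfl fun i _ => ?_
      rw [if_pos ⟨hc.bottom i, hc.top i⟩]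
      refine Finset.prod_congr rfl fun r _ => ?_
      rw [cellWeight_eq, if_pos (hc.cell i r)]
    · rw [if_neg hc]
      by_contra hne
      have h2 := fun i => Finset.prod_ne_zero_iff.1 hne i (Finset.mem_univ i)
      have h3 : ∀ i, V i 0 = false ∧ V i (Fin.last N) = false := fun i => by
        by_contra h
        exact h2 i (if_neg h)
      refine hc ⟨hH.1, hH.2, fun i => (h3 i).1, fun i => (h3 i).2, fun i r => ?_⟩
      have h4 := h2 i
      rw [if_pos (h3 i)] at h4
      have h5 := Finset.prod_ne_zero_iff.1 h4 r (Finset.mem_univ r)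
      rw [cellWeight_eq] at h5
      by_contra h
      exact h5 (if_neg h)
  · rw [if_neg hH]
    symm
    refine Finset.sum_eq_zero fun V _ => if_neg fun h => hH ⟨h.left, h.right⟩

end

/-! ### From lozenge tilings to configurations -/

section

open Lozenge

variable {a b c : ℕ}

theorem two_le_card_iff {σ : Type*} {s : Finset σ} (x y : σ) (h : ∀ t ∈ s, t = x ∨ t = y) (hxy : x ≠ y)
    (hx : x ∈ s) (hy : y ∈ s) : s.card = 2 := by
  classical
  refine Finset.card_eq_two.2 ⟨x, y, hxy, ?_⟩
  ext t
  constructor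
  · intro ht; simpa using h t ht
  · intro ht
    rcases (by simpa using ht : t = x ∨ t = y) with rfl | rfl <;> assumption

theorem card_cells_ab (i : Fin (b + c)) (j : Fin (a + c)) :
    (ab i j : Lozenge a b c).cells.card = 2 ↔ c ≤ i.val + j.val ∧ i.val + j.val + 1 < a + b + c := by
  constructor
  · intro h
    obtain ⟨t, u, htu, hs⟩ := Finset.card_eq_two.1 h
    have ht : t ∈ (ab i j : Lozenge a b c).cells := by rw [hs]; simp
    have hu : u ∈ (ab i j : Lozenge a b c).cells := by rw [hs]; simp
    obtain ⟨⟨t1, t2, t3⟩, ht'⟩ := t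
    obtain ⟨⟨u1, u2, u3⟩, hu'⟩ := u
    simp only [cells, Finset.mem_filter, Finset.mem_univ, true_and] at ht hu
    obtain ⟨rfl, rfl⟩ := ht
    obtain ⟨rfl, rfl⟩ := hu
    have : t3 ≠ u3 := by rintro rfl; exact htu rfl
    have : t3.val ≠ u3.val := fun h => this (Fin.ext h)
    have := t3.2
    have := u3.2
    simp only at ht' hu'
    omega
  · rintro ⟨h1, h2⟩
    refine two_le_card_iff ⟨(i, j, ⟨i + j - c, by omega⟩), .inl (by simp only; omega)⟩
      ⟨(i, j, ⟨i + j + 1 - c, by omega⟩), .inr (by simp only; omega)⟩ ?_ ?_ (by simp [cells]) (by simp [cells])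
    · rintro ⟨⟨t1, t2, t3⟩, ht'⟩ ht
      simp only [cells, Finset.mem_filter, Finset.mem_univ, true_and] at ht
      obtain ⟨rfl, rfl⟩ := ht
      simp only [Subtype.mk.injEq, Prod.mk.injEq, true_and, Fin.ext_iff]
      simp only at ht'
      omega
    · simp only [ne_eq, Subtype.mk.injEq, Prod.mk.injEq, true_and, Fin.ext_iff]
      omega

theorem card_cells_cb (k : Fin (a + b)) (j : Fin (a + c)) :
    (cb k j : Lozenge a b c).cells.card = 2 ↔ j.val < k.val + c ∧ k.val < b + j.val := by
  constructor
  · intro h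
    obtain ⟨t, u, htu, hs⟩ := Finset.card_eq_two.1 h
    have ht : t ∈ (cb k j : Lozenge a b c).cells := by rw [hs]; simp
    have hu : u ∈ (cb k j : Lozenge a b c).cells := by rw [hs]; simp
    obtain ⟨⟨t1, t2, t3⟩, ht'⟩ := t
    obtain ⟨⟨u1, u2, u3⟩, hu'⟩ := u
    simp only [cells, Finset.mem_filter, Finset.mem_univ, true_and] at ht hu
    obtain ⟨rfl, rfl⟩ := ht
    obtain ⟨rfl, rfl⟩ := hu
    have : t1 ≠ u1 := by rintro rfl; exact htu rfl
    have : t1.val ≠ u1.val := fun h => this (Fin.ext h)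
    have := t1.2
    have := u1.2
    simp only at ht' hu'
    omega
  · rintro ⟨h1, h2⟩
    refine two_le_card_iff ⟨(⟨k + c - j, by omega⟩, j, k), .inl (by simp only; omega)⟩
      ⟨(⟨k + c - j - 1, by omega⟩, j, k), .inr (by simp only; omega)⟩ ?_ ?_ (by simp [cells]) (by simp [cells])
    · rintro ⟨⟨t1, t2, t3⟩, ht'⟩ ht
      simp only [cells, Finset.mem_filter, Finset.mem_univ, true_and] at ht
      obtain ⟨rfl, rfl⟩ := ht
      simp only [Subtype.mk.injEq, Prod.mk.injEq, and_true, Fin.ext_iff]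
      simp only at ht'
      omega
    · simp only [ne_eq, Subtype.mk.injEq, Prod.mk.injEq, and_true, Fin.ext_iff]
      omega

theorem card_cells_ac (i : Fin (b + c)) (k : Fin (a + b)) :
    (ac i k : Lozenge a b c).cells.card = 2 ↔ i.val < k.val + c ∧ k.val < a + i.val := by
  constructor
  · intro h
    obtain ⟨t, u, htu, hs⟩ := Finset.card_eq_two.1 h
    have ht : t ∈ (ac i k : Lozenge a b c).cells := by rw [hs]; simp
    have hu : u ∈ (ac i k : Lozenge a b c).cells := by rw [hs]; simp
    obtain ⟨⟨t1, t2, t3⟩, ht'⟩ := t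
    obtain ⟨⟨u1, u2, u3⟩, hu'⟩ := u
    simp only [cells, Finset.mem_filter, Finset.mem_univ, true_and] at ht hu
    obtain ⟨rfl, rfl⟩ := ht
    obtain ⟨rfl, rfl⟩ := hu
    have : t2 ≠ u2 := by rintro rfl; exact htu rfl
    have : t2.val ≠ u2.val := fun h => this (Fin.ext h)
    have := t2.2
    have := u2.2
    simp only at ht' hu'
    omega
  · rintro ⟨h1, h2⟩
    refine two_le_card_iff ⟨(i, ⟨k + c - i, by omega⟩, k), .inl (by simp only; omega)⟩
      ⟨(i, ⟨k + c - i - 1, by omega⟩, k), .inr (by simp only; omega)⟩ ?_ ?_ (by simp [cells]) (by simp [cells])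
    · rintro ⟨⟨t1, t2, t3⟩, ht'⟩ ht
      simp only [cells, Finset.mem_filter, Finset.mem_univ, true_and] at ht
      obtain ⟨rfl, rfl⟩ := ht
      simp only [Subtype.mk.injEq, Prod.mk.injEq, true_and, and_true, Fin.ext_iff]
      simp only at ht'
      omega
    · simp only [ne_eq, Subtype.mk.injEq, Prod.mk.injEq, true_and, and_true, Fin.ext_iff]
      omega

/-- Exactly one of three propositions holds. -/
def OneOf (p q r : Prop) : Prop := (p ∨ q ∨ r) ∧ ¬ (p ∧ q) ∧ ¬ (p ∧ r) ∧ ¬ (q ∧ r)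

/-- The conditions on a tiling, lozenge by lozenge and triangle by triangle. -/
structure TilingConditions (T : Finset (Lozenge a b c)) : Prop where
  ab_mem : ∀ i j, ab i j ∈ T → c ≤ i.val + j.val ∧ i.val + j.val + 1 < a + b + c
  cb_mem : ∀ k j, cb k j ∈ T → j.val < k.val + c ∧ k.val < b + j.val
  ac_mem : ∀ i k, ac i k ∈ T → i.val < k.val + c ∧ k.val < a + i.val
  triangle : ∀ (i : Fin (b + c)) (j : Fin (a + c)) (k : Fin (a + b)),
    (k.val + c = i.val + j.val ∨ k.val + c = i.val + j.val + 1) →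
      OneOf (ab i j ∈ T) (cb k j ∈ T) (ac i k ∈ T)

theorem isTiling_iff (T : Finset (Lozenge a b c)) : IsTiling T ↔ TilingConditions T := by
  have hcell : ∀ (t : Triangle a b c) (L : Lozenge a b c), t ∈ L.cells ↔
      L = ab t.1.1 t.1.2.1 ∨ L = cb t.1.2.2 t.1.2.1 ∨ L = ac t.1.1 t.1.2.2 := by
    intro t L
    cases L <;> simp [cells, eq_comm]
  constructor
  · rintro ⟨h1, h2⟩
    refine ⟨fun i j h => (card_cells_ab i j).1 (h1 _ h), fun k j h => (card_cells_cb k j).1 (h1 _ h),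
      fun i k h => (card_cells_ac i k).1 (h1 _ h), fun i j k h => ?_⟩
    obtain ⟨L, ⟨hL, hL'⟩, hu⟩ := h2 ⟨(i, j, k), h⟩
    have u1 : ab i j ∈ T → ab i j = L := fun h' => hu _ ⟨h', by simp [hcell]⟩
    have u2 : cb k j ∈ T → cb k j = L := fun h' => hu _ ⟨h', by simp [hcell]⟩
    have u3 : ac i k ∈ T → ac i k = L := fun h' => hu _ ⟨h', by simp [hcell]⟩
    rw [hcell] at hL'
    refine ⟨?_, ?_, ?_, ?_⟩
    · rcases hL' with rfl | rfl | rfl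
      · exact .inl hL
      · exact .inr (.inl hL)
      · exact .inr (.inr hL)
    · rintro ⟨a1, a2⟩; exact nomatch (u1 a1).trans (u2 a2).symm
    · rintro ⟨a1, a2⟩; exact nomatch (u1 a1).trans (u3 a2).symm
    · rintro ⟨a1, a2⟩; exact nomatch (u2 a1).trans (u3 a2).symm
  · intro h
    refine ⟨?_, fun t => ?_⟩
    · rintro (⟨i, j⟩ | ⟨k, j⟩ | ⟨i, k⟩) hL
      · exact (card_cells_ab i j).2 (h.ab_mem _ _ hL)
      · exact (card_cells_cb k j).2 (h.cb_mem _ _ hL)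
      · exact (card_cells_ac i k).2 (h.ac_mem _ _ hL)
    · obtain ⟨h1, h2, h3, h4⟩ := h.triangle t.1.1 t.1.2.1 t.1.2.2 t.2
      rcases h1 with h1 | h1 | h1
      · refine ⟨_, ⟨h1, by simp [hcell]⟩, fun L hL => ?_⟩
        rcases (hcell t L).1 hL.2 with h' | h' | h'
        · exact h'
        · exact absurd ⟨h1, h' ▸ hL.1⟩ h2
        · exact absurd ⟨h1, h' ▸ hL.1⟩ h3
      · refine ⟨_, ⟨h1, by simp [hcell]⟩, fun L hL => ?_⟩
        rcases (hcell t L).1 hL.2 with h' | h' | h'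
        · exact absurd ⟨h' ▸ hL.1, h1⟩ h2
        · exact h'
        · exact absurd ⟨h1, h' ▸ hL.1⟩ h4
      · refine ⟨_, ⟨h1, by simp [hcell]⟩, fun L hL => ?_⟩
        rcases (hcell t L).1 hL.2 with h' | h' | h'
        · exact absurd ⟨h' ▸ hL.1, h1⟩ h3
        · exact absurd ⟨h' ▸ hL.1, h1⟩ h4
        · exact h'

/-- Cells of the rectangle, the lower triangle of which is outside the hexagon. -/
def Frozen (a b c s : ℕ) : Prop := s < c ∨ a + b + c ≤ s

open scoped Classical in
/-- The edges between horizontal neighbours crossed by a lozenge. -/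
def tilingH (T : Finset (Lozenge a b c)) (i : Fin (b + c + 1)) (r : Fin (a + c)) : Bool :=
  decide (Frozen a b c (i + r) ∨ ∃ k : Fin (a + b), k.val + c = i + r ∧ cb k r ∈ T)

open scoped Classical in
/-- The edges between vertical neighbours crossed by a lozenge. -/
def tilingV (T : Finset (Lozenge a b c)) (i : Fin (b + c)) (r : Fin (a + c + 1)) : Bool :=
  decide (∃ k : Fin (a + b), k.val + c = i + r ∧ ac i k ∈ T)

open scoped Classical in
/-- The tiling attached to a configuration of the vertex model. -/
def configTiling (H : Fin (b + c + 1) → Fin (a + c) → Bool) (V : Fin (b + c) → Fin (a + c + 1) → Bool) :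
    Finset (Lozenge a b c) := Finset.univ.filter fun L => match L with
  | .ab i j => H i.castSucc j = false ∧ V i j.castSucc = false
  | .cb k j => ∃ i : Fin (b + c), k.val + c = i + j ∧ 0 < i.val ∧ H i.castSucc j = true
  | .ac i k => ∃ r : Fin (a + c), k.val + c = i + r ∧ 0 < r.val ∧ V i r.castSucc = true

theorem tilingH_iff (T : Finset (Lozenge a b c)) (i : Fin (b + c + 1)) (r : Fin (a + c)) :
    tilingH T i r = true ↔ Frozen a b c (i + r) ∨ ∃ k : Fin (a + b), k.val + c = i + r ∧ cb k r ∈ T := by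
  simp [tilingH]

theorem tilingV_iff (T : Finset (Lozenge a b c)) (i : Fin (b + c)) (r : Fin (a + c + 1)) :
    tilingV T i r = true ↔ ∃ k : Fin (a + b), k.val + c = i + r ∧ ac i k ∈ T := by
  simp [tilingV]

theorem cellOk_of_oneOf {p : Prop} {l b r t : Bool} (h1 : OneOf p (l = true) (b = true))
    (h2 : OneOf p (r = true) (t = true)) : CellOk l b r t := by
  cases l <;> cases b <;> cases r <;> cases t <;> simp_all [OneOf, CellOk]

/-- In a cell of the hexagon this says that its lower triangle is covered exactly once. In a frozen
cell the left edge counts as crossed by convention. -/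
theorem TilingConditions.lower {T : Finset (Lozenge a b c)} (h : TilingConditions T) (i : Fin (b + c))
    (r : Fin (a + c)) : OneOf (ab i r ∈ T) (tilingH T i.castSucc r = true) (tilingV T i r.castSucc = true) := by
  rw [tilingH_iff, tilingV_iff, Fin.val_castSucc, Fin.val_castSucc]
  by_cases hf : Frozen a b c (i + r)
  · refine ⟨.inr (.inl (.inl hf)), fun h' => ?_, fun h' => ?_, fun h' => ?_⟩
    · have := h.ab_mem _ _ h'.1; rcases hf with hf | hf <;> omega
    · have := h.ab_mem _ _ h'.1; rcases hf with hf | hf <;> omega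
    · obtain ⟨-, k, hk, -⟩ := h'
      have := k.2
      rcases hf with hf | hf <;> omega
  · have hf' := hf
    simp only [Frozen, not_or, not_lt, not_le] at hf'
    have key := h.triangle i r ⟨i + r - c, by omega⟩ (.inl (by simp only; omega))
    have e1 : (∃ k : Fin (a + b), k.val + c = i + r ∧ cb k r ∈ T) ↔ cb ⟨i + r - c, by omega⟩ r ∈ T := by
      constructor
      · rintro ⟨k, hk, h'⟩
        convert h' using 3
        omega
      · exact fun h' => ⟨_, by simp only; omega, h'⟩
    have e2 : (∃ k : Fin (a + b), k.val + c = i + r ∧ ac i k ∈ T) ↔ ac i ⟨i + r - c, by omega⟩ ∈ T := by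
      constructor
      · rintro ⟨k, hk, h'⟩
        convert h' using 3
        omega
      · exact fun h' => ⟨_, by simp only; omega, h'⟩
    rw [e1, e2]
    simpa only [hf, false_or] using key

theorem TilingConditions.upper {T : Finset (Lozenge a b c)} (h : TilingConditions T) (i : Fin (b + c))
    (r : Fin (a + c)) : OneOf (ab i r ∈ T) (tilingH T i.succ r = true) (tilingV T i r.succ = true) := by
  rw [tilingH_iff, tilingV_iff, Fin.val_succ, Fin.val_succ]
  by_cases hf : Frozen a b c (i + 1 + r)
  · refine ⟨.inr (.inl (.inl hf)), fun h' => ?_, fun h' => ?_, fun h' => ?_⟩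
    · have := h.ab_mem _ _ h'.1; rcases hf with hf | hf <;> omega
    · have := h.ab_mem _ _ h'.1; rcases hf with hf | hf <;> omega
    · obtain ⟨-, k, hk, -⟩ := h'
      have := k.2
      rcases hf with hf | hf <;> omega
  · have hf' := hf
    simp only [Frozen, not_or, not_lt, not_le] at hf'
    have key := h.triangle i r ⟨i + 1 + r - c, by omega⟩ (.inr (by simp only; omega))
    have e1 : (∃ k : Fin (a + b), k.val + c = i + 1 + r ∧ cb k r ∈ T) ↔
        cb ⟨i + 1 + r - c, by omega⟩ r ∈ T := by
      constructor
      · rintro ⟨k, hk, h'⟩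
        convert h' using 3
        omega
      · exact fun h' => ⟨_, by simp only; omega, h'⟩
    have e2 : (∃ k : Fin (a + b), k.val + c = i + (r + 1) ∧ ac i k ∈ T) ↔
        ac i ⟨i + 1 + r - c, by omega⟩ ∈ T := by
      constructor
      · rintro ⟨k, hk, h'⟩
        convert h' using 3
        omega
      · exact fun h' => ⟨_, by simp only; omega, h'⟩
    rw [e1, e2]
    simpa only [hf, false_or] using key

theorem TilingConditions.isConfig {T : Finset (Lozenge a b c)} (h : TilingConditions T) :
    IsConfig (firstEdges c (a + c)) (lastEdges a (a + c)) (tilingH T) (tilingV T) := by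
  refine ⟨?_, ?_, ?_, ?_, ?_⟩
  · funext r
    have hr := r.2
    rw [Bool.eq_iff_iff, tilingH_iff]
    simp only [firstEdges, decide_eq_true_eq, Frozen, Fin.val_zero, zero_add]
    constructor
    · rintro ((h1 | h1) | ⟨k, hk, h1⟩)
      · exact h1
      · omega
      · have := h.cb_mem _ _ h1; omega
    · exact fun h => .inl (.inl h)
  · funext r
    have hr := r.2
    rw [Bool.eq_iff_iff, tilingH_iff]
    simp only [lastEdges, decide_eq_true_eq, Frozen, Fin.val_last]
    constructor
    · rintro ((h1 | h1) | ⟨k, hk, h1⟩)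
      · omega
      · omega
      · have := h.cb_mem _ _ h1; omega
    · exact fun h => .inl (.inr (by omega))
  · intro i
    rw [← Bool.not_eq_true, tilingV_iff, Fin.val_zero]
    rintro ⟨k, hk, h1⟩
    have := h.ac_mem _ _ h1
    omega
  · intro i
    rw [← Bool.not_eq_true, tilingV_iff, Fin.val_last]
    rintro ⟨k, hk, h1⟩
    have := h.ac_mem _ _ h1
    omega
  · intro i r
    exact cellOk_of_oneOf (h.lower i r) (h.upper i r)

end

/-! ### From configurations to lozenge tilings -/

section

open Lozenge

variable {a b c : ℕ}

namespace IsConfig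

variable {H : Fin (b + c + 1) → Fin (a + c) → Bool} {V : Fin (b + c) → Fin (a + c + 1) → Bool}

/-- The edge above in the same column is also crossed from the left, so its cell has an uncrossed
bottom. The line therefore cannot turn up and has to continue to the right. -/
theorem low (h : IsConfig (firstEdges c (a + c)) (lastEdges a (a + c)) H V) (m : ℕ) (hm : m < b + c + 1)
    (r : Fin (a + c)) (hr : m + r.val < c) : H ⟨m, hm⟩ r = true := by
  induction m generalizing r with
  | zero =>
    have := congrFun h.left r
    rw [show (⟨0, hm⟩ : Fin (b + c + 1)) = 0 from rfl, this]
    simp only [firstEdges, decide_eq_true_eq]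
    omega
  | succ m ih =>
    have h1 := h.cell ⟨m, by omega⟩ r
    have h2 := h.cell ⟨m, by omega⟩ ⟨r + 1, by omega⟩
    have e1 : H (Fin.castSucc ⟨m, by omega⟩) r = true := ih (by omega) r (by omega)
    have e2 : H (Fin.castSucc ⟨m, by omega⟩) ⟨r + 1, by omega⟩ = true :=
      ih (by omega) ⟨r + 1, by omega⟩ (by simp only; omega)
    have e3 : V ⟨m, by omega⟩ r.succ = false := by
      have : V ⟨m, by omega⟩ r.succ ≠ true := fun h' => h2.1 ⟨e2, h'⟩
      simpa using this
    have := h1.2.2.1 (.inl e1)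
    rw [e3] at this
    simpa using this

/-- The same argument backwards from the right boundary: the cell below is left through its right
edge, hence not through its top, so the line came from the left. -/
theorem high (h : IsConfig (firstEdges c (a + c)) (lastEdges a (a + c)) H V) (d m : ℕ) (hd : m + d = b + c)
    (r : Fin (a + c)) (hr : a + b + c ≤ m + r.val) : H ⟨m, by omega⟩ r = true := by
  induction d generalizing m r with
  | zero =>
    have := congrFun h.right r
    rw [show (⟨m, by omega⟩ : Fin (b + c + 1)) = Fin.last _ from Fin.ext hd, this]
    simp only [lastEdges, decide_eq_true_eq]
    omega
  | succ d ih =>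
    have h1 := h.cell ⟨m, by omega⟩ r
    have e1 : H (Fin.succ ⟨m, by omega⟩) r = true := ih (m + 1) (by omega) r (by omega)
    have e3 : V ⟨m, by omega⟩ r.castSucc ≠ true := by
      obtain ⟨r, hr2⟩ := r
      rcases r with _ | r
      · have := h.bottom ⟨m, by omega⟩
        rw [show Fin.castSucc (⟨0, hr2⟩ : Fin (a + c)) = 0 from rfl, this]
        simp
      · have h2 := h.cell ⟨m, by omega⟩ ⟨r, by omega⟩
        have e2 : H (Fin.succ ⟨m, by omega⟩) ⟨r, by omega⟩ = true :=
          ih (m + 1) (by omega) ⟨r, by omega⟩ (by simp only at *; omega)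
        exact fun h' => h2.2.1 ⟨e2, h'⟩
    have := h1.2.2.2 (.inl e1)
    exact this.resolve_right e3

theorem frozen (h : IsConfig (firstEdges c (a + c)) (lastEdges a (a + c)) H V) (i : Fin (b + c + 1))
    (r : Fin (a + c)) (hf : Frozen a b c (i + r)) : H i r = true := by
  rcases hf with hf | hf
  · exact h.low i i.2 r hf
  · exact h.high (b + c - i) i (by omega) r hf

end IsConfig

section mem

variable (H : Fin (b + c + 1) → Fin (a + c) → Bool) (V : Fin (b + c) → Fin (a + c + 1) → Bool)

theorem ab_mem_configTiling (i : Fin (b + c)) (j : Fin (a + c)) :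
    ab i j ∈ configTiling H V ↔ H i.castSucc j = false ∧ V i j.castSucc = false := by
  simp [configTiling]

theorem cb_mem_configTiling (k : Fin (a + b)) (j : Fin (a + c)) : cb k j ∈ configTiling H V ↔
    ∃ i : Fin (b + c), k.val + c = i + j ∧ 0 < i.val ∧ H i.castSucc j = true := by
  simp [configTiling]

theorem ac_mem_configTiling (i : Fin (b + c)) (k : Fin (a + b)) : ac i k ∈ configTiling H V ↔
    ∃ r : Fin (a + c), k.val + c = i + r ∧ 0 < r.val ∧ V i r.castSucc = true := by
  simp [configTiling]

end mem

theorem IsConfig.tilingConditions {H : Fin (b + c + 1) → Fin (a + c) → Bool}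
    {V : Fin (b + c) → Fin (a + c + 1) → Bool}
    (h : IsConfig (firstEdges c (a + c)) (lastEdges a (a + c)) H V) :
    TilingConditions (configTiling H V) := by
  refine ⟨?_, ?_, ?_, ?_⟩
  · intro i j hij
    rw [ab_mem_configTiling] at hij
    have h1 := h.cell i j
    have h2 : ¬ Frozen a b c (i + j) := fun hf => by
      have := h.frozen i.castSucc j hf
      rw [hij.1] at this
      exact absurd this (by simp)
    have h3 : ¬ Frozen a b c (i + 1 + j) := fun hf => by
      have e := h.frozen i.succ j (by rwa [Fin.val_succ])
      have := h1.2.2.2 (.inl e)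
      rw [hij.1, hij.2] at this
      simp at this
    simp only [Frozen, not_or] at h2 h3
    omega
  · intro k j hkj
    obtain ⟨i, h1, h2, -⟩ := (cb_mem_configTiling H V k j).1 hkj
    have := i.2
    omega
  · intro i k hik
    obtain ⟨r, h1, h2, -⟩ := (ac_mem_configTiling H V i k).1 hik
    have := r.2
    omega
  · intro i j k hk
    have hc := h.cell i j
    rcases hk with hk | hk
    · have e1 : cb k j ∈ configTiling H V ↔ H i.castSucc j = true := by
        rw [cb_mem_configTiling]
        constructor
        · rintro ⟨i', h1, -, h2⟩
          rwa [show i = i' from Fin.ext (by omega)]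
        · intro h1
          refine ⟨i, hk, Nat.pos_of_ne_zero fun h0 => ?_, h1⟩
          have h2 := congrFun h.left j
          rw [show (0 : Fin (b + c + 1)) = i.castSucc from Fin.ext h0.symm, h1] at h2
          have h3 := of_decide_eq_true h2.symm
          omega
      have e2 : ac i k ∈ configTiling H V ↔ V i j.castSucc = true := by
        rw [ac_mem_configTiling]
        constructor
        · rintro ⟨j', h1, -, h2⟩
          rwa [show j = j' from Fin.ext (by omega)]
        · intro h1
          refine ⟨j, hk, Nat.pos_of_ne_zero fun h0 => ?_, h1⟩
          have h2 := h.bottom i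
          rw [show (0 : Fin (a + c + 1)) = j.castSucc from Fin.ext h0.symm, h1] at h2
          exact absurd h2 (by simp)
      rw [ab_mem_configTiling, e1, e2]
      revert hc
      generalize H i.castSucc j = l
      generalize V i j.castSucc = m
      intro hc
      have := hc.1
      cases l <;> cases m <;> simp_all [OneOf]
    · have e1 : cb k j ∈ configTiling H V ↔ H i.succ j = true := by
        rw [cb_mem_configTiling]
        constructor
        · rintro ⟨i', h1, -, h2⟩
          rwa [show i.succ = i'.castSucc from Fin.ext (by simp only [Fin.val_succ, Fin.val_castSucc]; omega)]
        · intro h1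
          by_cases hi : i.val + 1 = b + c
          · exfalso
            have h2 := congrFun h.right j
            rw [show Fin.last (b + c) = i.succ from Fin.ext hi.symm, h1] at h2
            have h3 := of_decide_eq_true h2.symm
            have := k.2
            omega
          · exact ⟨⟨i + 1, by have := i.2; omega⟩, by simp only; omega, by simp only; omega, h1⟩
      have e2 : ac i k ∈ configTiling H V ↔ V i j.succ = true := by
        rw [ac_mem_configTiling]
        constructor
        · rintro ⟨j', h1, -, h2⟩
          rwa [show j.succ = j'.castSucc from Fin.ext (by simp only [Fin.val_succ, Fin.val_castSucc]; omega)]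
        · intro h1
          by_cases hj : j.val + 1 = a + c
          · exfalso
            have h2 := h.top i
            rw [show Fin.last (a + c) = j.succ from Fin.ext hj.symm, h1] at h2
            exact absurd h2 (by simp)
          · exact ⟨⟨j + 1, by have := j.2; omega⟩, by simp only; omega, by simp only; omega, h1⟩
      rw [ab_mem_configTiling, e1, e2]
      revert hc
      generalize H i.castSucc j = l
      generalize V i j.castSucc = m
      generalize H i.succ j = l'
      generalize V i j.succ = m'
      intro hc
      cases l <;> cases m <;> cases l' <;> cases m' <;> simp_all [OneOf, CellOk]

theorem TilingConditions.configTiling_eq {T : Finset (Lozenge a b c)} (h : TilingConditions T) :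
    configTiling (tilingH T) (tilingV T) = T := by
  ext L
  rcases L with ⟨i, j⟩ | ⟨k, j⟩ | ⟨i, k⟩
  · rw [ab_mem_configTiling]
    have := h.lower i j
    unfold OneOf at this
    rw [← Bool.not_eq_true, ← Bool.not_eq_true]
    tauto
  · rw [cb_mem_configTiling]
    constructor
    · rintro ⟨i, h1, h2, h3⟩
      rw [tilingH_iff, Fin.val_castSucc] at h3
      have hk := k.2
      rcases h3 with (h3 | h3) | ⟨k', h3, h4⟩
      · omega
      · omega
      · rwa [show k = k' from Fin.ext (by omega)]
    · intro h1
      have h2 := h.cb_mem _ _ h1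
      refine ⟨⟨k + c - j, by omega⟩, by simp only; omega, by simp only; omega, ?_⟩
      rw [tilingH_iff]
      exact .inr ⟨k, by simp only [Fin.val_castSucc]; omega, h1⟩
  · rw [ac_mem_configTiling]
    constructor
    · rintro ⟨r, h1, h2, h3⟩
      rw [tilingV_iff, Fin.val_castSucc] at h3
      obtain ⟨k', h3, h4⟩ := h3
      rwa [show k = k' from Fin.ext (by omega)]
    · intro h1
      have h2 := h.ac_mem _ _ h1
      refine ⟨⟨k + c - i, by omega⟩, by simp only; omega, by simp only; omega, ?_⟩
      rw [tilingV_iff]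
      exact ⟨k, by simp only [Fin.val_castSucc]; omega, h1⟩

theorem IsConfig.tilingH_configTiling {H : Fin (b + c + 1) → Fin (a + c) → Bool}
    {V : Fin (b + c) → Fin (a + c + 1) → Bool}
    (h : IsConfig (firstEdges c (a + c)) (lastEdges a (a + c)) H V) :
    tilingH (configTiling H V) = H := by
  funext i r
  rw [Bool.eq_iff_iff, tilingH_iff]
  constructor
  · rintro (h1 | ⟨k, h1, h2⟩)
    · exact h.frozen i r h1
    · obtain ⟨i', h3, -, h4⟩ := (cb_mem_configTiling H V k r).1 h2
      rwa [show i = i'.castSucc from Fin.ext (by simp only [Fin.val_castSucc]; omega)]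
  · intro h1
    by_cases hf : Frozen a b c (i + r)
    · exact .inl hf
    · right
      simp only [Frozen, not_or] at hf
      refine ⟨⟨i + r - c, by omega⟩, by simp only; omega, ?_⟩
      rw [cb_mem_configTiling]
      have hi0 : i.val ≠ 0 := fun h0 => by
        have h2 := congrFun h.left r
        rw [show (0 : Fin (b + c + 1)) = i from Fin.ext h0.symm, h1] at h2
        have h3 := of_decide_eq_true h2.symm
        omega
      have hil : i.val ≠ b + c := fun h0 => by
        have h2 := congrFun h.right r
        rw [show Fin.last (b + c) = i from Fin.ext h0.symm, h1] at h2
        have h3 := of_decide_eq_true h2.symm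
        omega
      have := i.2
      exact ⟨⟨i, by omega⟩, by simp only; omega, by simp only; omega, h1⟩

theorem IsConfig.tilingV_configTiling {H : Fin (b + c + 1) → Fin (a + c) → Bool}
    {V : Fin (b + c) → Fin (a + c + 1) → Bool}
    (h : IsConfig (firstEdges c (a + c)) (lastEdges a (a + c)) H V) :
    tilingV (configTiling H V) = V := by
  funext i r
  rw [Bool.eq_iff_iff, tilingV_iff]
  constructor
  · rintro ⟨k, h1, h2⟩
    obtain ⟨r', h3, -, h4⟩ := (ac_mem_configTiling H V i k).1 h2
    rwa [show r = r'.castSucc from Fin.ext (by simp only [Fin.val_castSucc]; omega)]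
  · intro h1
    have hr0 : r.val ≠ 0 := fun h0 => by
      have h2 := h.bottom i
      rw [show (0 : Fin (a + c + 1)) = r from Fin.ext h0.symm, h1] at h2
      exact absurd h2 (by simp)
    have hrl : r.val ≠ a + c := fun h0 => by
      have h2 := h.top i
      rw [show Fin.last (a + c) = r from Fin.ext h0.symm, h1] at h2
      exact absurd h2 (by simp)
    have hr := r.2
    have hf : ¬ Frozen a b c (i + r) := fun hf => by
      have h2 := h.frozen i.castSucc ⟨r, by omega⟩ hf
      exact (h.cell i ⟨r, by omega⟩).1 ⟨h2, h1⟩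
    simp only [Frozen, not_or] at hf
    refine ⟨⟨i + r - c, by omega⟩, by simp only; omega, ?_⟩
    rw [ac_mem_configTiling]
    exact ⟨⟨r, by omega⟩, by simp only; omega, by simp only; omega, h1⟩

end

/-! ### Comparison of the weights -/

section

open Lozenge
open MvPolynomial (eval degreeOf)

variable {a b c : ℕ}

open scoped Classical in
/-- The total weight of the cells outside the hexagon. -/
def frozenWeight (a b c : ℕ) (β g : ℕ → ℂ) : ℂ :=
  ∏ p : Fin (b + c) × Fin (a + c) with Frozen a b c (p.1 + p.2), (g (p.2 + p.1) - β p.2)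

/-- Each lozenge contains exactly one lower triangle, and its weight is charged to the cell of that
triangle. The frozen cells contribute `frozenWeight`. -/
theorem TilingConditions.prod_weight {T : Finset (Lozenge a b c)} (h : TilingConditions T)
    (ρ : Fin (b + c) ⊕ Fin (a + c) ⊕ Fin (a + b) → ℂ) {α β g : ℕ → ℂ}
    (hα : ∀ i : Fin (b + c), α i = ρ (.inl i)) (hβ : ∀ j : Fin (a + c), β j = ρ (.inr (.inl j)))
    (hg : ∀ k : Fin (a + b), g (k + c) = ρ (.inr (.inr k))) :
    frozenWeight a b c β g * eval ρ (∏ L ∈ T, L.weight) =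
      ∏ p : Fin (b + c) × Fin (a + c), cellVal (α p.1) (β p.2) (g (p.2 + p.1))
        (tilingH T p.1.castSucc p.2) (tilingV T p.1 p.2.castSucc) := by
  classical
  rw [← Finset.prod_filter_mul_prod_filter_not Finset.univ
    (fun p : Fin (b + c) × Fin (a + c) => Frozen a b c (p.1 + p.2)), frozenWeight, map_prod]
  congr 1
  · refine Finset.prod_congr rfl fun p hp => ?_
    have h1 : tilingH T p.1.castSucc p.2 = true := by
      rw [tilingH_iff]
      exact .inl (Finset.mem_filter.1 hp).2
    rw [h1, cellVal, cond_true]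
  · have hk : ∀ p : Fin (b + c) × Fin (a + c), p ∈ Finset.univ.filter (fun p : Fin (b + c) × Fin (a + c) =>
        ¬ Frozen a b c (p.1 + p.2)) → c ≤ p.1.val + p.2.val ∧ p.1.val + p.2.val - c < a + b := by
      intro p hp
      have := (Finset.mem_filter.1 hp).2
      simp only [Frozen, not_or] at this
      omega
    symm
    refine Finset.prod_bij (fun p hp => if ab p.1 p.2 ∈ T then ab p.1 p.2 else
      if cb ⟨p.1 + p.2 - c, (hk p hp).2⟩ p.2 ∈ T then cb ⟨p.1 + p.2 - c, (hk p hp).2⟩ p.2 else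
        ac p.1 ⟨p.1 + p.2 - c, (hk p hp).2⟩) ?_ ?_ ?_ ?_
    · intro p hp
      have h1 := hk p hp
      have h2 := (h.triangle p.1 p.2 ⟨p.1 + p.2 - c, (hk p hp).2⟩ (.inl (by simp only; omega))).1
      split_ifs with c1 c2
      · exact c1
      · exact c2
      · exact (h2.resolve_left c1).resolve_left c2
    · rintro ⟨i, j⟩ hp ⟨i', j'⟩ hp' heq
      have h1 := hk _ hp
      have h2 := hk _ hp'
      simp only at heq h1 h2
      split_ifs at heq <;> simp only [ab.injEq, cb.injEq, ac.injEq, Fin.ext_iff] at heq <;>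
        refine Prod.ext (Fin.ext ?_) (Fin.ext ?_) <;> simp only <;> omega
    · rintro (⟨i, j⟩ | ⟨k, j⟩ | ⟨i, k⟩) hL
      · have h1 := h.ab_mem _ _ hL
        refine ⟨(i, j), ?_, ?_⟩
        · simp only [Finset.mem_filter, Finset.mem_univ, true_and, Frozen, not_or, not_lt, not_le]; omega
        · simp only [hL, if_true]
      · have h1 := h.cb_mem _ _ hL
        have hk2 := k.2
        have e : (⟨k.val + c - j.val + j.val - c, by omega⟩ : Fin (a + b)) = k := Fin.ext (by simp only; omega)
        refine ⟨(⟨k + c - j, by omega⟩, j), ?_, ?_⟩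
        · simp only [Finset.mem_filter, Finset.mem_univ, true_and, Frozen, not_or, not_lt, not_le]; omega
        · have h3 := h.triangle ⟨k + c - j, by omega⟩ j k (.inl (by simp only; omega))
          simp only [e, hL, if_true]
          rw [if_neg fun h' => h3.2.1 ⟨h', hL⟩]
      · have h1 := h.ac_mem _ _ hL
        have hk2 := k.2
        have e : (⟨i.val + (k.val + c - i.val) - c, by omega⟩ : Fin (a + b)) = k := Fin.ext (by simp only; omega)
        refine ⟨(i, ⟨k + c - i, by omega⟩), ?_, ?_⟩
        · simp only [Finset.mem_filter, Finset.mem_univ, true_and, Frozen, not_or, not_lt, not_le]; omega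
        · have h3 := h.triangle i ⟨k + c - i, by omega⟩ k (.inl (by simp only; omega))
          simp only [e]
          rw [if_neg fun h' => h3.2.2.1 ⟨h', hL⟩, if_neg fun h' => h3.2.2.2 ⟨h', hL⟩]
    · rintro ⟨i, j⟩ hp
      have h1 := hk _ hp
      simp only at h1
      have hgk := hg ⟨i + j - c, h1.2⟩
      simp only at hgk
      rw [show i.val + j.val - c + c = j.val + i.val by omega] at hgk
      have hlow := h.lower i j
      have hfz := (Finset.mem_filter.1 hp).2
      have hH := tilingH_iff T i.castSucc j
      have e1 : tilingH T i.castSucc j = true ↔ cb ⟨i + j - c, h1.2⟩ j ∈ T := by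
        rw [tilingH_iff, Fin.val_castSucc]
        constructor
        · rintro (h' | ⟨k, hk1, h'⟩)
          · exact absurd h' hfz
          · rwa [show (⟨i + j - c, h1.2⟩ : Fin (a + b)) = k from Fin.ext (by simp only; omega)]
        · exact fun h' => .inr ⟨_, by simp only; omega, h'⟩
      dsimp only
      rw [hα, hβ, hgk]
      unfold cellVal
      rcases hlow.1 with h2 | h2 | h2
      · have h3 : tilingH T i.castSucc j = false := by
          rw [← Bool.not_eq_true]; exact fun h' => hlow.2.1 ⟨h2, h'⟩
        have h4 : tilingV T i j.castSucc = false := by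
          rw [← Bool.not_eq_true]; exact fun h' => hlow.2.2.1 ⟨h2, h'⟩
        rw [if_pos h2, h3, h4]
        simp [weight, LoopModel.α, LoopModel.β]
      · rw [if_neg fun h' => hlow.2.1 ⟨h', h2⟩, if_pos (e1.1 h2), h2]
        simp [weight, LoopModel.γ, LoopModel.β]
      · have h3 : tilingH T i.castSucc j = false := by
          rw [← Bool.not_eq_true]; exact fun h' => hlow.2.2.2 ⟨h', h2⟩
        rw [if_neg fun h' => hlow.2.2.1 ⟨h', h2⟩, if_neg fun h' => hlow.2.2.2 ⟨e1.2 h', h2⟩, h3, h2]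
        simp [weight, LoopModel.γ, LoopModel.α]

theorem frozenWeight_mul_partitionFunction (ρ : Fin (b + c) ⊕ Fin (a + c) ⊕ Fin (a + b) → ℂ)
    {α β g : ℕ → ℂ} (hα : ∀ i : Fin (b + c), α i = ρ (.inl i))
    (hβ : ∀ j : Fin (a + c), β j = ρ (.inr (.inl j)))
    (hg : ∀ k : Fin (a + b), g (k + c) = ρ (.inr (.inr k))) :
    frozenWeight a b c β g * eval ρ (partitionFunction a b c) =
      colProd β (a + c) (b + c) g α (firstEdges c (a + c)) (lastEdges a (a + c)) := by
  classical
  rw [partitionFunction, map_sum, Finset.mul_sum, colProd_eq_sum_config]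
  refine Finset.sum_bij' (fun T _ => (tilingH T, tilingV T)) (fun X _ => configTiling X.1 X.2) ?_ ?_ ?_ ?_ ?_
  · intro T hT
    rw [Finset.mem_filter, isTiling_iff] at hT
    rw [Finset.mem_filter]
    exact ⟨Finset.mem_univ _, hT.2.isConfig⟩
  · intro X hX
    rw [Finset.mem_filter] at hX
    rw [Finset.mem_filter, isTiling_iff]
    exact ⟨Finset.mem_univ _, hX.2.tilingConditions⟩
  · intro T hT
    rw [Finset.mem_filter, isTiling_iff] at hT
    exact hT.2.configTiling_eq
  · intro X hX
    rw [Finset.mem_filter] at hX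
    exact Prod.ext hX.2.tilingH_configTiling hX.2.tilingV_configTiling
  · intro T hT
    rw [Finset.mem_filter, isTiling_iff] at hT
    exact hT.2.prod_weight ρ hα hβ hg

end

/-! ### Symmetry, recursion and degree of the partition function -/

section

open Lozenge
open MvPolynomial (eval degreeOf)

variable {a b c : ℕ}

/-- The point with given values of the parameters. -/
def params (a b c : ℕ) (A B G : ℕ → ℂ) : Fin (b + c) ⊕ Fin (a + c) ⊕ Fin (a + b) → ℂ :=
  Sum.elim (fun i => A i) (Sum.elim (fun j => B j) fun k => G k)

/-- The values of the partition function. -/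
def pf (a b c : ℕ) (A B G : ℕ → ℂ) : ℂ := eval (params a b c A B G) (partitionFunction a b c)

/-- The parameters of the diagonals of the rectangle. -/
def diagParam (a b c : ℕ) (G : ℕ → ℂ) (x : ℂ) (s : ℕ) : ℂ :=
  if s < c then x else if s < a + b + c then G (s - c) else x

theorem frozenWeight_eq (β g : ℕ → ℂ) : frozenWeight a b c β g =
    ∏ i ∈ Finset.range (b + c), ∏ r ∈ Finset.range (a + c),
      if i + r < c ∨ a + b + c ≤ i + r then g (r + i) - β r else 1 := by
  classical
  rw [frozenWeight, Finset.prod_filter, Fintype.prod_prod_type,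
    ← Fin.prod_univ_eq_prod_range (fun i => ∏ r ∈ Finset.range (a + c),
      if i + r < c ∨ a + b + c ≤ i + r then g (r + i) - β r else 1)]
  refine Finset.prod_congr rfl fun i _ => ?_
  rw [← Fin.prod_univ_eq_prod_range (fun r =>
      if i.val + r < c ∨ a + b + c ≤ i.val + r then g (r + i) - β r else 1)]
  refine Finset.prod_congr rfl fun r _ => ?_
  simp only [Frozen]
  congr

theorem pf_eq (A B G : ℕ → ℂ) (x : ℂ) : frozenWeight a b c B (diagParam a b c G x) * pf a b c A B G =
    colProd B (a + c) (b + c) (diagParam a b c G x) A (firstEdges c (a + c)) (lastEdges a (a + c)) := by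
  refine frozenWeight_mul_partitionFunction _ (fun i => rfl) (fun j => rfl) fun k => ?_
  have := k.2
  rw [diagParam, if_neg (by omega), if_pos (by omega), Nat.add_sub_cancel]
  rfl

/-- Diagonals outside the hexagon carry no $\gamma$, so their parameter is free. Avoiding the values
of $\beta$ allows the frozen factor to be cancelled. -/
theorem exists_frozenWeight_ne_zero (a b c : ℕ) (B G : ℕ → ℂ) :
    ∃ x, (∀ r < a + c, x ≠ B r) ∧ frozenWeight a b c B (diagParam a b c G x) ≠ 0 := by
  obtain ⟨x, hx⟩ := exists_avoid fun r : Fin (a + c) => B r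
  have hx' : ∀ r < a + c, x ≠ B r := fun r hr h => hx ⟨r, hr⟩ h.symm
  refine ⟨x, hx', ?_⟩
  rw [frozenWeight_eq]
  refine Finset.prod_ne_zero_iff.2 fun i _ => Finset.prod_ne_zero_iff.2 fun r hr => ?_
  rw [Finset.mem_range] at hr
  split_ifs with h
  · have : diagParam a b c G x (r + i) = x := by
      rw [diagParam]
      split_ifs <;> first | rfl | omega
    rw [this]
    exact sub_ne_zero.2 (hx' r hr)
  · exact one_ne_zero

theorem pf_swap (A B G : ℕ → ℂ) {i : ℕ} (hi : i + 1 < b + c) :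
    pf a b c (fun j => A (Equiv.swap i (i + 1) j)) B G = pf a b c A B G := by
  obtain ⟨x, -, hx⟩ := exists_frozenWeight_ne_zero a b c B G
  refine mul_left_cancel₀ hx ?_
  rw [pf_eq, pf_eq, colProd_swap _ _ _ _ _ hi]

/-- With `c = 0` no line enters the rectangle, and only one tiling exists. -/
theorem pf_zero (a b : ℕ) (A B G : ℕ → ℂ) :
    pf a b 0 A B G = ∏ i ∈ Finset.range b, ∏ j ∈ Finset.range a, (A i - B j) := by
  obtain ⟨x, -, hx⟩ := exists_frozenWeight_ne_zero a b 0 B G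
  have h1 := pf_eq (a := a) (b := b) (c := 0) A B G x
  have h2 : frozenWeight a b 0 B (diagParam a b 0 G x) = 1 := by
    rw [frozenWeight_eq]
    refine Finset.prod_eq_one fun i hi => Finset.prod_eq_one fun r hr => ?_
    rw [Finset.mem_range] at hi hr
    rw [if_neg (by omega)]
  have h3 : firstEdges 0 (a + 0) = fun _ => false := by funext r; simp [firstEdges]
  have h4 : lastEdges a (a + 0) = fun _ => false := by
    funext r
    have := r.2
    simp only [lastEdges, decide_eq_false_iff_not]
    omega
  rw [h2, one_mul, h3, h4, colProd_empty] at h1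
  exact h1

theorem frozenWeight_succ (B G : ℕ → ℂ) (x : ℂ) :
    frozenWeight a b (c + 1) B (diagParam a b (c + 1) G x) =
      (∏ r ∈ Finset.range (c + 1), (diagParam a b (c + 1) G x r - B r)) *
        (∏ i ∈ Finset.range c, (diagParam a b (c + 1) G x (b + i + (a + c) + 1) - B (a + c))) *
        frozenWeight a b c B (diagParam a b c G x) := by
  rw [frozenWeight_eq, frozenWeight_eq, ← add_assoc b c 1, ← add_assoc a c 1, Finset.prod_range_succ']
  have h1 : ∏ r ∈ Finset.range (a + c + 1), (if 0 + r < c + 1 ∨ a + b + (c + 1) ≤ 0 + r then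
      diagParam a b (c + 1) G x (r + 0) - B r else 1) =
      ∏ r ∈ Finset.range (c + 1), (diagParam a b (c + 1) G x r - B r) := by
    rw [← Finset.prod_subset (Finset.range_mono (show c + 1 ≤ a + c + 1 by omega))]
    · refine Finset.prod_congr rfl fun r hr => ?_
      rw [Finset.mem_range] at hr
      rw [if_pos (by omega), add_zero]
    · intro r hr hr'
      rw [Finset.mem_range] at hr hr'
      rw [if_neg (by omega)]
  have h2 : ∀ i ∈ Finset.range (b + c), ∏ r ∈ Finset.range (a + c + 1),
      (if i + 1 + r < c + 1 ∨ a + b + (c + 1) ≤ i + 1 + r then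
        diagParam a b (c + 1) G x (r + (i + 1)) - B r else 1) =
      (∏ r ∈ Finset.range (a + c), if i + r < c ∨ a + b + c ≤ i + r then
        diagParam a b c G x (r + i) - B r else 1) *
      (if b ≤ i then diagParam a b (c + 1) G x (i + (a + c) + 1) - B (a + c) else 1) := by
    intro i hi
    rw [Finset.prod_range_succ]
    congr 1
    · refine Finset.prod_congr rfl fun r hr => ?_
      refine if_congr (by omega) ?_ rfl
      congr 1
      unfold diagParam
      rw [← add_assoc, Nat.add_sub_add_right]
      refine if_congr (by omega) rfl (if_congr (by omega) rfl rfl)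
    · refine if_congr (by omega) ?_ rfl
      congr 2
      omega
  rw [h1, Finset.prod_congr rfl h2, Finset.prod_mul_distrib]
  have h3 : ∏ i ∈ Finset.range (b + c), (if b ≤ i then
      diagParam a b (c + 1) G x (i + (a + c) + 1) - B (a + c) else 1) =
      ∏ i ∈ Finset.range c, (diagParam a b (c + 1) G x (b + i + (a + c) + 1) - B (a + c)) := by
    rw [Finset.prod_range_add, Finset.prod_eq_one, one_mul]
    · refine Finset.prod_congr rfl fun i _ => ?_
      rw [if_pos (by omega)]
    · intro i hi
      rw [Finset.mem_range] at hi
      rw [if_neg (by omega)]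
  rw [h3]
  ring

/-- `colProd_corner` with the frozen factors of both sizes cancelled. The sign comes from the `b`
cells of the last row that lie in the hexagon, where $\gamma_k-\beta$ is rewritten as
$-(\alpha_1-\gamma_k)$. -/
theorem pf_corner (a b c : ℕ) (A B G : ℕ → ℂ) (h : A 0 = B (a + c)) :
    pf a b (c + 1) A B G = (-1) ^ b * (∏ k ∈ Finset.range (a + b), (A 0 - G k)) *
      pf a b c (fun i => A (i + 1)) B G := by
  obtain ⟨x, -, hx⟩ := exists_frozenWeight_ne_zero a b (c + 1) B G
  refine mul_left_cancel₀ hx ?_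
  rw [pf_eq]
  have h1 := colProd_corner B a c (b + c) (diagParam a b (c + 1) G x) A h
  have h2 : (fun r => diagParam a b (c + 1) G x (r + 1)) = diagParam a b c G x := by
    funext r
    unfold diagParam
    rw [Nat.add_sub_add_right]
    refine if_congr (by omega) rfl (if_congr (by omega) rfl rfl)
  rw [h2, ← pf_eq] at h1
  refine h1.trans ?_
  rw [frozenWeight_succ]
  have h3 : ∏ r ∈ Finset.Ico (c + 1) (a + c + 1), (A 0 - diagParam a b (c + 1) G x r) =
      ∏ k ∈ Finset.range a, (A 0 - G k) := by
    rw [Finset.prod_Ico_eq_prod_range, show a + c + 1 - (c + 1) = a by omega]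
    refine Finset.prod_congr rfl fun k hk => ?_
    rw [Finset.mem_range] at hk
    rw [diagParam, if_neg (by omega), if_pos (by omega), Nat.add_sub_cancel_left]
  have h4 : ∏ i ∈ Finset.range b, (diagParam a b (c + 1) G x (i + (a + c) + 1) - B (a + c)) =
      (-1) ^ b * ∏ k ∈ Finset.range b, (A 0 - G (a + k)) := by
    rw [← Finset.card_range b, ← Finset.prod_const, Finset.card_range, ← Finset.prod_mul_distrib]
    refine Finset.prod_congr rfl fun k hk => ?_
    rw [Finset.mem_range] at hk
    rw [diagParam, if_neg (by omega), if_pos (by omega), show k + (a + c) + 1 - (c + 1) = a + k by omega, h]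
    ring
  have h5 := Finset.prod_range_add
    (fun i => diagParam a b (c + 1) G x (i + (a + c) + 1) - B (a + c)) b c
  rw [h3, h5, h4, Finset.prod_range_add (fun k => A 0 - G k) a b]
  ring

/-- At most `b` lozenges of a tiling lie in the last $\beta$ strip: they are injected into `range b`
by their position along the strip. -/
theorem degreeOf_partitionFunction_le (j : Fin (a + c)) (hj : j.val + 1 = a + c) :
    degreeOf (.inr (.inl j)) (partitionFunction a b c) ≤ b := by
  classical
  have hX : ∀ l : Fin (b + c) ⊕ Fin (a + c) ⊕ Fin (a + b),
      degreeOf (.inr (.inl j)) (MvPolynomial.X l : ParamPoly a b c) = if Sum.inr (Sum.inl j) = l then 1 else 0 :=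
    fun l => MvPolynomial.degreeOf_X _ _
  rw [partitionFunction]
  refine (MvPolynomial.degreeOf_sum_le _ _ _).trans (Finset.sup_le fun T hT => ?_)
  rw [Finset.mem_filter, isTiling_iff] at hT
  have h := hT.2
  refine (MvPolynomial.degreeOf_prod_le _ _ _).trans ?_
  set touches : Lozenge a b c → Prop := fun L => (∃ i, L = ab i j) ∨ ∃ k, L = cb k j with ht
  have h1 : ∀ L : Lozenge a b c, degreeOf (.inr (.inl j)) L.weight ≤ if touches L then 1 else 0 := by
    intro L
    have hsub : ∀ u v : Fin (b + c) ⊕ Fin (a + c) ⊕ Fin (a + b),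
        degreeOf (.inr (.inl j)) (MvPolynomial.X u - MvPolynomial.X v : ParamPoly a b c) ≤
        max (if Sum.inr (Sum.inl j) = u then 1 else 0) (if Sum.inr (Sum.inl j) = v then 1 else 0) := by
      intro u v
      have := MvPolynomial.degreeOf_sub_le (.inr (.inl j)) (MvPolynomial.X u : ParamPoly a b c) (MvPolynomial.X v)
      rwa [hX, hX] at this
    rcases L with ⟨i, j'⟩ | ⟨k, j'⟩ | ⟨i, k⟩
    · refine (hsub _ _).trans ?_
      by_cases hjj : j = j'
      · subst hjj; simp [ht]
      · simp [hjj]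
    · refine (hsub _ _).trans ?_
      by_cases hjj : j = j'
      · subst hjj; simp [ht]
      · simp [hjj]
    · refine (hsub _ _).trans ?_
      simp
  refine (Finset.sum_le_sum fun L _ => h1 L).trans ?_
  rw [← Finset.sum_filter, Finset.sum_const, smul_eq_mul, mul_one]
  refine (Finset.card_le_card_of_injOn (t := Finset.range b) (fun L => match L with
    | .ab i _ => i.val
    | .cb k _ => k.val - a
    | .ac _ _ => 0) ?_ ?_).trans_eq (Finset.card_range b)
  · intro L hL
    rw [Finset.mem_coe, Finset.mem_filter] at hL
    obtain ⟨hL, ⟨i, rfl⟩ | ⟨k, rfl⟩⟩ := hL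
    · have := h.ab_mem _ _ hL
      simp only [Finset.coe_range, Set.mem_Iio]; omega
    · have := h.cb_mem _ _ hL
      have := k.2
      simp only [Finset.coe_range, Set.mem_Iio]; omega
  · intro L hL L' hL' heq
    rw [Finset.mem_coe, Finset.mem_filter] at hL hL'
    -- Two lozenges of different types with the same label would cover the same upper triangle.
    have excl : ∀ i k, ab i j ∈ T → cb k j ∈ T → i.val ≠ k.val - a := by
      intro i k hi hk hik
      have h2 := h.cb_mem _ _ hk
      exact (h.triangle i j k (.inr (by omega))).2.1 ⟨hi, hk⟩
    obtain ⟨hL, ⟨i, rfl⟩ | ⟨k, rfl⟩⟩ := hL <;> obtain ⟨hL', ⟨i', rfl⟩ | ⟨k', rfl⟩⟩ := hL'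
    · rw [show i = i' from Fin.ext heq]
    · exact absurd heq (excl _ _ hL hL')
    · exact absurd heq.symm (excl _ _ hL' hL)
    · have h2 := h.cb_mem _ _ hL
      have h3 := h.cb_mem _ _ hL'
      simp only at heq
      rw [show k = k' from Fin.ext (by omega)]

end

/-! ### Exchange relation and recursion for a single component -/

section

open MvPolynomial (eval degreeOf)

variable {n : ℕ}

/-- `∏_{i<j} (q x_i - q⁻¹ x_j)`. -/
def qvand (m : ℕ) (x : ℕ → ℂ) : ℂ :=
  ∏ j ∈ Finset.range m, ∏ i ∈ Finset.range j, (q * x i - q⁻¹ * x j)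

theorem qvand_succ (m : ℕ) (x : ℕ → ℂ) :
    qvand (m + 1) x = qvand m x * ∏ i ∈ Finset.range m, (q * x i - q⁻¹ * x m) :=
  Finset.prod_range_succ _ _

theorem qvand_congr {m : ℕ} {x y : ℕ → ℂ} (h : ∀ i < m, x i = y i) : qvand m x = qvand m y := by
  refine Finset.prod_congr rfl fun j hj => Finset.prod_congr rfl fun i hi => ?_
  rw [Finset.mem_range] at hi hj
  rw [h i (by omega), h j hj]

theorem qvand_succ' (m : ℕ) (x : ℕ → ℂ) : qvand (m + 1) x =
    (∏ i ∈ Finset.range m, (q * x 0 - q⁻¹ * x (i + 1))) * qvand m fun i => x (i + 1) := by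
  rw [qvand, Finset.prod_range_succ', Finset.prod_range_zero, mul_one, qvand, ← Finset.prod_mul_distrib]
  refine Finset.prod_congr rfl fun j _ => ?_
  rw [Finset.prod_range_succ', mul_comm]

theorem qvand_add (m l : ℕ) (x : ℕ → ℂ) : qvand (m + l) x = qvand m x * (qvand l fun i => x (m + i)) *
    ∏ j ∈ Finset.range l, ∏ i ∈ Finset.range m, (q * x i - q⁻¹ * x (m + j)) := by
  induction l with
  | zero => simp [qvand]
  | succ l ih =>
    rw [← add_assoc, qvand_succ, ih, qvand_succ, Finset.prod_range_succ, Finset.prod_range_add]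
    ring

theorem qvand_smul (m : ℕ) (s : ℂ) (x : ℕ → ℂ) :
    (qvand m fun i => s * x i) = s ^ (m * (m - 1) / 2) * qvand m x := by
  rw [← Finset.sum_range_id, ← Finset.prod_pow_eq_pow_sum, qvand, qvand, ← Finset.prod_mul_distrib]
  refine Finset.prod_congr rfl fun j _ => ?_
  have h : s ^ j = ∏ _i ∈ Finset.range j, s := by rw [Finset.prod_const, Finset.card_range]
  rw [h, ← Finset.prod_mul_distrib]
  exact Finset.prod_congr rfl fun i _ => by ring

theorem qvand_swap {m i : ℕ} (hi : i + 1 < m) (x : ℕ → ℂ) :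
    (q * x i - q⁻¹ * x (i + 1)) * qvand m (fun j => x (Equiv.swap i (i + 1) j)) =
      (q * x (i + 1) - q⁻¹ * x i) * qvand m x := by
  obtain ⟨l, rfl⟩ := Nat.exists_eq_add_of_lt hi
  have hlt : ∀ j, j < i → Equiv.swap i (i + 1) j = j := fun j hj =>
    Equiv.swap_apply_of_ne_of_ne (by omega) (by omega)
  have hgt : ∀ j, i + 1 < j → Equiv.swap i (i + 1) j = j := fun j hj =>
    Equiv.swap_apply_of_ne_of_ne (by omega) (by omega)
  have hprod : ∀ u, ∏ j ∈ Finset.range i, (q * x (Equiv.swap i (i + 1) j) - q⁻¹ * u) =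
      ∏ j ∈ Finset.range i, (q * x j - q⁻¹ * u) := fun u =>
    Finset.prod_congr rfl fun j hj => by rw [hlt j (Finset.mem_range.1 hj)]
  clear hi
  induction l with
  | zero =>
    rw [qvand_succ, qvand_succ, qvand_succ _ x, qvand_succ _ x, Finset.prod_range_succ,
      Finset.prod_range_succ, Equiv.swap_apply_left, Equiv.swap_apply_right,
      qvand_congr (y := x) fun j hj => by rw [hlt j hj], hprod, hprod]
    ring
  | succ l ih =>
    have h := Equiv.Perm.prod_comp (Equiv.swap i (i + 1)) (Finset.range (i + 1 + (l + 1)))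
      (fun j => q * x j - q⁻¹ * x (i + 1 + (l + 1))) (by
        intro j hj
        rw [Finset.mem_coe, Finset.mem_range]
        by_contra hlt
        exact hj (hgt j (by omega)))
    rw [qvand_succ, qvand_succ _ x, hgt (i + 1 + (l + 1)) (by omega), h, ← mul_assoc]
    have ih' := ih
    rw [add_assoc (i + 1) l 1] at ih'
    rw [ih']
    ring

/-- The components of the ground state at the first terms of a sequence. -/
def seqGs (n : ℕ) (w : ℕ → ℂ) (π : LinkPattern n) : ℂ := gs (fun p => w p) π

/-- A pattern without the little arch at `k` is not in the image of the generator, so the exchange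
relation becomes scalar on its component. -/
theorem seqGs_swap {k : ℕ} (w : ℕ → ℂ) (hk : k + 1 < 2 * n) {π : LinkPattern n} (hπ : π.pn k ≠ k + 1) :
    (q * w k - q⁻¹ * w (k + 1)) * seqGs n (fun j => w (Equiv.swap k (k + 1) j)) π =
      (q * w (k + 1) - q⁻¹ * w k) * seqGs n w π := by
  obtain ⟨n, rfl⟩ : ∃ m, n = m + 1 := ⟨n - 1, by omega⟩
  set κ : Fin (2 * n + 1) := ⟨k, by omega⟩ with hκ
  have h := congrFun (gs_exchange κ (w k) (w (k + 1)) fun l => w (skip κ l)) π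
  have hne : ∀ σ, LinkPattern.e κ σ ≠ π := by
    rintro σ rfl
    rw [LinkPattern.pn_e (by rw [hκ]; exact hk)] at hπ
    simp [LinkPattern.eFun, hκ] at hπ
  rw [Pi.add_apply, Pi.smul_apply, Pi.smul_apply, Pi.smul_apply, push_apply_eq_zero _ hne, smul_zero,
    add_zero, smul_eq_mul, smul_eq_mul] at h
  have h1 : ins2 κ (w k) (w (k + 1)) (fun l => w (skip κ l)) = fun p : Fin (2 * (n + 1)) => w p := by
    rw [eq_ins2 κ fun p : Fin (2 * (n + 1)) => w p]
    rfl
  have h2 : ins2 κ (w (k + 1)) (w k) (fun l => w (skip κ l)) =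
      fun p : Fin (2 * (n + 1)) => w (Equiv.swap k (k + 1) p) := by
    rw [eq_ins2 κ fun p : Fin (2 * (n + 1)) => w (Equiv.swap k (k + 1) p)]
    congr
    · exact (Equiv.swap_apply_left k (k + 1)).symm
    · exact (Equiv.swap_apply_right k (k + 1)).symm
    · funext l
      rw [Equiv.swap_apply_of_ne_of_ne]
      · exact fun h => skip_ne_pos κ l (Fin.ext h)
      · exact fun h => skip_ne_posSucc κ l (Fin.ext h)
  rw [h1, h2] at h
  exact h

/-- Scalar exchanges bring the two positions next to each other, where one coefficient vanishes.
Distinct cubes of the intermediate values keep the coefficients to be cancelled nonzero. -/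
theorem seqGs_eq_zero {i j : ℕ} (hij : i < j) (w : ℕ → ℂ) (hj : j < 2 * n) {π : LinkPattern n}
    (hπ : ∀ k, i ≤ k → k < j → π.pn k ≠ k + 1) (h0 : w i ≠ 0)
    (hw : ∀ k, i < k → k < j → w k ^ 3 ≠ w i ^ 3) (h : w j = q ^ 2 * w i) : seqGs n w π = 0 := by
  have h3 := q_pow_three
  obtain ⟨d, rfl⟩ := Nat.exists_eq_add_of_lt hij
  clear hij
  induction d generalizing w with
  | zero =>
    rw [add_zero] at *
    have h1 := seqGs_swap w hj (hπ i le_rfl (by omega))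
    rw [h, q_inv, show q * w i - q ^ 2 * (q ^ 2 * w i) = 0 by linear_combination - q * w i * h3, zero_mul,
      eq_comm, mul_eq_zero] at h1
    refine h1.resolve_left fun h4 => ?_
    have h5 : (1 - q ^ 2) * w i = 0 := by linear_combination h4 - w i * h3
    exact (mul_ne_zero (sub_ne_zero.2 q_sq_ne_one.symm) h0) h5
  | succ d ih =>
    have h1 := seqGs_swap w (k := i + d + 1) hj (hπ _ (by omega) (by omega))
    have hs : ∀ k, k < i + d + 1 → Equiv.swap (i + d + 1) (i + d + 1 + 1) k = k := fun k hk =>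
      Equiv.swap_apply_of_ne_of_ne (by omega) (by omega)
    rw [ih (fun j => w (Equiv.swap (i + d + 1) (i + d + 1 + 1) j)) ?_ (by omega)
      (fun k hk hk' => hπ k hk (by omega)) ?_ ?_, mul_zero, eq_comm, mul_eq_zero] at h1
    · refine h1.resolve_left fun h4 => hw (i + d + 1) (by omega) (by omega) ?_
      have h4' : q * (q ^ 2 * w i) - q ^ 2 * w (i + d + 1) = 0 := by
        rw [← h, ← q_inv]
        exact h4
      have h5 : w (i + d + 1) = q * w i := by
        linear_combination (-q) * h4' - (w (i + d + 1) - q * w i) * h3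
      rw [h5]
      linear_combination w i ^ 3 * h3
    · simpa only [hs i (by omega)] using h0
    · intro k hk hk'
      simp only [hs i (by omega), hs k hk']
      exact hw k hk (by omega)
    · simp only [hs i (by omega), Equiv.swap_apply_left]
      exact h

theorem seqGs_restrict (k : Fin (2 * n + 1)) (x : ℂ) (w w' : ℕ → ℂ) (π : LinkPattern n)
    (hlt : ∀ p < k.val, w p = w' p) (hge : ∀ p, k.val ≤ p → w (p + 2) = w' p) (hk : w k = x)
    (hk' : w (k + 1) = q ^ 2 * x) :
    seqGs (n + 1) w (LinkPattern.ins k π) = (∏ l ∈ Finset.range (2 * n), (w' l - q * x)) * seqGs n w' π := by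
  have h := congrFun (gs_restrict k x fun l => w' l) (LinkPattern.ins k π)
  rw [Pi.smul_apply, push_inj_apply (LinkPattern.ins_injective k), smul_eq_mul,
    Fin.prod_univ_eq_prod_range fun l => w' l - q * x] at h
  have h1 : (fun p : Fin (2 * (n + 1)) => w p) = ins2 k x (q ^ 2 * x) (fun l : Fin (2 * n) => w' l) := by
    have h2 : (fun l => w (skip k l)) = fun l : Fin (2 * n) => w' l := by
      funext l
      rw [skip_val]
      split_ifs with hl
      · exact hlt _ hl
      · exact hge _ (by omega)
    rw [eq_ins2 k fun p : Fin (2 * (n + 1)) => w p, ← hk', ← hk, ← h2]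
    rfl
  rw [seqGs, seqGs, ← h, h1]

end

/-! ### The identity for $c=0$ and at the special values of the last $\beta$ -/

section

open MvPolynomial (eval degreeOf aeval)

variable {a b c : ℕ}

/-- The values of the spectral parameters. -/
def spec (a b c : ℕ) (A B G : ℕ → ℂ) (p : ℕ) : ℂ :=
  if p < a + b then q ^ 2 * G p
  else if p - (a + b) < a + c then q * B (p - (a + b)) else A (p - (a + b) - (a + c))

theorem spec_gamma {A B G : ℕ → ℂ} {k : ℕ} (h : k < a + b) : spec a b c A B G k = q ^ 2 * G k :=
  if_pos h

theorem spec_beta {A B G : ℕ → ℂ} {j : ℕ} (h : j < a + c) : spec a b c A B G (a + b + j) = q * B j := by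
  rw [spec, if_neg (by omega), if_pos (by omega), Nat.add_sub_cancel_left]

theorem spec_alpha {A B G : ℕ → ℂ} (i : ℕ) : spec a b c A B G (a + b + (a + c) + i) = A i := by
  rw [spec, if_neg (by omega), if_neg (by omega)]
  congr 1
  omega

/-- The identity between the component on three sets of nested arches and the partition function,
at given values of the parameters. -/
def Identity (a b c : ℕ) (A B G : ℕ → ℂ) : Prop :=
  seqGs (a + b + c) (spec a b c A B G) (threeArches a b c) =
    phase a b c * (qvand (b + c) A * qvand (a + c) B * qvand (a + b) G) * pf a b c A B G

theorem pn_threeArches {j : ℕ} (h : j < 2 * (a + b + c)) :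
    (threeArches a b c).pn j = threePartner a b c j := LinkPattern.pn_of_lt _ h

theorem threeArches_zero (a b : ℕ) : threeArches a b 0 = nested (a + b) := by
  refine LinkPattern.ext_pn fun j hj => ?_
  rw [pn_threeArches (c := 0) hj, LinkPattern.pn_of_lt _ hj]
  simp only [nested, Fin.val_rev, threePartner]
  split_ifs <;> omega

/-- The new innermost arch joins the last $\beta$ point to the first $\alpha$ point. -/
theorem threeArches_succ (a b c : ℕ) : threeArches a b (c + 1) =
    LinkPattern.ins ⟨a + b + (a + c), by omega⟩ (threeArches a b c) := by
  refine LinkPattern.ext_pn fun j hj => ?_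
  rw [pn_threeArches (c := c + 1) hj, LinkPattern.pn_ins]
  simp only [LinkPattern.insFun]
  have h1 : ∀ j, j < 2 * (a + b + c) → (threeArches a b c).pn j = threePartner a b c j :=
    fun j hj => pn_threeArches hj
  split_ifs with h2 h3 h4 h5 h6
  all_goals first
    | (simp only [threePartner]; split_ifs <;> omega)
    | (rw [h1 _ (by omega)] at *; simp only [threePartner] at *; split_ifs at * <;> omega)

theorem phase_succ (a b c : ℕ) : (-q ^ 2) ^ (a + b) * (-q) ^ (b + c) * phase a b c =
    (-1) ^ b * phase a b (c + 1) := by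
  have h3 := q_pow_three
  have h1 : (a + b + (c + 1)) * (a + b + (c + 1) - 1) / 2 = (a + b + c) * (a + b + c - 1) / 2 + (a + b + c) := by
    have := Nat.triangle_succ (a + b + c)
    simpa [add_assoc, Nat.succ_eq_add_one] using this
  have h2 : 2 * ((c + 1) * (a + (c + 1) - 1)) = 2 * (c * (a + c - 1)) + 2 * a + 4 * c := by
    rcases c with _ | c
    · simp
    · rw [show a + (c + 1 + 1) - 1 = a + c + 1 by omega, show a + (c + 1) - 1 = a + c by omega]
      ring
  have h4 : ∀ m, q ^ (3 * m) = 1 := fun m => by rw [pow_mul, h3, one_pow]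
  have h5 : (-1 : ℂ) ^ b * (-1) ^ b = 1 := by rw [← mul_pow]; simp
  rw [phase, phase, h1, h2, neg_pow, neg_pow q]
  have h6 : (q ^ 2) ^ (a + b) * q ^ (b + c) = q ^ (2 * a + c) * q ^ (3 * b) := by ring
  have h7 : q ^ (b * (a + b - 1) + (2 * (c * (a + c - 1)) + 2 * a + 4 * c)) =
      q ^ (b * (a + b - 1) + 2 * (c * (a + c - 1))) * q ^ (2 * a + c) * q ^ (3 * c) := by ring
  rw [h4, mul_one] at h6 h7
  rw [h7]
  linear_combination ((-1) ^ (a + b) * (-1) ^ (b + c) *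
    (-1) ^ ((a + b + c) * (a + b + c - 1) / 2 + a * b) *
    q ^ (b * (a + b - 1) + 2 * (c * (a + c - 1)))) * h6

theorem phase_zero (a b : ℕ) : (-1) ^ ((a + b) * (a + b - 1) / 2) *
    ((q ^ 2) ^ ((a + b) * (a + b - 1) / 2) * (q ^ (a * (a - 1) / 2) * (-q ^ 2) ^ (b * a))) = phase a b 0 := by
  have h3 := q_pow_three
  have h4 : ∀ m, q ^ (3 * m) = 1 := fun m => by rw [pow_mul, h3, one_pow]
  rw [phase, neg_pow (q ^ 2), ← pow_mul, ← pow_mul]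
  have h1 : 2 * ((a + b) * (a + b - 1) / 2) = (a + b) * (a + b - 1) :=
    Nat.two_mul_div_two_of_even (Nat.even_mul_pred_self _)
  have h2 : 2 * (a * (a - 1) / 2) = a * (a - 1) := Nat.two_mul_div_two_of_even (Nat.even_mul_pred_self _)
  have h5 : (a + b) * (a + b - 1) + a * (a - 1) / 2 + 2 * (b * a) =
      b * (a + b - 1) + 3 * (a * b + a * (a - 1) / 2) := by
    rcases a with _ | a
    · simp
    · rw [show a + 1 + b - 1 = a + b by omega]
      rw [Nat.add_sub_cancel] at *
      have : (a + 1 + b) * (a + b) = b * (a + b) + (a + 1) * a + (a + 1) * b := by ring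
      have : (a + 1) * b = b * (a + 1) := mul_comm _ _
      omega
  have h6 : q ^ ((a + b) * (a + b - 1)) * q ^ (a * (a - 1) / 2) * q ^ (2 * (b * a)) = q ^ (b * (a + b - 1)) := by
    rw [← pow_add, ← pow_add, h5, pow_add, h4, mul_one]
  rw [h1, ← mul_comm b a]
  simp only [add_zero, zero_mul, mul_zero]
  rw [← h6]
  ring

/-- The component is the explicit product for nested arches: one half consists of the $\gamma$ and
the other of the $\beta$ followed by the $\alpha$. The mixed factors
$q^2\beta_j-q^{-1}\alpha_i=-q^2(\alpha_i-\beta_j)$ form the partition function. -/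
theorem identity_zero (a b : ℕ) (A B G : ℕ → ℂ) : Identity a b 0 A B G := by
  have h0 : ∀ p < 2 * (a + b), extz (fun p : Fin (2 * (a + b)) => spec a b 0 A B G p) p = spec a b 0 A B G p :=
    fun p hp => extz_of_lt _ hp
  rw [Identity, threeArches_zero, pf_zero, ← phase_zero]
  have h1 : seqGs (a + b) (spec a b 0 A B G) (nested (a + b)) = (-1) ^ ((a + b) * (a + b - 1) / 2) *
      (qvand (a + b) (spec a b 0 A B G) * qvand (a + b) fun i => spec a b 0 A B G (a + b + i)) := by
    rw [seqGs, gs, groundState_nested, map_mul, eval_nestedPoly, qvand, qvand, ← Finset.prod_mul_distrib]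
    congr 1
    · simp
    · refine Finset.prod_congr rfl fun j hj => ?_
      rw [← Finset.prod_mul_distrib]
      refine Finset.prod_congr rfl fun i hi => ?_
      rw [Finset.mem_range] at hi hj
      rw [h0 _ (by omega), h0 _ (by omega), h0 _ (by omega), h0 _ (by omega)]
  have h2 : qvand (a + b) (spec a b 0 A B G) = (q ^ 2) ^ ((a + b) * (a + b - 1) / 2) * qvand (a + b) G := by
    rw [← qvand_smul]
    exact qvand_congr fun i hi => spec_gamma hi
  have h3 : (qvand (a + b) fun i => spec a b 0 A B G (a + b + i)) =
      q ^ (a * (a - 1) / 2) * qvand a B * qvand b A *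
      ((-q ^ 2) ^ (b * a) * ∏ i ∈ Finset.range b, ∏ j ∈ Finset.range a, (A i - B j)) := by
    rw [qvand_add, ← qvand_smul]
    congr 1
    · congr 1
      · exact qvand_congr fun i hi => spec_beta hi
      · exact qvand_congr fun i hi => by rw [← add_assoc]; exact spec_alpha i
    · have : (-q ^ 2) ^ (b * a) = ∏ _i ∈ Finset.range b, ∏ _j ∈ Finset.range a, (-q ^ 2) := by
        simp [← pow_mul, mul_comm]
      rw [this, ← Finset.prod_mul_distrib]
      refine Finset.prod_congr rfl fun i hi => ?_
      rw [← Finset.prod_mul_distrib]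
      refine Finset.prod_congr rfl fun j hj => ?_
      rw [Finset.mem_range] at hj
      rw [spec_beta (c := 0) hj, ← add_assoc, show a + b + a + i = a + b + (a + 0) + i from rfl, spec_alpha,
        q_inv]
      ring
  refine h1.trans ?_
  rw [h2, h3, add_zero, add_zero]
  ring

/-- When $\alpha_1$ equals the last $\beta$, their spectral values have ratio $q^2$ and the
innermost arch can be removed. The resulting product provides the factors of `pf_corner` and the new
factors of the $q$-Vandermonde products. -/
theorem identity_corner {A B G : ℕ → ℂ} (ih : Identity a b c (fun i => A (i + 1)) B G) (h : A 0 = B (a + c)) :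
    Identity a b (c + 1) A B G := by
  have h3 := q_pow_three
  have h1 := seqGs_restrict (n := a + b + c) ⟨a + b + (a + c), by omega⟩ (q * A 0) (spec a b (c + 1) A B G)
    (spec a b c (fun i => A (i + 1)) B G) (threeArches a b c) (fun p hp => ?_) (fun p hp => ?_) ?_ ?_
  · rw [Identity, threeArches_succ]
    refine h1.trans ?_
    rw [ih, pf_corner a b c A B G h, ← add_assoc b c 1, ← add_assoc a c 1, qvand_succ', qvand_succ _ B,
      show 2 * (a + b + c) = a + b + (a + c) + (b + c) by ring, Finset.prod_range_add, Finset.prod_range_add]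
    have h4 : ∏ k ∈ Finset.range (a + b), (spec a b c (fun i => A (i + 1)) B G k - q * (q * A 0)) =
        (-q ^ 2) ^ (a + b) * ∏ k ∈ Finset.range (a + b), (A 0 - G k) := by
      rw [← Finset.card_range (a + b), ← Finset.prod_const, Finset.card_range, ← Finset.prod_mul_distrib]
      refine Finset.prod_congr rfl fun k hk => ?_
      rw [spec_gamma (Finset.mem_range.1 hk)]
      ring
    have h5 : ∏ j ∈ Finset.range (a + c), (spec a b c (fun i => A (i + 1)) B G (a + b + j) - q * (q * A 0)) =
        ∏ j ∈ Finset.range (a + c), (q * B j - q⁻¹ * B (a + c)) := by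
      refine Finset.prod_congr rfl fun j hj => ?_
      rw [spec_beta (Finset.mem_range.1 hj), q_inv, h]
      ring
    have h6 : ∏ i ∈ Finset.range (b + c),
        (spec a b c (fun i => A (i + 1)) B G (a + b + (a + c) + i) - q * (q * A 0)) =
        (-q) ^ (b + c) * ∏ i ∈ Finset.range (b + c), (q * A 0 - q⁻¹ * A (i + 1)) := by
      rw [← Finset.card_range (b + c), ← Finset.prod_const, Finset.card_range, ← Finset.prod_mul_distrib]
      refine Finset.prod_congr rfl fun k hk => ?_
      rw [spec_alpha, q_inv]
      linear_combination - A (k + 1) * h3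
    rw [h4, h5, h6]
    linear_combination ((∏ k ∈ Finset.range (a + b), (A 0 - G k)) *
      (∏ j ∈ Finset.range (a + c), (q * B j - q⁻¹ * B (a + c))) *
      (∏ i ∈ Finset.range (b + c), (q * A 0 - q⁻¹ * A (i + 1))) *
      ((qvand (b + c) fun i => A (i + 1)) * qvand (a + c) B * qvand (a + b) G) *
      pf a b c (fun i => A (i + 1)) B G) * phase_succ a b c
  · have hp : p < a + b + (a + c) := hp
    by_cases hp' : p < a + b
    · rw [spec_gamma hp', spec_gamma hp']
    · obtain ⟨j, rfl⟩ := Nat.exists_eq_add_of_le (not_lt.1 hp')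
      rw [spec_beta (by omega), spec_beta (by omega)]
  · obtain ⟨i, rfl⟩ := Nat.exists_eq_add_of_le hp
    rw [spec_alpha, show a + b + (a + c) + i + 2 = a + b + (a + (c + 1)) + (i + 1) by omega, spec_alpha]
  · rw [h]
    exact spec_beta (by omega)
  · refine (spec_alpha (a := a) (b := b) (c := c + 1) 0).trans ?_
    linear_combination - A 0 * h3

theorem identity_swap {A B G : ℕ → ℂ} {i : ℕ} (hi : i + 1 < b + c)
    (h : Identity a b c (fun j => A (Equiv.swap i (i + 1) j)) B G)
    (hA : q * A (i + 1) - q⁻¹ * A i ≠ 0) : Identity a b c A B G := by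
  have hs := seqGs_swap (n := a + b + c) (spec a b c A B G) (k := a + b + (a + c) + i) (by omega)
    (π := threeArches a b c) (by
      rw [pn_threeArches (by omega)]
      simp only [threePartner]
      split_ifs <;> omega)
  have h1 : (fun j => spec a b c A B G (Equiv.swap (a + b + (a + c) + i) (a + b + (a + c) + i + 1) j)) =
      spec a b c (fun j => A (Equiv.swap i (i + 1) j)) B G := by
    funext p
    by_cases hp : p < a + b + (a + c)
    · rw [Equiv.swap_apply_of_ne_of_ne (by omega) (by omega)]
      by_cases hp' : p < a + b
      · rw [spec_gamma hp', spec_gamma hp']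
      · obtain ⟨j, rfl⟩ := Nat.exists_eq_add_of_le (not_lt.1 hp')
        rw [spec_beta (by omega), spec_beta (by omega)]
    · obtain ⟨l, rfl⟩ := Nat.exists_eq_add_of_le (not_lt.1 hp)
      rw [spec_alpha, ← spec_alpha (a := a) (b := b) (c := c) (A := A) (B := B) (G := G)]
      congr 1
      simp only [Equiv.swap_apply_def]
      split_ifs <;> omega
  rw [h1, h, spec_alpha, add_assoc (a + b + (a + c)) i 1, spec_alpha, pf_swap _ _ _ hi] at hs
  refine mul_left_cancel₀ hA (hs.symm.trans ?_)
  linear_combination (phase a b c * qvand (a + c) B * qvand (a + b) G * pf a b c A B G) * qvand_swap hi A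

/-- Symmetry in $\alpha$ moves the index `i` down to `0`, one neighbour at a time. -/
theorem identity_node {A B G : ℕ → ℂ} (ih : ∀ A B G, Identity a b c A B G) {i : ℕ} (hi : i < b + c + 1)
    (hA : ∀ i j, i < j → j < b + c + 1 → A i ^ 3 ≠ A j ^ 3) (h : A i = B (a + c)) :
    Identity a b (c + 1) A B G := by
  have h3 := q_pow_three
  have hne : ∀ i j, i ≠ j → i < b + c + 1 → j < b + c + 1 → A i ^ 3 ≠ A j ^ 3 := by
    intro i j hij hi hj
    rcases lt_or_gt_of_ne hij with h | h
    · exact hA i j h hj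
    · exact (hA j i h hi).symm
  clear hA
  induction i generalizing A with
  | zero => exact identity_corner (ih _ _ _) h
  | succ i IH =>
    refine identity_swap (i := i) hi (IH (by omega) ?_ ?_) fun h4 => ?_
    · rw [Equiv.swap_apply_left]; exact h
    · intro j l hjl hj hl
      refine hne _ _ (fun h => hjl ((Equiv.swap i (i + 1)).injective h)) ?_ ?_
      all_goals
        rw [Equiv.swap_apply_def]
        split_ifs <;> omega
    · refine hne (i + 1) i (by omega) (by omega) (by omega) ?_
      rw [q_inv] at h4
      have h5 : A (i + 1) = q * A i := by linear_combination q ^ 2 * h4 - (A (i + 1) - q * A i) * h3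
      rw [h5]
      linear_combination A i ^ 3 * h3

end

/-! ### Interpolation in the last $\beta$ and conclusion -/

section

open MvPolynomial (eval degreeOf aeval)

variable {a b c : ℕ}

/-- The two sides of the identity, as a function of the last of the `β`, are polynomials. -/
theorem exists_polynomial (A B G : ℕ → ℂ) : ∃ p : Polynomial ℂ, p.natDegree ≤ a + b + c ∧
    ∀ y, p.eval y = 0 ↔ Identity a b (c + 1) A (Function.update B (a + c) y) G := by
  set κ : ℕ := a + b + (a + c) with hκ
  set P : Polynomial ℂ := aeval (fun p : Fin (2 * (a + b + (c + 1))) =>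
    if p.val = κ then Polynomial.C q * Polynomial.X else Polynomial.C (spec a b (c + 1) A B G p))
    (groundState (threeArches a b (c + 1))) with hP
  set V : Polynomial ℂ := ∏ i ∈ Finset.range (a + c),
    (Polynomial.C (q * B i) - Polynomial.C q⁻¹ * Polynomial.X) with hV
  set Q : Polynomial ℂ := aeval (fun v : Fin (b + (c + 1)) ⊕ Fin (a + (c + 1)) ⊕ Fin (a + b) =>
    if v = .inr (.inl ⟨a + c, by omega⟩) then Polynomial.X else Polynomial.C (params a b (c + 1) A B G v))
    (partitionFunction a b (c + 1)) with hQ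
  set s : ℂ := phase a b (c + 1) * (qvand (b + (c + 1)) A * qvand (a + c) B * qvand (a + b) G) with hs
  have hlin : ∀ u v : ℂ, (Polynomial.C u - Polynomial.C v * Polynomial.X).natDegree ≤ 1 := fun u v =>
    (Polynomial.natDegree_sub_le _ _).trans (by
      simpa using Polynomial.natDegree_C_mul_le v Polynomial.X)
  -- The degree is at most $n-1=a+b+c$ for the component; on the other side $a+c$ comes from the
  -- $q$-Vandermonde product and $b$ from the partition function.
  have dP : P.natDegree ≤ a + b + c := by
    refine (natDegree_aeval_le _ _).trans ?_
    rw [Finset.sum_eq_single ⟨κ, by omega⟩]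
    · have h1 := (isWheel_groundState (threeArches a b (c + 1))).degree ⟨κ, by omega⟩
      rw [if_pos rfl]
      have h2 := (Polynomial.natDegree_C_mul_le q Polynomial.X).trans_eq Polynomial.natDegree_X
      calc _ ≤ (a + b + c) * 1 := Nat.mul_le_mul (by omega) h2
        _ = _ := mul_one _
    · intro p _ hp
      rw [if_neg fun h => hp (Fin.ext h), Polynomial.natDegree_C, mul_zero]
    · exact fun h => absurd (Finset.mem_univ _) h
  have dV : V.natDegree ≤ a + c := by
    refine (Polynomial.natDegree_prod_le _ _).trans ((Finset.sum_le_sum fun i _ => hlin _ _).trans ?_)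
    simp
  have dQ : Q.natDegree ≤ b := by
    refine (natDegree_aeval_le _ _).trans ?_
    rw [Finset.sum_eq_single (.inr (.inl ⟨a + c, by omega⟩))]
    · rw [if_pos rfl, Polynomial.natDegree_X, mul_one]
      exact degreeOf_partitionFunction_le _ rfl
    · intro p _ hp
      rw [if_neg hp, Polynomial.natDegree_C, mul_zero]
    · exact fun h => absurd (Finset.mem_univ _) h
  refine ⟨P - Polynomial.C s * (V * Q), ?_, fun y => ?_⟩
  · refine (Polynomial.natDegree_sub_le _ _).trans (max_le dP ?_)
    refine (Polynomial.natDegree_C_mul_le _ _).trans (Polynomial.natDegree_mul_le.trans ?_)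
    omega
  · have eP : P.eval y = seqGs (a + b + (c + 1)) (spec a b (c + 1) A (Function.update B (a + c) y) G)
        (threeArches a b (c + 1)) := by
      rw [hP, eval_aeval_polynomial, seqGs, gs]
      congr 2
      funext p
      by_cases hp : p.val = κ
      · rw [if_pos hp, hp, hκ, spec_beta (by omega), Function.update_self]
        simp
      · rw [if_neg hp, Polynomial.eval_C]
        unfold spec
        split_ifs with h1 h2
        · rfl
        · rw [Function.update_of_ne (by omega)]
        · rfl
    have eV : qvand (a + (c + 1)) (Function.update B (a + c) y) = qvand (a + c) B * V.eval y := by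
      rw [← add_assoc, qvand_succ, Function.update_self, hV, Polynomial.eval_prod]
      congr 1
      · exact qvand_congr fun i hi => Function.update_of_ne hi.ne _ _
      · refine Finset.prod_congr rfl fun i hi => ?_
        rw [Function.update_of_ne (Finset.mem_range.1 hi).ne]
        simp
    have eQ : Q.eval y = pf a b (c + 1) A (Function.update B (a + c) y) G := by
      rw [hQ, eval_aeval_polynomial, pf]
      congr 2
      funext v
      rcases v with i | j | k
      · simp [params]
      · by_cases hj : j = ⟨a + c, by omega⟩
        · subst hj
          simp [params]
        · rw [if_neg (by simpa using hj), Polynomial.eval_C]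
          exact (Function.update_of_ne (fun h => hj (Fin.ext h)) _ _).symm
      · simp [params]
    rw [Polynomial.eval_sub, Polynomial.eval_mul, Polynomial.eval_mul, Polynomial.eval_C, sub_eq_zero,
      Identity, eP, eQ, eV, hs]
    refine Eq.congr rfl ?_
    ring

/-- Two polynomials of degree at most $a+b+c$ in `y` agree at $a+b+2c+1$ values. At $y=\alpha_i$
this is `identity_node`. At $y=q^2\beta_j$ both sides vanish, the component by `seqGs_eq_zero`
because no little arch lies among the $\beta$ points. -/
theorem identity_update {A B G : ℕ → ℂ} (ih : ∀ A B G, Identity a b c A B G)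
    (hA : ∀ i j, i < j → j < b + c + 1 → A i ^ 3 ≠ A j ^ 3)
    (hB : ∀ i j, i < j → j < a + c → B i ^ 3 ≠ B j ^ 3) (hB0 : ∀ j < a + c, B j ≠ 0)
    (hAB : ∀ i < b + c + 1, ∀ j < a + c, A i ^ 3 ≠ B j ^ 3) (y : ℂ) :
    Identity a b (c + 1) A (Function.update B (a + c) y) G := by
  have h3 := q_pow_three
  obtain ⟨p, hp, hpe⟩ := exists_polynomial (a := a) (b := b) (c := c) A B G
  have hq3 : ∀ x : ℂ, (q ^ 2 * x) ^ 3 = x ^ 3 := fun x => by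
    linear_combination (q ^ 3 + 1) * x ^ 3 * h3
  have hinj : ∀ (m : ℕ) (x : ℕ → ℂ), (∀ i j, i < j → j < m → x i ^ 3 ≠ x j ^ 3) →
      ∀ i j : Fin m, x i ^ 3 = x j ^ 3 → i = j := by
    intro m x hx i j hij
    by_contra hne
    rcases lt_or_gt_of_ne hne with h | h
    · exact hx i j h j.2 hij
    · exact hx j i h i.2 hij.symm
  have h0 : p = 0 := by
    refine polynomial_eq_zero_of_roots
      (r := Sum.elim (fun j : Fin (a + c) => q ^ 2 * B j) fun i : Fin (b + c + 1) => A i) ?_ ?_ ?_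
    · rintro (i | i) (j | j) hij <;> replace hij := congrArg (· ^ 3) hij <;>
        simp only [Sum.elim_inl, Sum.elim_inr, hq3] at hij
      · rw [hinj _ _ hB i j hij]
      · exact absurd hij.symm (hAB j j.2 i i.2)
      · exact absurd hij (hAB i i.2 j j.2)
      · rw [hinj _ _ hA i j hij]
    · rintro (j | i)
      · rw [Sum.elim_inl, hpe, Identity, seqGs_eq_zero (i := a + b + j) (j := a + b + (a + c)) (by omega) _
          (by omega), ← add_assoc a c 1, qvand_succ _ (Function.update _ _ _),
          Finset.prod_eq_zero (Finset.mem_range.2 j.2)]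
        · ring
        · rw [Function.update_self, Function.update_of_ne j.2.ne, q_inv]
          linear_combination - q * B j * h3
        · intro k hk hk'
          rw [pn_threeArches (by omega)]
          simp only [threePartner]
          split_ifs <;> omega
        · rw [spec_beta (by omega), Function.update_of_ne j.2.ne]
          exact mul_ne_zero q_ne_zero (hB0 j j.2)
        · intro k hk hk'
          obtain ⟨l, rfl⟩ := Nat.exists_eq_add_of_le (show a + b ≤ k by omega)
          rw [spec_beta (by omega), spec_beta (by omega), Function.update_of_ne j.2.ne,
            Function.update_of_ne (by omega), mul_pow, mul_pow, h3, one_mul, one_mul]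
          exact (hB j l (by omega) (by omega)).symm
        · rw [spec_beta (by omega), spec_beta (by omega), Function.update_self, Function.update_of_ne j.2.ne]
          ring
      · rw [Sum.elim_inr, hpe]
        exact identity_node ih i.2 hA (Function.update_self (a + c) (A i) B).symm
    · rw [Fintype.card_sum, Fintype.card_fin, Fintype.card_fin]
      omega
  rw [← hpe, h0, Polynomial.eval_zero]

theorem eval_qVandermonde {σ : Type*} {m : ℕ} (z : σ → ℂ) (x : Fin m → MvPolynomial σ ℂ) (y : ℕ → ℂ)
    (h : ∀ i, eval z (x i) = y i) : eval z (qVandermonde x) = qvand m y := by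
  rw [qVandermonde, Finset.prod_filter, Fintype.prod_prod_type_right, map_prod, qvand,
    ← Fin.prod_univ_eq_prod_range (fun j => ∏ i ∈ Finset.range j, (q * y i - q⁻¹ * y j))]
  refine Finset.prod_congr rfl fun j _ => ?_
  have h1 : Finset.range j = (Finset.range m).filter (· < j.val) := by
    ext i
    have := j.2
    simp only [Finset.mem_range, Finset.mem_filter]
    omega
  rw [map_prod, h1, Finset.prod_filter,
    ← Fin.prod_univ_eq_prod_range (fun i => if i < j.val then q * y i - q⁻¹ * y j else 1)]
  refine Finset.prod_congr rfl fun i _ => ?_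
  by_cases hij : i < j
  · rw [if_pos hij, if_pos (Fin.lt_def.1 hij)]
    simp [h]
  · rw [if_neg hij, if_neg (fun h => hij (Fin.lt_def.2 h)), map_one]

theorem eval_spectral (A B G : ℕ → ℂ) (p : Fin (2 * (a + b + c))) :
    eval (params a b c A B G) (spectral a b c p) = spec a b c A B G p := by
  unfold spectral spec
  split_ifs <;> simp [params, α, β, γ]

theorem eval_component (A B G : ℕ → ℂ) :
    eval (params a b c A B G) (aeval (spectral a b c) (groundState (threeArches a b c))) =
      seqGs (a + b + c) (spec a b c A B G) (threeArches a b c) := by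
  rw [eval_aeval, seqGs, gs]
  congr 2
  exact funext fun p => eval_spectral A B G p

/-- The product of the explicit factors of the component. -/
def prefactor (a b c : ℕ) : ParamPoly a b c :=
  MvPolynomial.C (phase a b c) *
    (qVandermonde (α : Fin (b + c) → ParamPoly a b c) *
      qVandermonde (β : Fin (a + c) → ParamPoly a b c) *
      qVandermonde (γ : Fin (a + b) → ParamPoly a b c))

theorem eval_prefactor (A B G : ℕ → ℂ) : eval (params a b c A B G) (prefactor a b c) =
    phase a b c * (qvand (b + c) A * qvand (a + c) B * qvand (a + b) G) := by
  rw [prefactor, map_mul, map_mul, map_mul, MvPolynomial.eval_C,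
    eval_qVandermonde _ α A fun i => MvPolynomial.eval_X _,
    eval_qVandermonde _ β B fun i => MvPolynomial.eval_X _,
    eval_qVandermonde _ γ G fun i => MvPolynomial.eval_X _]

theorem identity_iff (A B G : ℕ → ℂ) : Identity a b c A B G ↔ eval (params a b c A B G)
    (aeval (spectral a b c) (groundState (threeArches a b c)) - prefactor a b c * partitionFunction a b c) = 0 := by
  rw [map_sub, map_mul, eval_prefactor, eval_component, sub_eq_zero]
  rfl

theorem params_extz (z : Fin (b + c) ⊕ Fin (a + c) ⊕ Fin (a + b) → ℂ) :
    params a b c (extz fun i => z (.inl i)) (extz fun j => z (.inr (.inl j)))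
      (extz fun k => z (.inr (.inr k))) = z := by
  funext v
  rcases v with i | j | k
  · exact extz_of_lt (fun i => z (.inl i)) i.2
  · exact extz_of_lt (fun j => z (.inr (.inl j))) j.2
  · exact extz_of_lt (fun k => z (.inr (.inr k))) k.2

theorem identity (a b c : ℕ) (A B G : ℕ → ℂ) : Identity a b c A B G := by
  induction c generalizing A B G with
  | zero => exact identity_zero a b A B G
  | succ c ih =>
    rw [identity_iff, eq_zero_of_generic (P := _ - _), map_zero]
    intro z hz
    have hA : ∀ i (hi : i < b + (c + 1)), extz (fun i => z (.inl i)) i = z (.inl ⟨i, hi⟩) := fun i hi =>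
      extz_of_lt _ hi
    have hB : ∀ j (hj : j < a + (c + 1)), extz (fun j => z (.inr (.inl j))) j = z (.inr (.inl ⟨j, hj⟩)) :=
      fun j hj => extz_of_lt _ hj
    rw [← params_extz z, ← identity_iff,
      -- The last $\beta$ is regarded as an updated value, so that the interpolation applies at a
      -- generic point.
      ← Function.update_eq_self (a + c) (extz fun j => z (.inr (.inl j)))]
    refine identity_update ih (fun i j hij hj => ?_) (fun i j hij hj => ?_) (fun j hj => ?_)
      (fun i hi j hj => ?_) _
    · rw [hA i (by omega), hA j hj]
      exact hz.2 _ _ (by simpa using hij.ne)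
    · rw [hB i (by omega), hB j (by omega)]
      exact hz.2 _ _ (by simpa using hij.ne)
    · rw [hB j (by omega)]
      exact hz.1 _
    · rw [hA i hi, hB j (by omega)]
      exact hz.2 _ _ (by simp)

theorem isReducedComponent_partitionFunction (a b c : ℕ) :
    IsReducedComponent a b c groundState (partitionFunction a b c) := by
  refine sub_eq_zero.1 (MvPolynomial.funext fun z => ?_)
  rw [map_zero, ← params_extz z]
  exact (identity_iff _ _ _).1 (identity _ _ _ _ _ _)

theorem qVandermonde_X_ne_zero {σ : Type*} {m : ℕ} {f : Fin m → σ} (hf : Function.Injective f) :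
    qVandermonde (fun i => MvPolynomial.X (f i)) ≠ 0 := by
  classical
  refine Finset.prod_ne_zero_iff.2 fun p hp h => ?_
  rw [Finset.mem_filter] at hp
  have h1 := congrArg (eval fun v => if v = f p.1 then (1 : ℂ) else 0) h
  have h2 : f p.2 ≠ f p.1 := hf.ne hp.2.ne'
  simp [h2, q_ne_zero] at h1

theorem prefactor_ne_zero (a b c : ℕ) : prefactor a b c ≠ 0 := by
  refine mul_ne_zero ?_ (mul_ne_zero (mul_ne_zero ?_ ?_) ?_)
  · rw [Ne, MvPolynomial.C_eq_zero]
    exact mul_ne_zero (pow_ne_zero _ (by norm_num)) (pow_ne_zero _ q_ne_zero)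
  · exact qVandermonde_X_ne_zero Sum.inl_injective
  · exact qVandermonde_X_ne_zero (Sum.inr_injective.comp Sum.inl_injective)
  · exact qVandermonde_X_ne_zero (Sum.inr_injective.comp Sum.inr_injective)

/-- Uniqueness of $\Phi$ is cancellation of the prefactor, which is nonzero in a domain. -/
theorem isReducedComponent_iff (Φ : ParamPoly a b c) :
    IsReducedComponent a b c groundState Φ ↔ Φ = partitionFunction a b c := by
  constructor
  · intro h
    exact mul_left_cancel₀ (prefactor_ne_zero a b c)
      (h.symm.trans (isReducedComponent_partitionFunction a b c))
  · rintro rfl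
    exact isReducedComponent_partitionFunction a b c

end

end LoopModel

end

open LoopModel in
theorem mainTheorem2 (a b c : ℕ) :
    (∃! Ψ : LinkPattern (a + b + c) → MvPolynomial (Fin (2 * (a + b + c))) ℂ,
      IsGroundState (a + b + c) Ψ) ∧
    ∀ Ψ : LinkPattern (a + b + c) → MvPolynomial (Fin (2 * (a + b + c))) ℂ,
      IsGroundState (a + b + c) Ψ →
        ∀ Φ : ParamPoly a b c,
          IsReducedComponent a b c Ψ Φ ↔ Φ = partitionFunction a b c := by
  refine ⟨⟨groundState, isGroundState_groundState _, fun Ψ h => ?_⟩, fun Ψ h Φ => ?_⟩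
  · exact (isGroundState_groundState _).unique h
  · rw [(isGroundState_groundState _).unique h]
    exact isReducedComponent_iff Φ
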